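/- Let $K$ be a number field with ring of integers $\mathcal O_K$, and let $\overline{\mathcal E}$ be a Hermitian vector bundle of rank $n+1$ over $\operatorname{Spec}\mathcal O_K$: a projective $\mathcal O_K$-module $\mathcal E$ of rank $n+1$ with, for every infinite place $v$, a Hermitian norm on $\mathcal E_v=\mathcal E\otimes_{\mathcal O_K,v}\mathbb C$ invariant under $\operatorname{Gal}(\mathbb C/K_v)$. For $D\in\mathbb N$ let $E_D=H^0(\mathbb P(\mathcal E),\mathcal O(D))=\operatorname{Sym}^D(\mathcal E)$, of rank $r(n,D)=\binom{n+D}{n}$, and $E_{D,v}=E_D\otimes_{\mathcal O_K,v}\mathbb C$. For an infinite place $v$, let $\|\cdot\|_{\mathrm{sym},v}$ (the Bombieri norm) be the quotient norm on $E_{D,v}$ of the tensor product norm under $\mathcal E_v^{\otimes D}\to \operatorname{Sym}^D(\mathcal E_v)=E_{D,v}$, let $\|\cdot\|_{\sup,v}$ be the supremum norm on $E_{D,v}$ for the Fubini–Study metric on $\mathcal O(D)$, and let $\|\cdot\|_{J,v}$ be the norm whose unit ball is the ellipsoid of John (the ellipsoid of maximal volume) of the unit ball of $\|\cdot\|_{\sup,v}$.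 Write $\overline E_{D,\mathrm{sym}}$ and $\overline E_{D,J}$ for $E_D$ with these norms. For a finite place $v$ and a module $E$ let $\|x\|_v=\inf\{|a|_v : a\in K^\times,\ a^{-1}x\in E\}$ be the norm given by the model. For a Hermitian vector bundle $\overline E$ let $$\widehat{\deg}_n(\overline E)=-\sum_{v}\frac{[K_v:\mathbb Q_v]}{[K:\mathbb Q]}\log\|s_1\wedge\dots\wedge s_r\|_v ,$$ the sum over all places $v$ of $K$, be its normalized Arakelov degree, where $s_1,\dots,s_r$ is any $K$-basis of $E\otimes K$. Here the norm at a finite place is the norm given by the model $\Lambda^rE$, and at an infinite place $\|s_1\wedge\dots\wedge s_r\|_v=\inf\|e_1\|_v\cdots\|e_r\|_v$ over the families with $e_1\wedge\dots\wedge e_r=s_1\wedge\dots\wedge s_r$. The degree is independent of the basis. Let $s\in H^0(\mathbb P(\mathcal E),\mathcal O(\delta))=E_\delta$ be a nonzero section, let $D\ge\delta+1$, and put $$\widehat{\deg}_n(s)=-\sum_{v\nmid\infty}\frac{[K_v:\mathbb Q_v]}{[K:\mathbb Q]}\log\|s\|_v-\sum_{v\mid\infty}\frac{[K_v:\mathbb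 Q_v]}{[K:\mathbb Q]}\log\|s\|_{\mathrm{sym},v}.$$ (1) Let $\overline E^{\,s}_{D-\delta,\mathrm{sym}}$ be $E_{D-\delta}$ with the norms induced from $\overline E_{D,\mathrm{sym}}$ by the embedding $E_{D-\delta}\to E_D$, $t\mapsto s\cdot t$. Then $$\widehat{\deg}_n(\overline E^{\,s}_{D-\delta,\mathrm{sym}})\le\widehat{\deg}_n(\overline E_{D-\delta,\mathrm{sym}})+r(n,D-\delta)\left(\widehat{\deg}_n(s)+\tfrac12\log\tbinom D\delta\right).$$ (2) There is a constant $R_0(n,D)$, depending only on $n$ and $D$, such that $\log\|x\|_{J,v}=\log\|x\|_{\mathrm{sym},v}+R_0(n,D)$ for every infinite place $v$ and every nonzero $x\in E_{D,v}$. Let $X\subset\mathbb P(\mathcal E_K)$ be the hypersurface defined by $s$, let $F_D$ be the quotient of $E_D$ by the sections which vanish on $X$ (those which are divisible by $s$ over $K$), let $r_1(n,D)$ be the rank of $F_D$, and let $\overline F_{D,J}$ be $F_D$ with the quotient norms of those of $\overline E_{D,J}$. Then $$\widehat{\deg}_n(\overline F_{D,J})\ge\widehat{\deg}_n(\overline E_{D,\mathrm{sym}})-\widehat{\deg}_n(\overline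 E_{D-\delta,\mathrm{sym}})-r(n,D-\delta)\left(\widehat{\deg}_n(s)+\tfrac12\log\tbinom D\delta\right)-r_1(n,D)\,R_0(n,D).$$ -/

import Mathlib

open scoped TensorProduct ComplexConjugate

open NumberField

noncomputable section

namespace ArakelovHS

/-! ### Complex fibres of modules over a ring of integers -/

section Fibres

variable {K : Type*} [Field K]

/-- The field `ℂ`, regarded as an algebra over the ring of integers of `K` through the embedding
`K → ℂ` attached to the infinite place `v`. -/
def ComplexAt (_v : InfinitePlace K) : Type := ℂ

instance (v : InfinitePlace K) : Field (ComplexAt v) := inferInstanceAs (Field ℂ)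

instance (v : InfinitePlace K) : Module ℂ (ComplexAt v) := inferInstanceAs (Module ℂ ℂ)

/-- The embedding `K → ℂ` attached to `v`. -/
def embAt (v : InfinitePlace K) : K →+* ComplexAt v := v.embedding

instance (v : InfinitePlace K) : Algebra (𝓞 K) (ComplexAt v) :=
  ((embAt v).comp (algebraMap (𝓞 K) K)).toAlgebra

instance (v : InfinitePlace K) : SMulCommClass (𝓞 K) ℂ (ComplexAt v) where
  smul_comm a z w :=
    mul_left_comm (G := ℂ) (v.embedding (algebraMap (𝓞 K) K a)) z w

/-- `K → ℂ` as an `𝓞 K`-linear map. -/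
def embLin (v : InfinitePlace K) : K →ₗ[𝓞 K] ComplexAt v where
  toFun := embAt v
  map_add' := map_add _
  map_smul' a x := by
    rw [Algebra.smul_def, map_mul]
    rfl

/-- Complex conjugation of `ℂ`, which is `𝓞 K`-linear when `v` is real. -/
def conjLin (v : InfinitePlace K) (hv : v.IsReal) : ComplexAt v →ₗ[𝓞 K] ComplexAt v where
  toFun := fun z => (conj (z : ℂ) : ℂ)
  map_add' := fun x y => map_add (starRingEnd ℂ) x y
  map_smul' a x := by
    have h : conj (v.embedding (algebraMap (𝓞 K) K a)) = v.embedding (algebraMap (𝓞 K) K a) := by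
      have := InfinitePlace.isReal_iff.mp hv
      exact RingHom.congr_fun (ComplexEmbedding.isReal_iff.mp this) _
    have hx : ∀ y : ℂ, conj (v.embedding (algebraMap (𝓞 K) K a) * y)
        = v.embedding (algebraMap (𝓞 K) K a) * conj y := fun y => by rw [map_mul, h]
    exact hx x

/-- The complex vector space `M_v = M ⊗_{𝓞 K, v} ℂ`. -/
abbrev Fiber (v : InfinitePlace K) (M : Type*) [AddCommGroup M] [Module (𝓞 K) M] : Type _ :=
  ComplexAt v ⊗[𝓞 K] M

variable {M : Type*} [AddCommGroup M] [Module (𝓞 K) M]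
variable {M' : Type*} [AddCommGroup M'] [Module (𝓞 K) M']

/-- The canonical map `M_K = M ⊗ K → M_v`. -/
def toFiber (v : InfinitePlace K) : (K ⊗[𝓞 K] M) →ₗ[𝓞 K] Fiber v M :=
  LinearMap.rTensor M (embLin v)

/-- The map `M_v → M'_v` induced by an `𝓞 K`-linear map `M → M'`. -/
def fiberMap (v : InfinitePlace K) (f : M →ₗ[𝓞 K] M') : Fiber v M →ₗ[𝓞 K] Fiber v M' :=
  LinearMap.lTensor (ComplexAt v) f

/-- The action of complex conjugation on `M_v`, for a real place `v`. -/
def fiberConj (v : InfinitePlace K) (hv : v.IsReal) : Fiber v M →ₗ[𝓞 K] Fiber v M :=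
  LinearMap.rTensor M (conjLin v hv)

end Fibres

/-! ### Symmetric powers and multiplication by a section -/

section Sym

variable (R : Type*) [CommRing R] (M : Type*) [AddCommGroup M] [Module R M]

/-- The symmetric power `Sym^D(M)`, the degree `D` part of the symmetric algebra. -/
abbrev SymPow (D : ℕ) : Submodule R (SymmetricAlgebra R M) :=
  LinearMap.range (SymmetricAlgebra.ι R M) ^ D

instance (D : ℕ) [Module.Finite R M] : Module.Finite R (SymPow R M D) :=
  Module.Finite.iff_fg.mpr (Submodule.FG.pow (Module.Finite.iff_fg.mp inferInstance) D)

variable {R M}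

/-- Multiplication `t ↦ s · t`, from `Sym^{D-δ}(M)` to `Sym^D(M)`, for `s ∈ Sym^δ(M)`. -/
def mulSection {δ D : ℕ} (h : δ ≤ D) (s : SymPow R M δ) :
    SymPow R M (D - δ) →ₗ[R] SymPow R M D :=
  (LinearMap.mulLeft R (s : SymmetricAlgebra R M)).restrict (by
    intro t ht
    have := Submodule.mul_mem_mul s.2 ht
    rwa [← pow_add, Nat.add_sub_cancel' h] at this)

/-- The elements of `Sym^D(M)` a nonzero multiple of which is divisible by `s`
(for `M` projective over a domain: those which are divisible by `s` over the fraction field). -/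
def vanishing [IsDomain R] {δ D : ℕ} (h : δ ≤ D) (s : SymPow R M δ) :
    Submodule R (SymPow R M D) where
  carrier := {x | ∃ a : R, a ≠ 0 ∧ ∃ t, a • x = mulSection h s t}
  zero_mem' := ⟨1, one_ne_zero, 0, by simp⟩
  add_mem' := by
    rintro x y ⟨a, ha, t, ht⟩ ⟨b, hb, u, hu⟩
    refine ⟨a * b, mul_ne_zero ha hb, b • t + a • u, ?_⟩
    rw [map_add, map_smul, map_smul, ← ht, ← hu, smul_add, smul_smul, smul_smul, mul_comm b a]
  smul_mem' := by
    rintro c x ⟨a, ha, t, ht⟩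
    exact ⟨a, ha, c • t, by rw [map_smul, ← ht, smul_comm]⟩

end Sym

/-! ### Norms on symmetric powers of a complex Hermitian space -/

section Norms

variable {V : Type*} [AddCommGroup V] [Module ℂ V]

/-- The norm induced by an inner product. -/
def coreNorm (c : InnerProductSpace.Core ℂ V) (x : V) : ℝ := √(c.inner x x).re

/-- The norm, for the tensor product of the inner products, of the element
`∑ j, a j • x j 0 ⊗ ⋯ ⊗ x j (D-1)` of `V^{⊗ D}`. -/
def tensorNorm (c : InnerProductSpace.Core ℂ V) {m D : ℕ} (a : Fin m → ℂ) (x : Fin m → Fin D → V) :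
    ℝ :=
  √(∑ j, ∑ k, conj (a j) * a k * ∏ i, c.inner (x j i) (x k i)).re

/-- The symmetric (Bombieri) norm on `Sym^D(V)`: the quotient norm of the tensor product norm under
`V^{⊗ D} → Sym^D(V)`. -/
def symNorm (c : InnerProductSpace.Core ℂ V) (D : ℕ) (f : SymmetricAlgebra ℂ V) : ℝ :=
  sInf {t | ∃ (m : ℕ) (a : Fin m → ℂ) (x : Fin m → Fin D → V),
    ∑ j, a j • ∏ i, SymmetricAlgebra.ι ℂ V (x j i) = f ∧ t = tensorNorm c a x}

/-- The Fubini–Study norm of a section of `O(D)` at the point of `ℙ(V)` given by the one-dimensional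
quotient `φ : V → ℂ`. The fibre of `O(1)` there is `ℂ` with the quotient norm from `V`. -/
def fubiniStudyNorm (c : InnerProductSpace.Core ℂ V) (D : ℕ) (φ : V →ₗ[ℂ] ℂ)
    (f : SymmetricAlgebra ℂ V) : ℝ :=
  ‖SymmetricAlgebra.lift φ f‖ * (sInf {t | ∃ x, φ x = 1 ∧ t = coreNorm c x}) ^ D

/-- The supremum norm of a section of `O(D)` on `ℙ(V)`. -/
def supNorm (c : InnerProductSpace.Core ℂ V) (D : ℕ) (f : SymmetricAlgebra ℂ V) : ℝ :=
  ⨆ φ : {φ : V →ₗ[ℂ] ℂ // φ ≠ 0}, fubiniStudyNorm c D φ.1 f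

end Norms

/-! ### The norm of John -/

section John

variable {W : Type*} [AddCommGroup W] [Module ℝ W]

/-- The ellipsoid `{x | B x x ≤ 1}`, for `B` a real inner product, is contained in the unit ball
of `N`. -/
structure IsInscribed (N : W → ℝ) (B : LinearMap.BilinForm ℝ W) : Prop where
  symm : ∀ x y, B x y = B y x
  pos : ∀ x, x ≠ 0 → 0 < B x x
  subset : {x | B x x ≤ 1} ⊆ {x | N x ≤ 1}

/-- `{x | B x x ≤ 1}` is an ellipsoid of maximal volume contained in the unit ball of `N`.
The volume of an ellipsoid is inversely proportional to the square root of the determinant of the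
Gram matrix of `B` in a fixed real basis. -/
def IsJohn (N : W → ℝ) (B : LinearMap.BilinForm ℝ W) : Prop :=
  IsInscribed N B ∧ ∀ B' : LinearMap.BilinForm ℝ W, IsInscribed N B' →
    ∀ b : Module.Basis (Fin (Module.finrank ℝ W)) ℝ W,
      (LinearMap.BilinForm.toMatrix b B).det ≤ (LinearMap.BilinForm.toMatrix b B').det

/-- The norm whose unit ball is the ellipsoid of John of the unit ball of `N`. (The ellipsoid of
John being unique, the infimum is over a single value.) -/
def johnNorm (N : W → ℝ) (x : W) : ℝ := sInf {t | ∃ B, IsJohn N B ∧ t = √(B x x)}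

end John

/-- The constant `R₀(n, D)`: the value of `log ‖f‖_J - log ‖f‖_sym` at the section `f = X₀^D` of
`O(D)` on `ℙ(ℂ^{n+1})`, for the standard Hermitian structure of `ℂ^{n+1}`. -/
def johnConst (n D : ℕ) : ℝ :=
  let V := EuclideanSpace ℂ (Fin (n + 1))
  let c : InnerProductSpace.Core ℂ V := InnerProductSpace.toCore
  let f : SymPow ℂ V D := ⟨SymmetricAlgebra.ι ℂ V (EuclideanSpace.single 0 1) ^ D,
    Submodule.pow_mem_pow _ (LinearMap.mem_range_self _ _) D⟩
  Real.log (johnNorm (fun g : SymPow ℂ V D => supNorm c D g) f) - Real.log (symNorm c D f)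

/-! ### Normed vector bundles and Arakelov degrees -/

section Degree

variable {K : Type*} [Field K] [NumberField K]

/-- The norm given by a model at a finite place `w`: `L` is a lattice in the `K`-vector space `W`.
The absolute value `w` is normalised by `w a = |N(a)|_p`, so this is `‖x‖_w ^ [K_w : ℚ_w]` for
the absolute value which extends the usual one of `ℚ_p`. -/
def modelNorm {W : Type*} [AddCommGroup W] [Module K W] [Module (𝓞 K) W]
    (L : Submodule (𝓞 K) W) (w : FinitePlace K) (x : W) : ℝ :=
  sInf {t | ∃ a : K, a ≠ 0 ∧ a⁻¹ • x ∈ L ∧ t = w a}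

/-- The norm `‖s_1 ∧ ⋯ ∧ s_r‖`: the infimum of `‖e_1‖ ⋯ ‖e_r‖` over the vectors with
`e_1 ∧ ⋯ ∧ e_r = s_1 ∧ ⋯ ∧ s_r`. -/
def wedgeNorm {V : Type*} [AddCommGroup V] [Module ℂ V] (N : V → ℝ) {r : ℕ} (s : Fin r → V) : ℝ :=
  sInf {t | ∃ e : Fin r → V, exteriorPower.ιMulti ℂ r e = exteriorPower.ιMulti ℂ r s ∧
    t = ∏ i, N (e i)}

variable (M : Type*) [AddCommGroup M] [Module (𝓞 K) M]

/-- The image of `M` in `M_K`. -/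
def lattice : Submodule (𝓞 K) (K ⊗[𝓞 K] M) := LinearMap.range (TensorProduct.mk (𝓞 K) K M 1)

/-- The image of `Λ^r M` in `Λ^r M_K`. -/
def wedgeLattice (r : ℕ) : Submodule (𝓞 K) (⋀[K]^r (K ⊗[𝓞 K] M)) :=
  Submodule.span (𝓞 K) (Set.range fun e : Fin r → M =>
    exteriorPower.ιMulti K r fun i => (1 : K) ⊗ₜ[𝓞 K] e i)

/-- A Hermitian metric on `M`: a Hermitian inner product on every `M_v`, invariant under the action
of `Gal(ℂ / K_v)`. -/
structure HermitianMetric where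
  core : ∀ v : InfinitePlace K, InnerProductSpace.Core ℂ (Fiber v M)
  norm_conj : ∀ (v : InfinitePlace K) (hv : v.IsReal) (x : Fiber v M),
    coreNorm (core v) (fiberConj v hv x) = coreNorm (core v) x

variable {M}

/-- The normalized Arakelov degree of the normed vector bundle `(M, (N v)_v)`. -/
def normalizedDegree [Module.Finite (𝓞 K) M] (N : ∀ v : InfinitePlace K, Fiber v M → ℝ) : ℝ :=
  let r := Module.finrank K (K ⊗[𝓞 K] M)
  let s : Fin r → K ⊗[𝓞 K] M := Module.finBasis K (K ⊗[𝓞 K] M)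
  (-(∑ᶠ w : FinitePlace K,
        Real.log (modelNorm (wedgeLattice M r) w (exteriorPower.ιMulti K r s)))
    - ∑ v : InfinitePlace K, (v.mult : ℝ) * Real.log (wedgeNorm (N v) fun i => toFiber v (s i)))
    / Module.finrank ℚ K

/-- The normalized Arakelov degree of an element `s` of the normed vector bundle
`(M, (N v)_v)`. -/
def normalizedDegreeOf (N : ∀ v : InfinitePlace K, Fiber v M → ℝ) (s : M) : ℝ :=
  (-(∑ᶠ w : FinitePlace K, Real.log (modelNorm (lattice M) w ((1 : K) ⊗ₜ[𝓞 K] s)))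
    - ∑ v : InfinitePlace K, (v.mult : ℝ) * Real.log (N v (1 ⊗ₜ[𝓞 K] s)))
    / Module.finrank ℚ K

/-- The quotient norms on `M ⧸ P`. -/
def quotientNorm (N : ∀ v : InfinitePlace K, Fiber v M → ℝ) (P : Submodule (𝓞 K) M)
    (v : InfinitePlace K) (y : Fiber v (M ⧸ P)) : ℝ :=
  sInf {t | ∃ x : Fiber v M, fiberMap v P.mkQ x = y ∧ t = N v x}

end Degree

/-! ### The bundles of sections of `O(D)` on `ℙ(E)` -/

section Sections

variable {K : Type*} [Field K] {E : Type*} [AddCommGroup E] [Module (𝓞 K) E]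

theorem smul_one_tmul (v : InfinitePlace K) (a : 𝓞 K) (x : E) :
    (a • ((1 : ComplexAt v) ⊗ₜ[𝓞 K] x) : Fiber v E)
      = v.embedding (algebraMap (𝓞 K) K a) • ((1 : ComplexAt v) ⊗ₜ[𝓞 K] x) := by
  rw [TensorProduct.smul_tmul', TensorProduct.smul_tmul']
  rfl

/-- The canonical ring homomorphism `Sym(E) → Sym(E_v)`. -/
def symToFiber (v : InfinitePlace K) :
    SymmetricAlgebra (𝓞 K) E →+* SymmetricAlgebra ℂ (Fiber v E) :=
  letI : Algebra (𝓞 K) (SymmetricAlgebra ℂ (Fiber v E)) :=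
    ((algebraMap ℂ (SymmetricAlgebra ℂ (Fiber v E))).comp
      (v.embedding.comp (algebraMap (𝓞 K) K))).toAlgebra
  (SymmetricAlgebra.lift (R := 𝓞 K)
    { toFun := fun e : E => SymmetricAlgebra.ι ℂ (Fiber v E) (1 ⊗ₜ[𝓞 K] e)
      map_add' := fun x y => by rw [TensorProduct.tmul_add, map_add]
      map_smul' := fun a x => by
        rw [TensorProduct.tmul_smul, smul_one_tmul, map_smul, Algebra.smul_def]
        rfl } : SymmetricAlgebra (𝓞 K) E →ₐ[𝓞 K] _).toRingHom

theorem symToFiber_smul (v : InfinitePlace K) (a : 𝓞 K) (x : SymmetricAlgebra (𝓞 K) E) :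
    symToFiber v (a • x) = v.embedding (algebraMap (𝓞 K) K a) • symToFiber v x := by
  let _ : Algebra (𝓞 K) (SymmetricAlgebra ℂ (Fiber v E)) :=
    ((algebraMap ℂ (SymmetricAlgebra ℂ (Fiber v E))).comp
      (v.embedding.comp (algebraMap (𝓞 K) K))).toAlgebra
  rw [Algebra.smul_def, map_mul, Algebra.smul_def]
  congr 1
  exact (SymmetricAlgebra.lift (R := 𝓞 K) (A := SymmetricAlgebra ℂ (Fiber v E)) _).commutes a

/-- The canonical map `Sym^D(E)_v → Sym(E_v)`, which identifies `Sym^D(E)_v` with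
`Sym^D(E_v)`. -/
def fiberToSym (v : InfinitePlace K) (D : ℕ) :
    Fiber v (SymPow (𝓞 K) E D) →+ SymmetricAlgebra ℂ (Fiber v E) :=
  TensorProduct.liftAddHom
    (AddMonoidHom.mk' (fun z : ComplexAt v => AddMonoidHom.mk'
        (fun x : SymPow (𝓞 K) E D => (show ℂ from z) • symToFiber v (x : SymmetricAlgebra (𝓞 K) E))
        (fun x y => by rw [Submodule.coe_add, map_add, smul_add]))
      (fun z w => by
        ext x
        exact add_smul (show ℂ from z) (show ℂ from w) _))
    (fun a z x => by
      change (show ℂ from a • z) • symToFiber v (x : SymmetricAlgebra (𝓞 K) E)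
        = (show ℂ from z) • symToFiber v ((a • x : SymPow (𝓞 K) E D) : SymmetricAlgebra (𝓞 K) E)
      rw [Submodule.coe_smul, symToFiber_smul, smul_smul, mul_comm]
      rfl)

variable (h : HermitianMetric (K := K) E)

/-- The norms of `E_{D,sym}`, where `E_D = H⁰(ℙ(E), O(D)) = Sym^D(E)`. -/
def bundleSymNorm (D : ℕ) (v : InfinitePlace K) (x : Fiber v (SymPow (𝓞 K) E D)) : ℝ :=
  symNorm (h.core v) D (fiberToSym v D x)

/-- The supremum norms on `E_D`. -/
def bundleSupNorm (D : ℕ) (v : InfinitePlace K) (x : Fiber v (SymPow (𝓞 K) E D)) : ℝ :=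
  supNorm (h.core v) D (fiberToSym v D x)

/-- The norms of `E_{D,J}`: the norms of John of the supremum norms. -/
def bundleJohnNorm (D : ℕ) (v : InfinitePlace K) (x : Fiber v (SymPow (𝓞 K) E D)) : ℝ :=
  johnNorm (bundleSupNorm h D v) x

/-- The norms of `E^s_{D-δ,sym}`: the norms on `E_{D-δ}` induced from `E_{D,sym}` by
`t ↦ s · t`. -/
def bundleSubspaceNorm {δ D : ℕ} (hD : δ ≤ D) (s : SymPow (𝓞 K) E δ) (v : InfinitePlace K)
    (t : Fiber v (SymPow (𝓞 K) E (D - δ))) : ℝ :=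
  bundleSymNorm h D v (fiberMap v (mulSection hD s) t)

variable [NumberField K]

/-- The module `F_D` of the hypersurface of `ℙ(E_K)` defined by `s`: the image of `E_D` in the
degree `D` part of `Sym(E_K) / (s)`, that is the quotient of `E_D` by the sections which vanish on
the hypersurface. -/
abbrev HypersurfaceSections {δ D : ℕ} (hD : δ ≤ D) (s : SymPow (𝓞 K) E δ) : Type _ :=
  SymPow (𝓞 K) E D ⧸ vanishing hD s

/-- The norms of `F_{D,J}`: the quotient norms of those of `E_{D,J}`. -/
def hypersurfaceJohnNorm {δ D : ℕ} (hD : δ ≤ D) (s : SymPow (𝓞 K) E δ) (v : InfinitePlace K)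
    (y : Fiber v (HypersurfaceSections hD s)) : ℝ :=
  quotientNorm (bundleJohnNorm h D) (vanishing hD s) v y

end Sections

end ArakelovHS

end

open ArakelovHS

/-!
# Arakelov degrees of the sections on a hypersurface

Both degree inequalities reduce to local inequalities, since the degree may be computed with any
basis of the generic fibre (`normalizedDegree_eq`, by the product formula).

At an infinite place, an orthonormal basis identifies the symmetric norm with the norm of Bombieri
on homogeneous polynomials (`symNorm_eq_bombieriNorm`). Three facts are used.

* The inequality of Bombieri `‖s‖ ‖t‖ ≤ √(D.choose δ) ‖s t‖` (`bombieriNorm_mul_le`), where `s` and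
  `t` have degrees `δ` and `D - δ`: the square of the right-hand side is a sum of squares, some of
  which add up to the square of the left-hand side. It bounds below the norms induced by
  multiplication by `s`, hence those of the determinants. At the finite places nothing changes, and
  the first inequality follows, as `s` is integral.
* The norm of John of the supremum norm is the symmetric norm (`johnNorm_supNorm_eq`), so that the
  constant `R₀` is zero for `D > 0`. The unit ball of the symmetric norm lies in that of the supremum norm,
  with the powers `ℓ ^ D` of vectors `ℓ` of norm `1` as points of contact. The average of these
  points over the Gaussian measure is a multiple of the identity, which is the condition of John
  for the ellipsoid of maximal volume (`IsInscribed.one_le_det`).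
* For norms induced by inner products, the norm of a decomposable vector is the absolute value of a
  determinant in an orthonormal basis (`wedgeNorm_eq_norm_det`, by the inequality of Hadamard). It
  is multiplicative in the short exact sequence of the sections of degree `D - δ` with the induced
  norms, the sections of degree `D`, and the sections on the hypersurface with the quotient norms
  (`wedgeNorm_mul_wedgeNorm`).

At a finite place, the lattices have local bases, and the norms are absolute values of determinants
in these. Multiplication by `s` maps the lattice of degree `D - δ` into its saturation in the
lattice of degree `D`, with an index which is bounded in terms of the norm of `s`: this is the
lemma of Gauss, for the monomials in a local basis (`modelNorm_mul_pow_le`).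

The sum of the local statements over all places is the second inequality.
-/

noncomputable section

namespace ArakelovHS

set_option linter.unusedSectionVars false

open Finset.HasAntidiagonal (antidiagonal mem_antidiagonal)

/-! ### Determinant inequalities -/

section DeterminantInequalities

variable {n : Type*} [Fintype n]

theorem prod_le_one_of_sum_le_card {x : n → ℝ} (hx : ∀ i, 0 ≤ x i)
    (h : ∑ i, x i ≤ Fintype.card n) : ∏ i, x i ≤ 1 := by
  calc ∏ i, x i ≤ ∏ i, Real.exp (x i - 1) :=
        Finset.prod_le_prod (fun i _ => hx i) fun i _ => by
          simpa using Real.add_one_le_exp (x i - 1)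
    _ = Real.exp (∑ i, x i - Fintype.card n) := by
        rw [← Real.exp_sum, Finset.sum_sub_distrib]; simp
    _ ≤ 1 := Real.exp_le_one_iff.mpr (by linarith)

theorem eq_one_of_one_le_prod_of_sum_le_card {x : n → ℝ} (hx : ∀ i, 0 < x i)
    (h : ∑ i, x i ≤ Fintype.card n) (h1 : 1 ≤ ∏ i, x i) (i : n) : x i = 1 := by
  by_contra hi
  have hlt : ∏ i, x i < ∏ i, Real.exp (x i - 1) :=
    Finset.prod_lt_prod (fun i _ => hx i) (fun i _ => by
      simpa using Real.add_one_le_exp (x i - 1)) ⟨i, Finset.mem_univ i, by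
        simpa using Real.add_one_lt_exp (sub_ne_zero.mpr hi)⟩
  rw [← Real.exp_sum, Finset.sum_sub_distrib] at hlt
  have : Real.exp (∑ i, x i - ∑ _i : n, (1 : ℝ)) ≤ 1 := Real.exp_le_one_iff.mpr (by simp; linarith)
  linarith

variable [DecidableEq n]

open scoped ComplexOrder in
theorem det_le_one_of_trace_le_card {A : Matrix n n ℂ} (hA : A.PosSemidef)
    (h : A.trace.re ≤ Fintype.card n) : ‖A.det‖ ≤ 1 := by
  rw [hA.isHermitian.det_eq_prod_eigenvalues, norm_prod]
  have hpos := hA.eigenvalues_nonneg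
  have : ∀ i, ‖((hA.isHermitian.eigenvalues i : ℝ) : ℂ)‖ = hA.isHermitian.eigenvalues i := fun i => by
    rw [Complex.norm_real, Real.norm_of_nonneg (hpos i)]
  refine (Finset.prod_congr rfl fun i _ => this i).trans_le ?_
  refine prod_le_one_of_sum_le_card hpos ?_
  rw [hA.isHermitian.trace_eq_sum_eigenvalues] at h
  simpa using h

theorem det_le_one_and_eq_one {A : Matrix n n ℝ} (hA : A.PosDef)
    (h : A.trace ≤ Fintype.card n) : A.det ≤ 1 ∧ (1 ≤ A.det → A = 1) := by
  have hdet := hA.isHermitian.det_eq_prod_eigenvalues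
  have htr := hA.isHermitian.trace_eq_sum_eigenvalues
  simp only [RCLike.ofReal_real_eq_id, id_eq] at hdet htr
  rw [htr] at h
  refine ⟨hdet ▸ prod_le_one_of_sum_le_card (fun i => (hA.eigenvalues_pos i).le) h, fun h1 => ?_⟩
  have hone := eq_one_of_one_le_prod_of_sum_le_card hA.eigenvalues_pos h (hdet ▸ h1)
  have hs := hA.isHermitian.spectral_theorem
  have hd : Matrix.diagonal ((RCLike.ofReal : ℝ → ℝ) ∘ hA.isHermitian.eigenvalues) = 1 := by
    rw [← Matrix.diagonal_one]; congr 1; ext i; simp [hone i]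
  rw [hd, map_one] at hs
  exact hs

open scoped ComplexOrder in
/-- Hadamard's inequality. -/
theorem norm_det_le_prod_norm_row (A : Matrix n n ℂ) :
    ‖A.det‖ ≤ ∏ i, √(∑ j, ‖A i j‖ ^ 2) := by
  set ρ : n → ℝ := fun i => √(∑ j, ‖A i j‖ ^ 2) with hρ
  by_cases h0 : ∃ i, ρ i = 0
  · obtain ⟨i, hi⟩ := h0
    have hrow : ∀ j, A i j = 0 := by
      rw [hρ, Real.sqrt_eq_zero (Finset.sum_nonneg fun _ _ => sq_nonneg _),
        Finset.sum_eq_zero_iff_of_nonneg fun _ _ => sq_nonneg _] at hi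
      intro j
      simpa using hi j (Finset.mem_univ j)
    rw [Matrix.det_eq_zero_of_row_eq_zero i hrow, norm_zero]
    exact Finset.prod_nonneg fun _ _ => Real.sqrt_nonneg _
  push Not at h0
  have hpos : ∀ i, 0 < ρ i := fun i => lt_of_le_of_ne (Real.sqrt_nonneg _) (h0 i).symm
  -- after normalising the rows, the Gram matrix has diagonal entries `1`
  set B : Matrix n n ℂ := Matrix.diagonal (fun i => ((ρ i)⁻¹ : ℂ)) * A with hB
  have htr : (B * B.conjTranspose).trace.re = Fintype.card n := by
    rw [Matrix.trace, Complex.re_sum]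
    have : ∀ i, (Matrix.diag (B * B.conjTranspose) i).re = 1 := by
      intro i
      have hsq : (ρ i) ^ 2 = ∑ j, ‖A i j‖ ^ 2 :=
        Real.sq_sqrt (Finset.sum_nonneg fun _ _ => sq_nonneg _)
      simp only [Matrix.diag_apply, Matrix.mul_apply, Matrix.conjTranspose_apply, Complex.re_sum]
      have : ∀ j, (B i j * star (B i j)).re = ((ρ i) ^ 2)⁻¹ * ‖A i j‖ ^ 2 := by
        intro j
        rw [Complex.star_def, Complex.mul_conj, Complex.ofReal_re, Complex.normSq_eq_norm_sq, hB,
          Matrix.diagonal_mul, norm_mul, mul_pow, norm_inv, Complex.norm_real,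
          Real.norm_of_nonneg (hpos i).le, inv_pow]
      rw [Finset.sum_congr rfl fun j _ => this j, ← Finset.mul_sum, ← hsq, inv_mul_cancel₀]
      exact pow_ne_zero _ (h0 i)
    rw [Finset.sum_congr rfl fun i _ => this i]; simp
  have h1 := det_le_one_of_trace_le_card (Matrix.posSemidef_self_mul_conjTranspose B) htr.le
  rw [Matrix.det_mul, Matrix.det_conjTranspose, norm_mul, norm_star, ← sq] at h1
  have h2 : ‖B.det‖ ≤ 1 := by nlinarith [norm_nonneg B.det]
  have h3 : ‖B.det‖ = (∏ i, ρ i)⁻¹ * ‖A.det‖ := by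
    rw [hB, Matrix.det_mul, Matrix.det_diagonal, norm_mul, norm_prod, ← Finset.prod_inv_distrib]
    congr 1
    refine Finset.prod_congr rfl fun i _ => ?_
    rw [norm_inv, Complex.norm_real, Real.norm_of_nonneg (hpos i).le]
  have hP : 0 < ∏ i, ρ i := Finset.prod_pos fun i _ => hpos i
  rw [h3, inv_mul_le_iff₀ hP, mul_one] at h2
  exact h2

end DeterminantInequalities

/-! ### Exterior powers and bases -/

section Wedge

variable {k V : Type*} [Field k] [AddCommGroup V] [Module k V]

theorem ιMulti_eq_det_smul {r : ℕ} (b : Module.Basis (Fin r) k V) (s : Fin r → V) :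
    exteriorPower.ιMulti k r s = b.det s • exteriorPower.ιMulti k r b := by
  have : exteriorPower.ιMulti k r (M := V)
      = (LinearMap.toSpanSingleton k _ (exteriorPower.ιMulti k r b)).compAlternatingMap b.det := by
    refine Module.Basis.ext_alternating b fun v hv => ?_
    let σ : Equiv.Perm (Fin r) := Equiv.ofBijective v (Finite.injective_iff_bijective.mp hv)
    have h1 : (fun i => b (v i)) = b ∘ σ := rfl
    rw [h1, AlternatingMap.map_perm, LinearMap.compAlternatingMap_apply, AlternatingMap.map_perm,
      b.det_self]
    simp
  conv_lhs => rw [this]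
  simp

/-- The top exterior power is a line, on which the determinant is a coordinate. -/
theorem ιMulti_eq_iff_det_eq {r : ℕ} (b : Module.Basis (Fin r) k V) (s t : Fin r → V) :
    exteriorPower.ιMulti k r s = exteriorPower.ιMulti k r t ↔ b.det s = b.det t := by
  constructor
  · intro h
    have := congrArg (exteriorPower.alternatingMapLinearEquiv b.det) h
    simpa using this
  · intro h
    rw [ιMulti_eq_det_smul b s, ιMulti_eq_det_smul b t, h]

/-- The determinant of a family, in a basis adapted to an exact sequence `V' → V → V''`, is the
product of the determinants in `V'` and `V''`. -/
theorem det_sum_eq_mul {V' V'' : Type*} [AddCommGroup V'] [Module k V'] [AddCommGroup V'']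
    [Module k V''] {ι' ι'' : Type*} [Fintype ι'] [Fintype ι''] [DecidableEq ι'] [DecidableEq ι'']
    (j : V' →ₗ[k] V) (q : V →ₗ[k] V'') (hqj : ∀ x, q (j x) = 0)
    (B : Module.Basis (ι' ⊕ ι'') k V) (b' : Module.Basis ι' k V') (b'' : Module.Basis ι'' k V'')
    (hB' : ∀ i, B (Sum.inl i) = j (b' i)) (hB'' : ∀ i, q (B (Sum.inr i)) = b'' i)
    (t : ι' → V') (m : ι'' → V) :
    B.det (Sum.elim (fun i => j (t i)) m) = b'.det t * b''.det (fun i => q (m i)) := by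
  have hl : ∀ x i, B.repr (j x) (Sum.inl i) = b'.repr x i := by
    intro x i
    have : j x = ∑ i, b'.repr x i • B (Sum.inl i) := by
      conv_lhs => rw [← b'.sum_repr x, map_sum]
      simp [hB']
    rw [this]
    simp [Finsupp.single_apply]
  have hl0 : ∀ x l, B.repr (j x) (Sum.inr l) = 0 := by
    intro x l
    have : j x = ∑ i, b'.repr x i • B (Sum.inl i) := by
      conv_lhs => rw [← b'.sum_repr x, map_sum]
      simp [hB']
    rw [this]
    simp
  have hr : ∀ x l, b''.repr (q x) l = B.repr x (Sum.inr l) := by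
    intro x l
    conv_lhs => rw [← B.sum_repr x, map_sum, Fintype.sum_sum_type]
    simp [hB', hB'', hqj, Finsupp.single_apply]
  rw [Module.Basis.det_apply, Module.Basis.det_apply, Module.Basis.det_apply]
  have : B.toMatrix (Sum.elim (fun i => j (t i)) m) = Matrix.fromBlocks (b'.toMatrix t)
      (Matrix.of fun i l => B.repr (m l) (Sum.inl i)) 0 (b''.toMatrix fun i => q (m i)) := by
    ext (i | i) (l | l)
    · simpa [Module.Basis.toMatrix_apply] using hl (t l) i
    · simp [Module.Basis.toMatrix_apply]
    · simpa [Module.Basis.toMatrix_apply] using hl0 (t l) i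
    · simp [Module.Basis.toMatrix_apply, hr]
  rw [this, Matrix.det_fromBlocks_zero₂₁]

end Wedge

/-! ### The norm of a decomposable vector -/

section WedgeNorm

variable {V : Type*} [AddCommGroup V] [Module ℂ V]

/-- The norm `N` behaves on the basis `b` like a Hermitian norm for which `b` is orthonormal: it
dominates the `ℓ²`-norm of the coordinates, and the vectors of `b` have norm at most `1`. This is
what is needed to compute `wedgeNorm N`. -/
structure IsAdaptedBasis {ι : Type*} [Fintype ι] (N : V → ℝ) (b : Module.Basis ι ℂ V) : Prop where
  le : ∀ x, √(∑ i, ‖b.repr x i‖ ^ 2) ≤ N x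
  smul_le : ∀ (z : ℂ) i, N (z • b i) ≤ ‖z‖

theorem IsAdaptedBasis.reindex {ι ι' : Type*} [Fintype ι] [Fintype ι'] {N : V → ℝ}
    {b : Module.Basis ι ℂ V} (h : IsAdaptedBasis N b) (e : ι ≃ ι') :
    IsAdaptedBasis N (b.reindex e) where
  le x := by
    refine le_trans (le_of_eq ?_) (h.le x)
    congr 1
    exact (Equiv.sum_comp e.symm fun i => ‖b.repr x i‖ ^ 2) ▸ by simp
  smul_le z i := by simpa using h.smul_le z (e.symm i)

/-- For a norm induced by an inner product, the infimum of the products of the norms over the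
families with a given exterior product is the absolute value of the determinant in an orthonormal
basis: the lower bound is Hadamard's inequality. -/
theorem wedgeNorm_eq_norm_det {r : ℕ} {N : V → ℝ} {b : Module.Basis (Fin r) ℂ V}
    (h : IsAdaptedBasis N b) (s : Fin r → V) : wedgeNorm N s = ‖b.det s‖ := by
  have hN : ∀ x, 0 ≤ N x := fun x => (Real.sqrt_nonneg _).trans (h.le x)
  have hlow : ∀ e : Fin r → V, ‖b.det e‖ ≤ ∏ i, N (e i) := by
    intro e
    rw [Module.Basis.det_apply, ← Matrix.det_transpose]
    refine (norm_det_le_prod_norm_row _).trans ?_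
    exact Finset.prod_le_prod (fun _ _ => Real.sqrt_nonneg _) fun i _ => h.le (e i)
  have hlb : ‖b.det s‖ ∈ lowerBounds {t | ∃ e : Fin r → V,
      exteriorPower.ιMulti ℂ r e = exteriorPower.ιMulti ℂ r s ∧ t = ∏ i, N (e i)} := by
    rintro t ⟨e, he, rfl⟩
    rw [← (ιMulti_eq_iff_det_eq b e s).mp he]
    exact hlow e
  apply le_antisymm
  · rcases Nat.eq_zero_or_pos r with rfl | hr
    · refine csInf_le ⟨_, hlb⟩ ⟨s, rfl, ?_⟩
      rw [Module.Basis.det_apply]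
      simp
    · -- scale the first vector of `b` by the determinant
      let i0 : Fin r := ⟨0, hr⟩
      let e : Fin r → V := Function.update b i0 (b.det s • b i0)
      have hdet : b.det e = b.det s := by
        simp only [e]
        rw [AlternatingMap.map_update_smul, Function.update_eq_self, b.det_self, smul_eq_mul,
          mul_one]
      refine (csInf_le ⟨_, hlb⟩ ⟨e, (ιMulti_eq_iff_det_eq b e s).mpr hdet, rfl⟩).trans ?_
      rw [← Finset.mul_prod_erase _ _ (Finset.mem_univ i0)]
      have h1 : N (e i0) ≤ ‖b.det s‖ := by simpa [e] using h.smul_le (b.det s) i0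
      have h2 : ∏ i ∈ Finset.univ.erase i0, N (e i) ≤ 1 := by
        refine Finset.prod_le_one (fun i _ => hN _) fun i hi => ?_
        have : e i = b i := Function.update_of_ne (Finset.ne_of_mem_erase hi) _ _
        simpa [this] using h.smul_le 1 i
      calc N (e i0) * ∏ i ∈ Finset.univ.erase i0, N (e i)
          ≤ ‖b.det s‖ * 1 := mul_le_mul h1 h2 (Finset.prod_nonneg fun i _ => hN _) (norm_nonneg _)
        _ = ‖b.det s‖ := mul_one _
  · exact le_csInf ⟨_, s, rfl, rfl⟩ hlb

/-- Rescaling: a comparison of two norms gives one of the norms of the exterior products of `r`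
vectors. -/
theorem pow_mul_wedgeNorm_le {N N' : V → ℝ} (hN : ∀ x, 0 ≤ N x) {c : ℝ} (hc : 0 ≤ c)
    (h : ∀ x, c * N x ≤ N' x) {r : ℕ} (s : Fin r → V) :
    c ^ r * wedgeNorm N s ≤ wedgeNorm N' s := by
  refine le_csInf ⟨_, s, rfl, rfl⟩ ?_
  rintro t ⟨e, he, rfl⟩
  have h1 : wedgeNorm N s ≤ ∏ i, N (e i) := by
    refine csInf_le ⟨0, ?_⟩ ⟨e, he, rfl⟩
    rintro t ⟨e, -, rfl⟩
    exact Finset.prod_nonneg fun i _ => hN _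
  calc c ^ r * wedgeNorm N s ≤ c ^ r * ∏ i, N (e i) :=
        mul_le_mul_of_nonneg_left h1 (pow_nonneg hc r)
    _ = ∏ i, c * N (e i) := by rw [Finset.prod_mul_distrib]; simp
    _ ≤ ∏ i, N' (e i) :=
        Finset.prod_le_prod (fun i _ => mul_nonneg hc (hN _)) fun i _ => h _

end WedgeNorm

/-! ### A criterion for the ellipsoid of John -/

section JohnCriterion

variable {W : Type*} [AddCommGroup W] [Module ℝ W] {ι : Type*} [Fintype ι] [DecidableEq ι]

theorem IsInscribed.posDef_toMatrix {N : W → ℝ} {B : LinearMap.BilinForm ℝ W}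
    (hB : IsInscribed N B) (b : Module.Basis ι ℝ W) :
    (LinearMap.BilinForm.toMatrix b B).PosDef := by
  refine Matrix.PosDef.of_dotProduct_mulVec_pos ?_ fun x hx => ?_
  · ext i j
    simpa [LinearMap.BilinForm.toMatrix_apply] using hB.symm _ _
  · have h0 : b.equivFun.symm x ≠ 0 := (LinearEquiv.map_ne_zero_iff _).mpr hx
    have := hB.pos _ h0
    rw [LinearMap.BilinForm.apply_eq_dotProduct_toMatrix_mulVec b] at this
    have hr : (b.repr (b.equivFun.symm x) : ι → ℝ) = x := b.equivFun.apply_symm_apply x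
    rw [hr] at this
    simpa using this

/-- The sufficient half of John's theorem. Suppose that `{x | B₀ x x ≤ 1}` is inscribed in the unit
ball of `N`, that the unit ball lies in the half-space `B₀ x u ≤ 1` for every `u ∈ S`, and that the
points of `S` are spread out enough for the trace (with respect to `B₀`) of a symmetric form which
is at most `1` on `S` to be at most the dimension. Then every inscribed ellipsoid has a Gram matrix
of determinant at least `1`, with equality only for `B₀`: apply the trace condition to the inverse
of the Gram matrix, and the inequality of the arithmetic and geometric means to its eigenvalues. -/
theorem IsInscribed.one_le_det {N : W → ℝ} {B₀ : LinearMap.BilinForm ℝ W} (b : Module.Basis ι ℝ W)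
    (hb : LinearMap.BilinForm.toMatrix b B₀ = 1) (S : Set W)
    (hS : ∀ u ∈ S, ∀ x, N x ≤ 1 → B₀ x u ≤ 1)
    (htr : ∀ C : LinearMap.BilinForm ℝ W, (∀ x y, C x y = C y x) → (∀ u ∈ S, C u u ≤ 1) →
      ∑ i, C (b i) (b i) ≤ Fintype.card ι)
    {B : LinearMap.BilinForm ℝ W} (hB : IsInscribed N B) :
    1 ≤ (LinearMap.BilinForm.toMatrix b B).det
      ∧ ((LinearMap.BilinForm.toMatrix b B).det ≤ 1 → B = B₀) := by
  set M := LinearMap.BilinForm.toMatrix b B with hM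
  have hMpos : M.PosDef := hB.posDef_toMatrix b
  have hMdet : IsUnit M.det := hMpos.det_pos.ne'.isUnit
  have hsymm : M⁻¹.transpose = M⁻¹ := by
    have := hMpos.inv.isHermitian
    rwa [Matrix.IsHermitian, Matrix.conjTranspose_eq_transpose_of_trivial] at this
  -- the form dual to `B`, which measures the width of the ellipsoid of `B` in each direction
  set C : LinearMap.BilinForm ℝ W := Matrix.toBilin b M⁻¹ with hC
  have hCapp : ∀ x y, C x y = b.equivFun x ⬝ᵥ M⁻¹.mulVec (b.equivFun y) := fun x y => by
    rw [LinearMap.BilinForm.apply_eq_dotProduct_toMatrix_mulVec b, hC,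
      LinearMap.BilinForm.toMatrix_toBilin]
    rfl
  have hCsymm : ∀ x y, C x y = C y x := fun x y => by
    rw [hCapp, hCapp, Matrix.dotProduct_mulVec, ← Matrix.mulVec_transpose, hsymm, dotProduct_comm]
  have hCS : ∀ u ∈ S, C u u ≤ 1 := by
    intro u hu
    by_contra! hlt
    have hq : 0 < C u u := one_pos.trans hlt
    -- the point of the ellipsoid of `B` which lies farthest in the direction `u`
    set y : W := b.equivFun.symm (M⁻¹.mulVec (b.equivFun u)) with hy
    have hyr : b.equivFun y = M⁻¹.mulVec (b.equivFun u) := by rw [hy, LinearEquiv.apply_symm_apply]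
    have hBy : B y y = C u u := by
      rw [LinearMap.BilinForm.apply_eq_dotProduct_toMatrix_mulVec b, ← hM, hCapp]
      change b.equivFun y ⬝ᵥ M.mulVec (b.equivFun y) = _
      rw [hyr, Matrix.mulVec_mulVec, Matrix.mul_nonsing_inv _ hMdet, Matrix.one_mulVec,
        dotProduct_comm]
    have hB0y : B₀ y u = C u u := by
      rw [LinearMap.BilinForm.apply_eq_dotProduct_toMatrix_mulVec b, hb, Matrix.one_mulVec, hCapp]
      change b.equivFun y ⬝ᵥ b.equivFun u = _
      rw [hyr, dotProduct_comm]
    have hx : N ((√(C u u))⁻¹ • y) ≤ 1 := hB.subset (by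
      simp only [Set.mem_ofPred_eq, map_smul, LinearMap.smul_apply, smul_eq_mul, hBy]
      rw [← mul_assoc, ← mul_inv, Real.mul_self_sqrt hq.le, inv_mul_cancel₀ hq.ne'])
    have h1 := hS u hu _ hx
    rw [map_smul, LinearMap.smul_apply, hB0y, smul_eq_mul, inv_mul_le_iff₀ (Real.sqrt_pos.mpr hq),
      mul_one, Real.le_sqrt hq.le hq.le] at h1
    nlinarith
  have htrace : M⁻¹.trace ≤ Fintype.card ι := by
    refine le_trans (le_of_eq ?_) (htr C hCsymm hCS)
    rw [Matrix.trace]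
    refine Finset.sum_congr rfl fun i _ => ?_
    have : LinearMap.BilinForm.toMatrix b C = M⁻¹ := by
      rw [hC, LinearMap.BilinForm.toMatrix_toBilin]
    rw [Matrix.diag_apply, ← this, LinearMap.BilinForm.toMatrix_apply]
  obtain ⟨h1, h2⟩ := det_le_one_and_eq_one hMpos.inv htrace
  rw [Matrix.det_nonsing_inv, Ring.inverse_eq_inv'] at h1 h2
  refine ⟨(inv_le_one₀ hMpos.det_pos).mp h1, fun h => ?_⟩
  have hM1 : M⁻¹ = 1 := h2 ((one_le_inv₀ hMpos.det_pos).mpr h)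
  have hM2 : M = 1 := by
    rw [← Matrix.nonsing_inv_nonsing_inv M hMdet, hM1, inv_one]
  exact (LinearMap.BilinForm.toMatrix b).injective (by rw [← hM, hM2, hb])

/-- A change of basis multiplies the determinants of all Gram matrices by the same positive
constant, so that the comparison of volumes can be made in any basis. -/
theorem det_toMatrix_eq_sq_mul (b : Module.Basis ι ℝ W)
    (c : Module.Basis (Fin (Module.finrank ℝ W)) ℝ W) :
    ∃ a : ℝ, a ≠ 0 ∧ ∀ B : LinearMap.BilinForm ℝ W, (LinearMap.BilinForm.toMatrix c B).det
      = a ^ 2 * (LinearMap.BilinForm.toMatrix b B).det := by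
  have e : ι ≃ Fin (Module.finrank ℝ W) := b.indexEquiv c
  refine ⟨((b.reindex e).toMatrix c).det, ?_, fun B => ?_⟩
  · rw [← Module.Basis.det_apply]
    exact ((b.reindex e).isUnit_det c).ne_zero
  · rw [← LinearMap.BilinForm.toMatrix_mul_basis_toMatrix (b.reindex e) c B, Matrix.det_mul,
      Matrix.det_mul, Matrix.det_transpose]
    have : LinearMap.BilinForm.toMatrix (b.reindex e) B
        = (LinearMap.BilinForm.toMatrix b B).submatrix e.symm e.symm := by
      ext i j
      simp [LinearMap.BilinForm.toMatrix_apply]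
    rw [this, Matrix.det_submatrix_equiv_self]
    ring

/-- Under the conditions of `IsInscribed.one_le_det`, the form `B₀` is the only one which defines an
ellipsoid of maximal volume. -/
theorem johnNorm_eq_sqrt {N : W → ℝ} {B₀ : LinearMap.BilinForm ℝ W} (b : Module.Basis ι ℝ W)
    (hB₀ : IsInscribed N B₀) (hb : LinearMap.BilinForm.toMatrix b B₀ = 1) (S : Set W)
    (hS : ∀ u ∈ S, ∀ x, N x ≤ 1 → B₀ x u ≤ 1)
    (htr : ∀ C : LinearMap.BilinForm ℝ W, (∀ x y, C x y = C y x) → (∀ u ∈ S, C u u ≤ 1) →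
      ∑ i, C (b i) (b i) ≤ Fintype.card ι) (x : W) :
    johnNorm N x = √(B₀ x x) := by
  have key := fun {B} (hB : IsInscribed N B) => IsInscribed.one_le_det b hb S hS htr hB
  have hJohn : ∀ B, IsJohn N B ↔ B = B₀ := by
    intro B
    constructor
    · rintro ⟨hB, hmin⟩
      have : Module.Finite ℝ W := .of_basis b
      let c := Module.finBasis ℝ W
      obtain ⟨a, ha, hdet⟩ := det_toMatrix_eq_sq_mul b c
      have h := hmin B₀ hB₀ c
      rw [hdet, hdet, hb, Matrix.det_one] at h
      exact (key hB).2 (le_of_mul_le_mul_left h (by positivity))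
    · rintro rfl
      refine ⟨hB₀, fun B' hB' c => ?_⟩
      obtain ⟨a, ha, hdet⟩ := det_toMatrix_eq_sq_mul b c
      rw [hdet, hdet, hb, Matrix.det_one]
      exact mul_le_mul_of_nonneg_left (key hB').1 (sq_nonneg a)
  have : {t | ∃ B, IsJohn N B ∧ t = √(B x x)} = {√(B₀ x x)} := by
    ext t
    simp [hJohn]
  rw [johnNorm, this, csInf_singleton]

end JohnCriterion

/-! ### Multi-indices -/

section MultiIndex

variable {ι : Type*} [Fintype ι] [DecidableEq ι]

/-- The multi-indices of degree `D`. -/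
def multiIndices (ι : Type*) [Fintype ι] [DecidableEq ι] (D : ℕ) : Finset (ι →₀ ℕ) :=
  Finset.univ.finsuppAntidiag D

@[simp]
theorem mem_multiIndices {D : ℕ} {α : ι →₀ ℕ} : α ∈ multiIndices ι D ↔ α.degree = D := by
  simp [multiIndices, Finsupp.degree_eq_sum]

theorem card_multiIndices (n D : ℕ) (hι : Fintype.card ι = n + 1) :
    (multiIndices ι D).card = (n + D).choose n := by
  rw [multiIndices, Finset.card_finsuppAntidiag_nat_eq_choose, Finset.card_univ, hι,
    show n + 1 + D - 1 = n + D by omega, Nat.choose_symm_add]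

/-- The multi-index of the monomial `∏ i, X (I i)`. -/
def multiIndexOf {D : ℕ} (I : Fin D → ι) : ι →₀ ℕ := ∑ i, Finsupp.single (I i) 1

theorem multiIndexOf_mem {D : ℕ} (I : Fin D → ι) : multiIndexOf I ∈ multiIndices ι D := by
  simp [multiIndexOf]

theorem prod_X_eq_monomial (k : Type*) [CommSemiring k] {D : ℕ} (I : Fin D → ι) :
    ∏ i, (MvPolynomial.X (I i) : MvPolynomial ι k) = MvPolynomial.monomial (multiIndexOf I) 1 := by
  rw [multiIndexOf, MvPolynomial.monomial_sum_one]
  rfl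

theorem card_multiIndexOf_eq {D : ℕ} {α : ι →₀ ℕ} (hα : α ∈ multiIndices ι D) :
    (Finset.univ.filter fun I : Fin D → ι => multiIndexOf I = α).card = α.multinomial := by
  have h := MvPolynomial.coeff_sum_X_pow_of_fintype (R := ℕ) α D
  rw [Fintype.sum_pow, MvPolynomial.coeff_sum, 
    if_pos (show (α.sum fun _ m => m) = D from mem_multiIndices.mp hα)] at h
  simp_rw [prod_X_eq_monomial, MvPolynomial.coeff_monomial] at h
  rw [Finset.sum_boole] at h
  simpa using h

theorem multinomial_pos (α : ι →₀ ℕ) : 0 < α.multinomial := by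
  have h := card_multiIndexOf_eq (α := α) (mem_multiIndices.mpr rfl)
  rw [← h, Finset.card_pos]
  by_contra h0
  rw [Finset.not_nonempty_iff_eq_empty] at h0
  rw [h0, Finset.card_empty] at h
  have := Nat.multinomial_pos α.support α
  rw [← Finsupp.multinomial_eq] at this
  omega

end MultiIndex

/-! ### The symmetric norm in coordinates -/

section SymNorm

variable {V : Type*} [AddCommGroup V] [Module ℂ V] {ι : Type*} [Fintype ι] [DecidableEq ι]

/-- The basis `b` is orthonormal for the inner product `c`. -/
def IsOrthonormalFor (c : InnerProductSpace.Core ℂ V) (b : Module.Basis ι ℂ V) : Prop :=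
  ∀ x y, c.inner x y = ∑ i, conj (b.repr x i) * b.repr y i

theorem exists_isOrthonormalFor [Module.Finite ℂ V] (c : InnerProductSpace.Core ℂ V) {n : ℕ}
    (hn : Module.finrank ℂ V = n) : ∃ b : Module.Basis (Fin n) ℂ V, IsOrthonormalFor c b := by
  let _ : NormedAddCommGroup V := c.toNormedAddCommGroup
  let _ : InnerProductSpace ℂ V := InnerProductSpace.ofCore c.toCore
  let b := (stdOrthonormalBasis ℂ V).reindex (finCongr hn)
  refine ⟨b.toBasis, fun x y => ?_⟩
  change inner ℂ x y = _
  rw [← b.repr.inner_map_map x y, PiLp.inner_apply]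
  simp [mul_comm]

/-- The Bombieri norm of a homogeneous polynomial of degree `D`. -/
def bombieriNorm (D : ℕ) (p : MvPolynomial ι ℂ) : ℝ :=
  √(∑ α ∈ multiIndices ι D, ‖p.coeff α‖ ^ 2 / α.multinomial)

theorem equivMvPolynomial_ι {k V : Type*} [CommSemiring k] [AddCommMonoid V] [Module k V]
    (b : Module.Basis ι k V) (x : V) :
    SymmetricAlgebra.equivMvPolynomial b (SymmetricAlgebra.ι k V x)
      = ∑ i, b.repr x i • MvPolynomial.X i := by
  conv_lhs => rw [← b.sum_repr x, map_sum, map_sum]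
  exact Finset.sum_congr rfl fun i _ => by rw [map_smul, map_smul,
    SymmetricAlgebra.equivMvPolynomial_ι_apply]

theorem equivMvPolynomial_symPow {k V : Type*} [CommRing k] [AddCommGroup V] [Module k V]
    (b : Module.Basis ι k V) (D : ℕ) :
    (SymPow k V D).map (SymmetricAlgebra.equivMvPolynomial b).toAlgHom.toLinearMap
      = MvPolynomial.homogeneousSubmodule ι k D := by
  rw [Submodule.map_pow, ← MvPolynomial.homogeneousSubmodule_one_pow,
    MvPolynomial.homogeneousSubmodule_one_eq_span_X]
  congr 1
  rw [← LinearMap.range_comp, LinearMap.range_eq_map, ← b.span_eq, Submodule.map_span,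
    ← Set.range_comp]
  congr 2
  ext1 i
  simp

theorem isHomogeneous_equivMvPolynomial {k V : Type*} [CommRing k] [AddCommGroup V] [Module k V]
    (b : Module.Basis ι k V) {D : ℕ} {f : SymmetricAlgebra k V} (hf : f ∈ SymPow k V D) :
    (SymmetricAlgebra.equivMvPolynomial b f).IsHomogeneous D := by
  rw [← MvPolynomial.mem_homogeneousSubmodule, ← equivMvPolynomial_symPow b D]
  exact Submodule.mem_map_of_mem hf

theorem equivMvPolynomial_sum_prod (b : Module.Basis ι ℂ V) {m D : ℕ} (a : Fin m → ℂ)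
    (x : Fin m → Fin D → V) :
    SymmetricAlgebra.equivMvPolynomial b (∑ j, a j • ∏ i, SymmetricAlgebra.ι ℂ V (x j i))
      = ∑ I : Fin D → ι,
          MvPolynomial.monomial (multiIndexOf I) (∑ j, a j * ∏ i, b.repr (x j i) (I i)) := by
  simp only [map_sum, map_smul, map_prod, equivMvPolynomial_ι]
  rw [Finset.sum_comm]
  refine Finset.sum_congr rfl fun j _ => ?_
  rw [Fintype.prod_sum, Finset.smul_sum]
  refine Finset.sum_congr rfl fun I _ => ?_
  rw [Finset.prod_smul, prod_X_eq_monomial, smul_smul, MvPolynomial.smul_monomial, smul_eq_mul,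
    mul_one]

/-- The tensor product norm is the `ℓ²` norm of the coordinates in the basis of the tensor power
given by an orthonormal basis; these are indexed by the words `I : Fin D → ι`. -/
theorem tensorNorm_eq {c : InnerProductSpace.Core ℂ V} {b : Module.Basis ι ℂ V}
    (hb : IsOrthonormalFor c b) {m D : ℕ} (a : Fin m → ℂ) (x : Fin m → Fin D → V) :
    tensorNorm c a x = √(∑ I : Fin D → ι, ‖∑ j, a j * ∏ i, b.repr (x j i) (I i)‖ ^ 2) := by
  rw [tensorNorm]
  congr 1
  have : ∑ j, ∑ k, conj (a j) * a k * ∏ i, c.inner (x j i) (x k i)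
      = ((∑ I : Fin D → ι, ‖∑ j, a j * ∏ i, b.repr (x j i) (I i)‖ ^ 2 : ℝ) : ℂ) := by
    have h1 : ∀ j k, conj (a j) * a k * ∏ i, c.inner (x j i) (x k i)
        = ∑ I : Fin D → ι, conj (a j * ∏ i, b.repr (x j i) (I i))
          * (a k * ∏ i, b.repr (x k i) (I i)) := by
      intro j k
      simp_rw [hb _ _]
      rw [Fintype.prod_sum, Finset.mul_sum]
      refine Finset.sum_congr rfl fun I _ => ?_
      rw [Finset.prod_mul_distrib, map_mul, map_prod]
      ring
    simp_rw [h1]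
    rw [Finset.sum_congr rfl fun j _ => Finset.sum_comm, Finset.sum_comm]
    push_cast
    refine Finset.sum_congr rfl fun I _ => ?_
    rw [← Complex.conj_mul', map_sum, Finset.sum_mul]
    exact Finset.sum_congr rfl fun j _ => (Finset.mul_sum _ _ _).symm
  rw [this, Complex.ofReal_re]

/-- The projection of a tensor to the polynomials adds the coordinates of the `multinomial α` words
with the same content `α`, so that the Cauchy–Schwarz inequality bounds the norm of the image. -/
theorem bombieriNorm_sum_monomial_le {D : ℕ} (T : (Fin D → ι) → ℂ) :
    bombieriNorm D (∑ I : Fin D → ι, MvPolynomial.monomial (multiIndexOf I) (T I))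
      ≤ √(∑ I, ‖T I‖ ^ 2) := by
  rw [← Finset.sum_fiberwise_of_maps_to (fun I _ => multiIndexOf_mem (ι := ι) (D := D) I)
    fun I => ‖T I‖ ^ 2]
  refine Real.sqrt_le_sqrt (Finset.sum_le_sum fun α hα => ?_)
  have hpos : (0 : ℝ) < α.multinomial := by exact_mod_cast multinomial_pos α
  rw [div_le_iff₀' hpos, ← card_multiIndexOf_eq hα, MvPolynomial.coeff_sum]
  simp_rw [MvPolynomial.coeff_monomial]
  rw [← Finset.sum_filter]
  exact (pow_le_pow_left₀ (norm_nonneg _) (norm_sum_le _ _) 2).trans sq_sum_le_card_mul_sum_sq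

/-- The quotient norm of the tensor product norm is the Bombieri norm: the tensor of least norm
above a polynomial is the symmetric one. -/
theorem symNorm_eq_bombieriNorm {c : InnerProductSpace.Core ℂ V} {b : Module.Basis ι ℂ V}
    (hb : IsOrthonormalFor c b) {D : ℕ} {f : SymmetricAlgebra ℂ V} (hf : f ∈ SymPow ℂ V D) :
    symNorm c D f = bombieriNorm D (SymmetricAlgebra.equivMvPolynomial b f) := by
  have hlb : bombieriNorm D (SymmetricAlgebra.equivMvPolynomial b f) ∈ lowerBounds {t |
      ∃ (m : ℕ) (a : Fin m → ℂ) (x : Fin m → Fin D → V),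
        ∑ j, a j • ∏ i, SymmetricAlgebra.ι ℂ V (x j i) = f ∧ t = tensorNorm c a x} := by
    rintro t ⟨m, a, x, rfl, rfl⟩
    rw [equivMvPolynomial_sum_prod, tensorNorm_eq hb]
    exact bombieriNorm_sum_monomial_le _
  set p := SymmetricAlgebra.equivMvPolynomial b f with hp
  have hhom : p.IsHomogeneous D := isHomogeneous_equivMvPolynomial b hf
  let e : Fin (Fintype.card (Fin D → ι)) ≃ (Fin D → ι) := (Fintype.equivFin _).symm
  -- the coordinates of the symmetric tensor
  let T : (Fin D → ι) → ℂ := fun I => p.coeff (multiIndexOf I) / (multiIndexOf I).multinomial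
  have hT : ∀ I : Fin D → ι, ∑ j, T (e j) * ∏ i, b.repr (b (e j i)) (I i) = T I := by
    intro I
    rw [Equiv.sum_comp e fun J => T J * ∏ i, b.repr (b (J i)) (I i), Finset.sum_eq_single I]
    · simp
    · intro J _ hJ
      obtain ⟨i, hi⟩ := Function.ne_iff.mp hJ
      rw [Finset.prod_eq_zero (Finset.mem_univ i), mul_zero]
      simp [hi]
    · simp
  have hmem : bombieriNorm D p ∈ {t |
      ∃ (m : ℕ) (a : Fin m → ℂ) (x : Fin m → Fin D → V),
        ∑ j, a j • ∏ i, SymmetricAlgebra.ι ℂ V (x j i) = f ∧ t = tensorNorm c a x} := by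
    refine ⟨_, fun j => T (e j), fun j i => b (e j i), ?_, ?_⟩
    · apply (SymmetricAlgebra.equivMvPolynomial b).injective
      rw [equivMvPolynomial_sum_prod, ← hp]
      ext α
      simp_rw [hT, MvPolynomial.coeff_sum, MvPolynomial.coeff_monomial]
      by_cases hα : α ∈ multiIndices ι D
      · rw [← Finset.sum_filter, Finset.sum_congr rfl (g := fun _ => p.coeff α / α.multinomial)]
        · rw [Finset.sum_const, card_multiIndexOf_eq hα, nsmul_eq_mul, mul_div_cancel₀]
          exact_mod_cast (multinomial_pos α).ne'
        · intro I hI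
          rw [← (Finset.mem_filter.mp hI).2]
      · rw [hhom.coeff_eq_zero (by simpa using hα)]
        refine Finset.sum_eq_zero fun I _ => if_neg ?_
        rintro rfl
        exact hα (multiIndexOf_mem I)
    · rw [tensorNorm_eq hb]
      simp_rw [hT]
      rw [bombieriNorm]
      congr 1
      rw [← Finset.sum_fiberwise_of_maps_to (fun I _ => multiIndexOf_mem (ι := ι) (D := D) I)]
      refine Finset.sum_congr rfl fun α hα => ?_
      rw [Finset.sum_congr rfl (g := fun _ => ‖p.coeff α / α.multinomial‖ ^ 2)]
      · have hpos : (α.multinomial : ℝ) ≠ 0 := by exact_mod_cast (multinomial_pos α).ne'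
        rw [Finset.sum_const, card_multiIndexOf_eq hα, nsmul_eq_mul, norm_div, div_pow,
          Complex.norm_natCast]
        field_simp
      · intro I hI
        rw [← (Finset.mem_filter.mp hI).2]
  exact le_antisymm (csInf_le ⟨_, hlb⟩ hmem) (le_csInf ⟨_, hmem⟩ hlb)

end SymNorm

/-! ### Bombieri's inequality -/

section Bombieri

variable {ι : Type*} [Fintype ι] [DecidableEq ι]

/-- The factorial `∏ i, (α i)!` of a multi-index. -/
def multiFactorial (α : ι →₀ ℕ) : ℕ := ∏ i, (α i).factorial

theorem multiFactorial_pos (α : ι →₀ ℕ) : 0 < multiFactorial α :=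
  Finset.prod_pos fun _ _ => Nat.factorial_pos _

theorem multiFactorial_ne_zero (α : ι →₀ ℕ) : (multiFactorial α : ℂ) ≠ 0 :=
  Nat.cast_ne_zero.mpr (multiFactorial_pos α).ne'

@[simp]
theorem multiFactorial_zero : multiFactorial (0 : ι →₀ ℕ) = 1 := by simp [multiFactorial]

theorem multiFactorial_add_single (α : ι →₀ ℕ) (i : ι) :
    multiFactorial (α + Finsupp.single i 1) = (α i + 1) * multiFactorial α := by
  rw [multiFactorial, multiFactorial, ← Finset.mul_prod_erase _ _ (Finset.mem_univ i),
    ← Finset.mul_prod_erase _ (fun j => (α j).factorial) (Finset.mem_univ i), ← mul_assoc]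
  congr 1
  · simp [Nat.factorial_succ]
  · refine Finset.prod_congr rfl fun j hj => ?_
    simp [(Finset.ne_of_mem_erase hj).symm]

theorem multinomial_mul_multiFactorial (α : ι →₀ ℕ) :
    α.multinomial * multiFactorial α = α.degree.factorial := by
  have h := Nat.multinomial_spec α.support α
  rw [← Finsupp.multinomial_eq, mul_comm] at h
  have h2 : multiFactorial α = ∏ i ∈ α.support, (α i).factorial := by
    refine (Finset.prod_subset (Finset.subset_univ _) fun i _ hi => ?_).symm
    rw [Finsupp.notMem_support_iff.mp hi, Nat.factorial_zero]
  rw [h2, h]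
  rfl

theorem sum_antidiagonal_add_single (β : ι →₀ ℕ) (i : ι) (φ : (ι →₀ ℕ) → (ι →₀ ℕ) → ℂ) :
    ∑ x ∈ antidiagonal (β + (Finsupp.single i 1 : ι →₀ ℕ)), (x.1 i : ℂ) * φ x.1 x.2
      = ∑ x ∈ antidiagonal β,
        ((x.1 i : ℂ) + 1) * φ (x.1 + Finsupp.single i 1) x.2 := by
  symm
  refine Finset.sum_of_injOn (fun x => (x.1 + Finsupp.single i 1, x.2)) ?_ ?_ ?_ ?_
  · intro x _ y _ h
    simp only [Prod.mk.injEq, add_left_inj] at h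
    exact Prod.ext h.1 h.2
  · intro x hx
    simp only [Finset.mem_coe, mem_antidiagonal] at hx ⊢
    rw [← hx]; abel
  · intro x hx hx'
    by_cases h0 : x.1 i = 0
    · simp [h0]
    refine absurd ⟨(x.1 - Finsupp.single i 1, x.2), ?_, ?_⟩ hx'
    · rw [mem_antidiagonal] at hx
      simp only [Finset.mem_coe, mem_antidiagonal]
      ext j
      have := DFunLike.congr_fun hx j
      by_cases hj : i = j
      · subst hj
        simp at this ⊢
        omega
      · simpa [Finsupp.single_apply, hj] using this
    · refine Prod.ext ?_ rfl
      exact tsub_add_cancel_of_le (Finsupp.single_le_iff.mpr (Nat.one_le_iff_ne_zero.mpr h0))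
  · intro x _
    simp

/-- `∑ (γ! / (a! b!)) ψ a b` over `a + b = γ`: the functional `X^a Y^b ↦ ψ a b`, applied to
`(X + Y)^γ`. -/
def binomialSum (γ : ι →₀ ℕ) (ψ : (ι →₀ ℕ) → (ι →₀ ℕ) → ℂ) : ℂ :=
  ∑ x ∈ antidiagonal γ,
    (multiFactorial γ : ℂ) / (multiFactorial x.1 * multiFactorial x.2) * ψ x.1 x.2

theorem binomialSum_add_single (β : ι →₀ ℕ) (i : ι) (ψ : (ι →₀ ℕ) → (ι →₀ ℕ) → ℂ) :
    binomialSum (β + Finsupp.single i 1) ψ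
      = binomialSum β fun a b => ψ (a + Finsupp.single i 1) b + ψ a (b + Finsupp.single i 1) := by
  have h1 := sum_antidiagonal_add_single β i fun a b =>
    (multiFactorial β : ℂ) / (multiFactorial a * multiFactorial b) * ψ a b
  have h2 := (Finsupp.sum_antidiagonal_swap (β + Finsupp.single i 1) fun a b =>
      (b i : ℂ) * ((multiFactorial β : ℂ) / (multiFactorial a * multiFactorial b) * ψ a b)).trans
    ((sum_antidiagonal_add_single β i fun b a =>
      (multiFactorial β : ℂ) / (multiFactorial a * multiFactorial b) * ψ a b).trans
    (Finsupp.sum_antidiagonal_swap β fun b a => ((b i : ℂ) + 1) * ((multiFactorial β : ℂ)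
      / (multiFactorial a * multiFactorial (b + Finsupp.single i 1))
        * ψ a (b + Finsupp.single i 1))))
  have e : binomialSum (β + Finsupp.single i 1) ψ
      = ∑ x ∈ antidiagonal (β + (Finsupp.single i 1 : ι →₀ ℕ)), (x.1 i : ℂ)
          * ((multiFactorial β : ℂ) / (multiFactorial x.1 * multiFactorial x.2) * ψ x.1 x.2)
        + ∑ x ∈ antidiagonal (β + (Finsupp.single i 1 : ι →₀ ℕ)), (x.2 i : ℂ)
          * ((multiFactorial β : ℂ) / (multiFactorial x.1 * multiFactorial x.2) * ψ x.1 x.2) := by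
    rw [binomialSum, ← Finset.sum_add_distrib]
    refine Finset.sum_congr rfl fun x hx => ?_
    have hi : x.1 i + x.2 i = β i + 1 := by
      have := DFunLike.congr_fun (mem_antidiagonal.mp hx) i
      simpa using this
    have hi' : (x.1 i : ℂ) + x.2 i = β i + 1 := by exact_mod_cast hi
    rw [multiFactorial_add_single, ← add_mul, hi']
    push_cast
    ring
  rw [e, h1, h2, ← Finset.sum_add_distrib, binomialSum]
  refine Finset.sum_congr rfl fun x _ => ?_
  rw [multiFactorial_add_single, multiFactorial_add_single]
  have a1 := multiFactorial_ne_zero x.1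
  have a2 := multiFactorial_ne_zero x.2
  have a3 : (x.1 i : ℂ) + 1 ≠ 0 := Nat.cast_add_one_ne_zero _
  have a4 : (x.2 i : ℂ) + 1 ≠ 0 := Nat.cast_add_one_ne_zero _
  push_cast
  field_simp

/-- `(X + Y)^(α + β) = (X + Y)^α (X + Y)^β`. -/
theorem binomialSum_add (α β : ι →₀ ℕ) (ψ : (ι →₀ ℕ) → (ι →₀ ℕ) → ℂ) :
    binomialSum (α + β) ψ
      = binomialSum α fun κ l => binomialSum β fun μ ν => ψ (κ + μ) (l + ν) := by
  induction hd : α.degree generalizing α ψ with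
  | zero =>
    rw [Finsupp.degree_eq_zero_iff] at hd
    subst hd
    conv_rhs => rw [binomialSum]
    simp
  | succ d ih =>
    obtain ⟨i, hi⟩ : ∃ i, α i ≠ 0 := by
      by_contra! h
      have : α = 0 := Finsupp.ext h
      simp [this] at hd
    obtain ⟨α', rfl⟩ : ∃ α', α = α' + Finsupp.single i 1 :=
      ⟨α - Finsupp.single i 1, (tsub_add_cancel_of_le
        (Finsupp.single_le_iff.mpr (Nat.one_le_iff_ne_zero.mpr hi))).symm⟩
    have hd' : α'.degree = d := by simpa using hd
    rw [add_right_comm, binomialSum_add_single, ih α' _ hd', binomialSum_add_single]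
    congr 1
    ext κ l
    rw [binomialSum, binomialSum, binomialSum, ← Finset.sum_add_distrib]
    refine Finset.sum_congr rfl fun x _ => ?_
    rw [← mul_add]
    congr 3
    · abel
    · abel

/-- The multi-indices of degree at most `D`. -/
def multiIndicesLE (ι : Type*) [Fintype ι] [DecidableEq ι] (D : ℕ) : Finset (ι →₀ ℕ) :=
  (Finset.range (D + 1)).biUnion (multiIndices ι)

@[simp]
theorem mem_multiIndicesLE {D : ℕ} {α : ι →₀ ℕ} : α ∈ multiIndicesLE ι D ↔ α.degree ≤ D := by
  simp [multiIndicesLE]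

/-- The pairs `(a, b)` with `a + b` of degree `d` can be enumerated without reference to their sum.
-/
theorem sum_sum_antidiagonal {d D : ℕ} (hd : d ≤ D) (φ : (ι →₀ ℕ) → (ι →₀ ℕ) → ℂ)
    (hφ : ∀ a b, (a + b).degree ≠ d → φ a b = 0) :
    ∑ γ ∈ multiIndices ι d, ∑ x ∈ antidiagonal γ, φ x.1 x.2
      = ∑ a ∈ multiIndicesLE ι D, ∑ b ∈ multiIndicesLE ι D, φ a b := by
  rw [← Finset.sum_product', Finset.sum_sigma']
  refine Finset.sum_of_injOn (fun x => x.2) ?_ ?_ ?_ ?_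
  · rintro ⟨γ, x⟩ hx ⟨γ', x'⟩ hx' h
    simp only [Finset.coe_sigma, Finset.mem_coe, Set.mem_sigma_iff, mem_antidiagonal] at *
    subst h
    rw [← hx.2, ← hx'.2]
  · rintro ⟨γ, x⟩ hx
    simp only [Finset.mem_coe, Finset.mem_sigma, mem_antidiagonal, mem_multiIndices] at hx
    simp only [Finset.mem_coe, Finset.mem_product, mem_multiIndicesLE]
    have : x.1.degree + x.2.degree = d := by rw [← map_add, hx.2, hx.1]
    omega
  · intro x _ hx
    refine hφ _ _ fun h => hx ⟨⟨x.1 + x.2, x⟩, ?_, rfl⟩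
    simpa using h
  · intro x _
    rfl

/-- The square of the norm of Bombieri times `D!`, for which monomials have square norm `α!`. -/
theorem factorial_mul_bombieriNorm_sq (D : ℕ) (p : MvPolynomial ι ℂ) :
    (D.factorial : ℝ) * bombieriNorm D p ^ 2
      = ∑ α ∈ multiIndices ι D, (multiFactorial α : ℝ) * ‖p.coeff α‖ ^ 2 := by
  rw [bombieriNorm, Real.sq_sqrt (Finset.sum_nonneg fun _ _ => by positivity), Finset.mul_sum]
  refine Finset.sum_congr rfl fun α hα => ?_
  have h := multinomial_mul_multiFactorial α
  rw [mem_multiIndices.mp hα] at h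
  have hpos : (α.multinomial : ℝ) ≠ 0 := by exact_mod_cast (multinomial_pos α).ne'
  rw [← h]
  push_cast
  field_simp

/-- The expansion of the norm of a product as a sum of squares, one for each pair `(κ, ν)`. Both
factors and the conjugate of the product are expanded: this gives a sum over the two-by-two matrices
of multi-indices `κ, l; μ, ν`, with `p` evaluated at the row sum `κ + l` and, in the conjugate, at
the column sum `κ + μ`, and likewise `q` at `μ + ν` and `l + ν`. For fixed `κ` and `ν` the sums over
`l` and `μ` are conjugate to each other. -/
theorem sum_multiFactorial_mul_coeff_mul {δ ε : ℕ} {p q : MvPolynomial ι ℂ}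
    (hp : p.IsHomogeneous δ) (hq : q.IsHomogeneous ε) :
    ∑ γ ∈ multiIndices ι (δ + ε), (multiFactorial γ : ℝ) * ‖(p * q).coeff γ‖ ^ 2
      = ∑ κ ∈ multiIndicesLE ι (δ + ε), ∑ ν ∈ multiIndicesLE ι (δ + ε),
        ((multiFactorial κ : ℝ) * multiFactorial ν)⁻¹ * ‖∑ l ∈ multiIndicesLE ι (δ + ε),
          (multiFactorial (κ + l) * p.coeff (κ + l))
            * conj (multiFactorial (l + ν) * q.coeff (l + ν)) / (multiFactorial l : ℂ)‖ ^ 2 := by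
  set P : (ι →₀ ℕ) → ℂ := fun α => multiFactorial α * p.coeff α with hP
  set Q : (ι →₀ ℕ) → ℂ := fun α => multiFactorial α * q.coeff α with hQ
  have hP0 : ∀ α, α.degree ≠ δ → P α = 0 := fun α h => by simp [hP, hp.coeff_eq_zero h]
  have hQ0 : ∀ α, α.degree ≠ ε → Q α = 0 := fun α h => by simp [hQ, hq.coeff_eq_zero h]
  set B := multiIndicesLE ι (δ + ε) with hB
  let Θ : (ι →₀ ℕ) → (ι →₀ ℕ) → (ι →₀ ℕ) → (ι →₀ ℕ) → ℂ := fun κ l μ ν =>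
    P (κ + l) * Q (μ + ν) * conj (P (κ + μ) * Q (l + ν))
      / (multiFactorial κ * multiFactorial l * multiFactorial μ * multiFactorial ν)
  -- the left-hand side is a sum over two-by-two matrices of multi-indices
  have hexpand : ∀ γ : ι →₀ ℕ, ((multiFactorial γ * ‖(p * q).coeff γ‖ ^ 2 : ℝ) : ℂ)
      = ∑ x ∈ antidiagonal γ, ∑ y ∈ antidiagonal x.1,
          ∑ z ∈ antidiagonal x.2, Θ y.1 y.2 z.1 z.2 := by
    intro γ
    push_cast
    rw [← Complex.mul_conj', MvPolynomial.coeff_mul, Finset.sum_mul, Finset.mul_sum]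
    refine Finset.sum_congr rfl fun x hx => ?_
    have h1 : (multiFactorial γ : ℂ) * conj (∑ x ∈ antidiagonal γ, p.coeff x.1 * q.coeff x.2)
        = binomialSum γ fun a b => conj (P a * Q b) := by
      rw [map_sum, Finset.mul_sum, binomialSum]
      refine Finset.sum_congr rfl fun x _ => ?_
      have a1 := multiFactorial_ne_zero x.1
      have a2 := multiFactorial_ne_zero x.2
      simp only [hP, hQ, map_mul, Complex.conj_natCast]
      field_simp
    rw [mul_left_comm, h1, ← mem_antidiagonal.mp hx, binomialSum_add, binomialSum,
      Finset.mul_sum]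
    refine Finset.sum_congr rfl fun y hy => ?_
    rw [binomialSum, Finset.mul_sum, Finset.mul_sum]
    refine Finset.sum_congr rfl fun z hz => ?_
    simp only [Θ, mem_antidiagonal.mp hy, mem_antidiagonal.mp hz, hP, hQ]
    have a1 := multiFactorial_ne_zero x.1
    have a2 := multiFactorial_ne_zero x.2
    have a3 := multiFactorial_ne_zero y.1
    have a4 := multiFactorial_ne_zero y.2
    have a5 := multiFactorial_ne_zero z.1
    have a6 := multiFactorial_ne_zero z.2
    field_simp
  have hΘ1 : ∀ κ l μ ν, (κ + l).degree ≠ δ → Θ κ l μ ν = 0 := fun κ l μ ν h => by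
    simp [Θ, hP0 _ h]
  have hΘ2 : ∀ κ l μ ν, (μ + ν).degree ≠ ε → Θ κ l μ ν = 0 := fun κ l μ ν h => by
    simp [Θ, hQ0 _ h]
  have hreindex : ∑ γ ∈ multiIndices ι (δ + ε), ∑ x ∈ antidiagonal γ,
      ∑ y ∈ antidiagonal x.1, ∑ z ∈ antidiagonal x.2, Θ y.1 y.2 z.1 z.2
      = ∑ κ ∈ B, ∑ l ∈ B, ∑ μ ∈ B, ∑ ν ∈ B, Θ κ l μ ν := by
    have hφ1 : ∀ α β : ι →₀ ℕ, α.degree ≠ δ → ∑ y ∈ antidiagonal α,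
        ∑ z ∈ antidiagonal β, Θ y.1 y.2 z.1 z.2 = 0 := fun α β h =>
      Finset.sum_eq_zero fun y hy => Finset.sum_eq_zero fun z _ =>
        hΘ1 _ _ _ _ (by rwa [mem_antidiagonal.mp hy])
    have hφ2 : ∀ α β : ι →₀ ℕ, β.degree ≠ ε → ∑ y ∈ antidiagonal α,
        ∑ z ∈ antidiagonal β, Θ y.1 y.2 z.1 z.2 = 0 := fun α β h =>
      Finset.sum_eq_zero fun y _ => Finset.sum_eq_zero fun z hz =>
        hΘ2 _ _ _ _ (by rwa [mem_antidiagonal.mp hz])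
    rw [sum_sum_antidiagonal (D := δ + ε) le_rfl (fun α β => ∑ y ∈ antidiagonal α,
        ∑ z ∈ antidiagonal β, Θ y.1 y.2 z.1 z.2)]
    · have hsubδ : multiIndices ι δ ⊆ B := fun α hα => by
        simp only [mem_multiIndices] at hα; simp only [hB, mem_multiIndicesLE]; omega
      have hsubε : multiIndices ι ε ⊆ B := fun α hα => by
        simp only [mem_multiIndices] at hα; simp only [hB, mem_multiIndicesLE]; omega
      rw [← hB, ← Finset.sum_subset hsubδ fun α _ hα => Finset.sum_eq_zero fun β _ =>
        hφ1 α β (by simpa using hα)]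
      have e1 : ∀ α, ∑ β ∈ B, ∑ y ∈ antidiagonal α, ∑ z ∈ antidiagonal β,
          Θ y.1 y.2 z.1 z.2
          = ∑ y ∈ antidiagonal α, ∑ μ ∈ B, ∑ ν ∈ B, Θ y.1 y.2 μ ν := by
        intro α
        rw [← Finset.sum_subset hsubε fun β _ hβ => hφ2 α β (by simpa using hβ), Finset.sum_comm]
        refine Finset.sum_congr rfl fun y _ => ?_
        exact sum_sum_antidiagonal (Nat.le_add_left ε δ) _ fun a b h => hΘ2 _ _ _ _ h
      rw [Finset.sum_congr rfl fun α _ => e1 α]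
      refine sum_sum_antidiagonal (Nat.le_add_right δ ε)
        (fun κ l => ∑ μ ∈ B, ∑ ν ∈ B, Θ κ l μ ν) fun a b h => ?_
      exact Finset.sum_eq_zero fun _ _ => Finset.sum_eq_zero fun _ _ => hΘ1 _ _ _ _ h
    · intro α β h
      by_cases hα : α.degree = δ
      · refine hφ2 α β fun hβ => h ?_
        rw [map_add, hα, hβ]
      · exact hφ1 α β hα
  have hsquare : ∀ κ ν, ∑ l ∈ B, ∑ μ ∈ B, Θ κ l μ ν
      = ((((multiFactorial κ : ℝ) * multiFactorial ν)⁻¹ * ‖∑ l ∈ B,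
          P (κ + l) * conj (Q (l + ν)) / (multiFactorial l : ℂ)‖ ^ 2 : ℝ) : ℂ) := by
    intro κ ν
    push_cast
    rw [← Complex.mul_conj', map_sum, Finset.sum_mul, Finset.mul_sum]
    refine Finset.sum_congr rfl fun l _ => ?_
    rw [Finset.mul_sum, Finset.mul_sum]
    refine Finset.sum_congr rfl fun μ _ => ?_
    simp only [Θ, map_mul, map_div₀, Complex.conj_natCast, Complex.conj_conj]
    have a3 := multiFactorial_ne_zero κ
    have a4 := multiFactorial_ne_zero l
    have a5 := multiFactorial_ne_zero μ
    have a6 := multiFactorial_ne_zero ν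
    field_simp
  rw [← Complex.ofReal_inj, Complex.ofReal_sum, Finset.sum_congr rfl fun γ _ => hexpand γ, hreindex,
    Complex.ofReal_sum]
  refine Finset.sum_congr rfl fun κ _ => ?_
  rw [Complex.ofReal_sum, Finset.sum_congr rfl fun l _ => Finset.sum_comm, Finset.sum_comm]
  exact Finset.sum_congr rfl fun ν _ => hsquare κ ν

/-- Bombieri's inequality: in the expansion of the norm of the product as a sum of squares, the
terms with `κ` of degree `δ` and `ν` of degree `ε` add up to the product of the norms. -/
theorem bombieriNorm_mul_le {δ ε : ℕ} {p q : MvPolynomial ι ℂ}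
    (hp : p.IsHomogeneous δ) (hq : q.IsHomogeneous ε) :
    bombieriNorm δ p * bombieriNorm ε q
      ≤ √((δ + ε).choose δ) * bombieriNorm (δ + ε) (p * q) := by
  have hsub : ∀ {d}, d ≤ δ + ε → multiIndices ι d ⊆ multiIndicesLE ι (δ + ε) := fun hd α hα => by
    simp only [mem_multiIndices] at hα
    simp only [mem_multiIndicesLE]
    omega
  have key : (δ.factorial * bombieriNorm δ p ^ 2) * (ε.factorial * bombieriNorm ε q ^ 2)
      ≤ (δ + ε).factorial * bombieriNorm (δ + ε) (p * q) ^ 2 := by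
    rw [factorial_mul_bombieriNorm_sq, factorial_mul_bombieriNorm_sq,
      factorial_mul_bombieriNorm_sq, sum_multiFactorial_mul_coeff_mul hp hq, Finset.sum_mul_sum]
    refine (Finset.sum_le_sum fun κ hκ => ?_).trans (Finset.sum_le_sum_of_subset_of_nonneg
      (hsub (Nat.le_add_right δ ε)) fun _ _ _ => Finset.sum_nonneg fun _ _ => by positivity)
    refine (Finset.sum_le_sum fun ν hν => ?_).trans (Finset.sum_le_sum_of_subset_of_nonneg
      (hsub (Nat.le_add_left ε δ)) fun _ _ _ => by positivity)
    -- for `κ` of degree `δ`, only `l = 0` contributes to the inner sum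
    rw [Finset.sum_eq_single 0]
    · have a1 : (multiFactorial κ : ℝ) ≠ 0 := by exact_mod_cast (multiFactorial_pos κ).ne'
      have a2 : (multiFactorial ν : ℝ) ≠ 0 := by exact_mod_cast (multiFactorial_pos ν).ne'
      refine le_of_eq ?_
      simp only [add_zero, zero_add, multiFactorial_zero, Nat.cast_one, div_one, norm_mul,
        RCLike.norm_conj, Complex.norm_natCast]
      field_simp
    · intro l _ hl
      have : (κ + l).degree ≠ δ := by
        rw [map_add, mem_multiIndices.mp hκ]
        have : l.degree ≠ 0 := fun h => hl (Finsupp.degree_eq_zero_iff l |>.mp h)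
        omega
      rw [hp.coeff_eq_zero this]
      simp
    · intro h
      exact absurd (by simp) h
  have hchoose : ((δ + ε).choose δ : ℝ) * (δ.factorial * ε.factorial) = (δ + ε).factorial := by
    have := Nat.add_choose_mul_factorial_mul_factorial δ ε
    rw [← this, Nat.choose_symm_add]
    push_cast
    ring
  have hfac : (0 : ℝ) < δ.factorial * ε.factorial := by positivity
  have key2 : (bombieriNorm δ p * bombieriNorm ε q) ^ 2
      ≤ (√((δ + ε).choose δ) * bombieriNorm (δ + ε) (p * q)) ^ 2 := by
    rw [mul_pow _ (bombieriNorm (δ + ε) (p * q)), Real.sq_sqrt (by positivity)]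
    refine le_of_mul_le_mul_left ?_ hfac
    calc _ = (δ.factorial * bombieriNorm δ p ^ 2) * (ε.factorial * bombieriNorm ε q ^ 2) := by ring
      _ ≤ _ := key
      _ = _ := by rw [← hchoose]; ring
  exact le_of_sq_le_sq key2 (mul_nonneg (Real.sqrt_nonneg _) (Real.sqrt_nonneg _))

end Bombieri

/-! ### Gaussian integrals of monomials -/

section Gaussian

open MeasureTheory

theorem integrable_conj_pow_mul_pow_mul_exp (j k : ℕ) :
    Integrable fun z : ℂ => conj z ^ j * z ^ k * (Real.exp (-‖z‖ ^ 2) : ℂ) := by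
  have h := Complex.integral_rpow_mul_exp_neg_rpow (p := 2) (q := (j + k : ℕ)) one_le_two
    (by have : (0 : ℝ) ≤ (j + k : ℕ) := Nat.cast_nonneg _; linarith)
  have hpos : 2 * Real.pi / 2 * Real.Gamma (((j + k : ℕ) + 2) / 2) ≠ 0 := by
    have := Real.Gamma_pos_of_pos (s := ((j + k : ℕ) + 2) / 2) (by positivity)
    positivity
  have hi := Integrable.of_integral_ne_zero (h ▸ hpos)
  refine hi.mono' (by fun_prop) (Filter.Eventually.of_forall fun z => ?_)
  rw [norm_mul, norm_mul, norm_pow, norm_pow, RCLike.norm_conj, Complex.norm_real,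
    Real.norm_of_nonneg (Real.exp_pos _).le, ← pow_add, Real.rpow_natCast, Real.rpow_two]

theorem integral_conj_pow_mul_pow_mul_exp (j k : ℕ) :
    ∫ z : ℂ, conj z ^ j * z ^ k * (Real.exp (-‖z‖ ^ 2) : ℂ)
      = if j = k then (Real.pi * j.factorial : ℂ) else 0 := by
  split_ifs with hjk
  · subst hjk
    have h := Complex.integral_rpow_mul_exp_neg_rpow (p := 2) (q := (2 * j : ℕ)) one_le_two
      (by have : (0 : ℝ) ≤ (2 * j : ℕ) := Nat.cast_nonneg _; linarith)
    have hG : Real.Gamma (((2 * j : ℕ) + 2) / 2) = j.factorial := by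
      rw [← Real.Gamma_nat_eq_factorial]
      congr 1
      push_cast
      ring
    rw [hG, mul_div_cancel_left₀ _ two_ne_zero] at h
    have e : ∀ z : ℂ, conj z ^ j * z ^ j * (Real.exp (-‖z‖ ^ 2) : ℂ)
        = ((‖z‖ ^ ((2 * j : ℕ) : ℝ) * Real.exp (-‖z‖ ^ (2 : ℝ)) : ℝ) : ℂ) := by
      intro z
      rw [← mul_pow, Complex.conj_mul', Real.rpow_natCast, Real.rpow_two, ← pow_mul]
      push_cast
      ring
    simp_rw [e]
    rw [integral_complex_ofReal, h]
    push_cast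
    ring
  · -- the integral is multiplied by `ζ ^ k / ζ ^ j` under a rotation by `ζ`
    -- of order `N > max j k`
    set N := j + k + 1 with hN
    have hζ := Complex.isPrimitiveRoot_exp N (by omega)
    set ζ := Complex.exp (2 * Real.pi * Complex.I / N) with hζdef
    have hnorm : ‖ζ‖ = 1 := Complex.norm_eq_one_of_pow_eq_one hζ.pow_eq_one (by omega)
    have hne : ζ ^ j ≠ ζ ^ k := fun h => hjk (hζ.pow_inj (by omega) (by omega) h)
    let c : Circle := ⟨ζ, by simp [Submonoid.unitSphere, hnorm]⟩
    have hrot := (rotation c).measurePreserving.integral_comp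
      (rotation c).toHomeomorph.measurableEmbedding
      fun z : ℂ => conj z ^ j * z ^ k * (Real.exp (-‖z‖ ^ 2) : ℂ)
    have e : ∀ z : ℂ, conj (rotation c z) ^ j * (rotation c z) ^ k
        * (Real.exp (-‖rotation c z‖ ^ 2) : ℂ)
        = conj ζ ^ j * ζ ^ k * (conj z ^ j * z ^ k * (Real.exp (-‖z‖ ^ 2) : ℂ)) := by
      intro z
      have h1 : rotation c z = ζ * z := rotation_apply c z
      rw [h1, norm_mul, hnorm, one_mul, map_mul]
      ring
    simp_rw [e] at hrot
    rw [integral_const_mul] at hrot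
    have h1 : conj ζ ^ j * ζ ^ k ≠ 1 := by
      intro h
      have h2 : conj ζ ^ j * ζ ^ j = 1 := by
        rw [← mul_pow, Complex.conj_mul', hnorm]; simp
      have h3 : conj ζ ^ j ≠ 0 := fun h0 => by rw [h0, zero_mul] at h2; exact zero_ne_one h2
      exact hne (mul_left_cancel₀ h3 (h2.trans h.symm))
    have h2 : (conj ζ ^ j * ζ ^ k - 1) * ∫ z : ℂ, conj z ^ j * z ^ k
        * (Real.exp (-‖z‖ ^ 2) : ℂ) = 0 := by
      rw [sub_mul, hrot, one_mul, sub_self]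
    exact (mul_eq_zero.mp h2).resolve_left (sub_ne_zero.mpr h1)

variable {ι : Type*} [Fintype ι] [DecidableEq ι]

/-- The monomial `a^α`, normalised to have norm `1` for the Bombieri norm, times the square root of
the Gaussian weight. -/
def gaussianMonomial (α : ι →₀ ℕ) (a : ι → ℂ) : ℂ :=
  √α.multinomial * (∏ i, a i ^ α i) * ∏ i, (Real.exp (-‖a i‖ ^ 2 / 2) : ℂ)

theorem conj_gaussianMonomial_mul (α β : ι →₀ ℕ) (a : ι → ℂ) :
    conj (gaussianMonomial α a) * gaussianMonomial β a
      = (√α.multinomial * √β.multinomial : ℂ)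
        * ∏ i, (conj (a i) ^ α i * a i ^ β i * (Real.exp (-‖a i‖ ^ 2) : ℂ)) := by
  have h : ∀ i, (Real.exp (-‖a i‖ ^ 2) : ℂ)
      = (Real.exp (-‖a i‖ ^ 2 / 2) : ℂ) * (Real.exp (-‖a i‖ ^ 2 / 2) : ℂ) := fun i => by
    rw [← Complex.ofReal_mul, ← Real.exp_add, add_halves]
  simp_rw [h, Finset.prod_mul_distrib]
  simp only [gaussianMonomial, map_mul, map_prod, map_pow, Complex.conj_ofReal]
  ring

theorem integrable_conj_gaussianMonomial_mul (α β : ι →₀ ℕ) :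
    Integrable fun a : ι → ℂ => conj (gaussianMonomial α a) * gaussianMonomial β a := by
  simp_rw [conj_gaussianMonomial_mul]
  refine Integrable.const_mul ?_ _
  exact Integrable.fintype_prod (μ := fun _ => volume)
    (f := fun i z => conj z ^ α i * z ^ β i * (Real.exp (-‖z‖ ^ 2) : ℂ))
    fun i => integrable_conj_pow_mul_pow_mul_exp (α i) (β i)

/-- The normalised monomials of degree `D` are orthogonal for the Gaussian measure, with a square
norm which does not depend on the monomial. -/
theorem integral_conj_gaussianMonomial_mul {D : ℕ} {α β : ι →₀ ℕ} (hα : α ∈ multiIndices ι D) :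
    ∫ a : ι → ℂ, conj (gaussianMonomial α a) * gaussianMonomial β a
      = if α = β then ((Real.pi ^ Fintype.card ι * D.factorial : ℝ) : ℂ) else 0 := by
  simp_rw [conj_gaussianMonomial_mul]
  rw [integral_const_mul, integral_fintype_prod_volume_eq_prod
    fun i z => conj z ^ α i * z ^ β i * (Real.exp (-‖z‖ ^ 2) : ℂ)]
  simp_rw [integral_conj_pow_mul_pow_mul_exp]
  split_ifs with h
  · subst h
    simp only [if_true, Finset.prod_mul_distrib, Finset.prod_const, Finset.card_univ]
    rw [← Complex.ofReal_mul, Real.mul_self_sqrt (Nat.cast_nonneg _)]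
    have h2 := multinomial_mul_multiFactorial α
    rw [mem_multiIndices.mp hα] at h2
    rw [← h2, multiFactorial]
    push_cast
    ring
  · obtain ⟨i, hi⟩ : ∃ i, α i ≠ β i := by
      by_contra! h0
      exact h (Finsupp.ext h0)
    rw [Finset.prod_eq_zero (Finset.mem_univ i) (if_neg hi), mul_zero]

end Gaussian

/-! ### Traces of real quadratic forms -/

section Trace

open MeasureTheory

variable {W : Type*} [AddCommGroup W] [Module ℂ W] [Module ℝ W] [IsScalarTower ℝ ℂ W]
  {J : Type*} [Fintype J] [DecidableEq J]

/-- A real quadratic form, averaged over multiplication by `1` and `I`, is a Hermitian form. -/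
theorem exists_hermitian_matrix (β : Module.Basis J ℂ W) (C : LinearMap.BilinForm ℝ W) :
    ∃ h : J → J → ℂ,
      (∀ j, (h j j).re = C (β j) (β j) + C (Complex.I • β j) (Complex.I • β j)) ∧
      ∀ x : J → ℂ, C (∑ j, x j • β j) (∑ j, x j • β j)
        + C (Complex.I • ∑ j, x j • β j) (Complex.I • ∑ j, x j • β j)
        = (∑ i, ∑ j, conj (x i) * x j * h i j).re := by
  refine ⟨fun i j => ⟨C (β i) (β j) + C (Complex.I • β i) (Complex.I • β j),
    C (Complex.I • β i) (β j) - C (β i) (Complex.I • β j)⟩, fun j => rfl, fun x => ?_⟩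
  have hz : ∀ (z : ℂ) (w : W), z • w = z.re • w + z.im • (Complex.I • w) := by
    intro z w
    rw [← algebraMap_smul ℂ z.re w, ← algebraMap_smul ℂ z.im, smul_smul, ← add_smul]
    congr 1
    exact (Complex.re_add_im z).symm
  have hI : ∀ w : W, Complex.I • (Complex.I • w) = -w := fun w => by
    rw [smul_smul, Complex.I_mul_I, neg_one_smul]
  have hcomm : ∀ (r : ℝ) (w : W), Complex.I • (r • w) = r • (Complex.I • w) := by
    intro r w
    rw [← algebraMap_smul ℂ r w, ← algebraMap_smul ℂ r, smul_comm]
  simp only [Finset.smul_sum, map_sum, LinearMap.sum_apply, ← Finset.sum_add_distrib,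
    Complex.re_sum]
  rw [Finset.sum_comm]
  refine Finset.sum_congr rfl fun i _ => Finset.sum_congr rfl fun j _ => ?_
  rw [hz (x i), hz (x j)]
  simp only [smul_add, hcomm, hI, map_add, map_smul, map_neg, LinearMap.add_apply,
    LinearMap.smul_apply, LinearMap.neg_apply, smul_eq_mul, smul_neg, Complex.mul_re,
    Complex.mul_im, Complex.conj_re, Complex.conj_im]
  ring

/-- If the vectors with coordinates `ψ · a`, for `a` in a measure space, average to a multiple of
the identity, then the trace of a real quadratic form is bounded by its values on these vectors. -/
theorem sum_le_of_forall_le (β : Module.Basis J ℂ W) (C : LinearMap.BilinForm ℝ W)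
    {A : Type*} [MeasurableSpace A] {μ : Measure A} {ψ : J → A → ℂ}
    (hint : ∀ i j, Integrable (fun a => conj (ψ i a) * ψ j a) μ) {κ : ℝ} (hκ : 0 < κ)
    (horth : ∀ i j, ∫ a, conj (ψ i a) * ψ j a ∂μ = if i = j then (κ : ℂ) else 0)
    (hle : ∀ a, C (∑ j, ψ j a • β j) (∑ j, ψ j a • β j) ≤ ∑ j, ‖ψ j a‖ ^ 2)
    (hle' : ∀ a, C (Complex.I • ∑ j, ψ j a • β j) (Complex.I • ∑ j, ψ j a • β j)
      ≤ ∑ j, ‖ψ j a‖ ^ 2) :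
    ∑ j, (C (β j) (β j) + C (Complex.I • β j) (Complex.I • β j)) ≤ 2 * Fintype.card J := by
  obtain ⟨h, hdiag, hx⟩ := exists_hermitian_matrix β C
  have hint2 : ∀ i j, Integrable (fun a => conj (ψ i a) * ψ j a * h i j) μ :=
    fun i j => (hint i j).mul_const _
  have hint3 : Integrable (fun a => ∑ i, ∑ j, conj (ψ i a) * ψ j a * h i j) μ :=
    integrable_finsetSum _ fun i _ => integrable_finsetSum _ fun j _ => hint2 i j
  have hint4 : Integrable (fun a => ∑ j, conj (ψ j a) * ψ j a) μ :=
    integrable_finsetSum _ fun j _ => hint j j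
  have hmono : ∫ a, (∑ i, ∑ j, conj (ψ i a) * ψ j a * h i j).re ∂μ
      ≤ ∫ a, 2 * (∑ j, conj (ψ j a) * ψ j a).re ∂μ := by
    refine integral_mono hint3.re (hint4.re.const_mul 2) fun a => ?_
    have h1 : (∑ j, conj (ψ j a) * ψ j a).re = ∑ j, ‖ψ j a‖ ^ 2 := by
      rw [Complex.re_sum]
      refine Finset.sum_congr rfl fun j _ => ?_
      rw [Complex.conj_mul', ← Complex.ofReal_pow, Complex.ofReal_re]
    change (∑ i, ∑ j, conj (ψ i a) * ψ j a * h i j).re ≤ 2 * (∑ j, conj (ψ j a) * ψ j a).re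
    rw [← hx, h1]
    linarith [hle a, hle' a]
  have hL : ∫ a, (∑ i, ∑ j, conj (ψ i a) * ψ j a * h i j).re ∂μ
      = κ * ∑ j, (C (β j) (β j) + C (Complex.I • β j) (Complex.I • β j)) := by
    have := integral_re hint3
    simp only [RCLike.re_eq_complex_re] at this
    rw [this, integral_finsetSum _ fun i _ => integrable_finsetSum _ fun j _ => hint2 i j,
      Complex.re_sum, Finset.mul_sum]
    refine Finset.sum_congr rfl fun i _ => ?_
    rw [integral_finsetSum _ fun j _ => hint2 i j]
    simp_rw [integral_mul_const, horth]
    simp [hdiag]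
  have hR : ∫ a, 2 * (∑ j, conj (ψ j a) * ψ j a).re ∂μ = κ * (2 * Fintype.card J) := by
    have := integral_re hint4
    simp only [RCLike.re_eq_complex_re] at this
    rw [integral_const_mul, this, integral_finsetSum _ fun j _ => hint j j]
    simp_rw [horth]
    simp
    ring
  rw [hL, hR] at hmono
  exact le_of_mul_le_mul_left hmono hκ

end Trace

/-! ### The supremum norm -/

section SupNorm

variable {ι : Type*} [Fintype ι] [DecidableEq ι]

/-- The multinomial theorem, in terms of multi-indices. -/
theorem sum_pow_eq_sum_multinomial {k : Type*} [CommSemiring k] (t : ι → k) (D : ℕ) :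
    (∑ i, t i) ^ D = ∑ α ∈ multiIndices ι D, (α.multinomial : k) * ∏ i, t i ^ α i := by
  rw [Fintype.sum_pow, ← Finset.sum_fiberwise_of_maps_to
    (fun I _ => multiIndexOf_mem (ι := ι) (D := D) I)]
  refine Finset.sum_congr rfl fun α hα => ?_
  rw [← card_multiIndexOf_eq hα, ← nsmul_eq_mul, ← Finset.sum_const]
  refine Finset.sum_congr rfl fun I hI => ?_
  have h := congrArg (MvPolynomial.eval t) (prod_X_eq_monomial k I)
  rw [map_prod, MvPolynomial.eval_monomial, one_mul, (Finset.mem_filter.mp hI).2,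
    Finsupp.prod_fintype _ _ fun _ => pow_zero _] at h
  simpa using h

theorem eval_eq_sum_multiIndices {D : ℕ} {p : MvPolynomial ι ℂ} (hp : p.IsHomogeneous D)
    (a : ι → ℂ) :
    MvPolynomial.eval a p = ∑ α ∈ multiIndices ι D, p.coeff α * ∏ i, a i ^ α i := by
  rw [MvPolynomial.eval_eq']
  refine Finset.sum_subset (fun α hα => ?_) fun α _ hα => ?_
  · rw [mem_multiIndices]
    by_contra h
    exact MvPolynomial.mem_support_iff.mp hα (hp.coeff_eq_zero h)
  · rw [MvPolynomial.notMem_support_iff.mp hα, zero_mul]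

/-- The Cauchy–Schwarz inequality, as evaluation at `a` is the inner product with the power of a
vector of norm `‖a‖`. -/
theorem norm_eval_le {D : ℕ} {p : MvPolynomial ι ℂ} (hp : p.IsHomogeneous D) (a : ι → ℂ) :
    ‖MvPolynomial.eval a p‖ ≤ bombieriNorm D p * √(∑ i, ‖a i‖ ^ 2) ^ D := by
  have h1 : √(∑ i, ‖a i‖ ^ 2) ^ D
      = √(∑ α ∈ multiIndices ι D, (√α.multinomial * ∏ i, ‖a i‖ ^ α i) ^ 2) := by
    have h0 : 0 ≤ ∑ i, ‖a i‖ ^ 2 := Finset.sum_nonneg fun _ _ => by positivity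
    rw [eq_comm, Real.sqrt_eq_iff_mul_self_eq (Finset.sum_nonneg fun _ _ => by positivity)
      (by positivity), ← mul_pow, Real.mul_self_sqrt h0, sum_pow_eq_sum_multinomial]
    refine Finset.sum_congr rfl fun α _ => ?_
    rw [mul_pow, Real.sq_sqrt (Nat.cast_nonneg _), ← Finset.prod_pow]
    congr 1
    exact Finset.prod_congr rfl fun i _ => by rw [← pow_mul, ← pow_mul, mul_comm]
  rw [h1, bombieriNorm, ← Real.sqrt_mul (Finset.sum_nonneg fun _ _ => by positivity),
    eval_eq_sum_multiIndices hp]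
  refine Real.le_sqrt_of_sq_le ?_
  have h2 : ∑ α ∈ multiIndices ι D, ‖p.coeff α‖ ^ 2 / α.multinomial
      = ∑ α ∈ multiIndices ι D, (‖p.coeff α‖ / √α.multinomial) ^ 2 :=
    Finset.sum_congr rfl fun α _ => by rw [div_pow, Real.sq_sqrt (Nat.cast_nonneg _)]
  rw [h2]
  refine le_trans (pow_le_pow_left₀ (norm_nonneg _) ?_ 2) (Finset.sum_mul_sq_le_sq_mul_sq _ _ _)
  refine (norm_sum_le _ _).trans (Finset.sum_le_sum fun α _ => le_of_eq ?_)
  have hpos : √(α.multinomial : ℝ) ≠ 0 := by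
    have := multinomial_pos α
    positivity
  rw [norm_mul, norm_prod]
  simp_rw [norm_pow]
  field_simp

variable {V : Type*} [AddCommGroup V] [Module ℂ V]

theorem coreNorm_eq_sqrt {c : InnerProductSpace.Core ℂ V} {b : Module.Basis ι ℂ V}
    (hb : IsOrthonormalFor c b) (x : V) : coreNorm c x = √(∑ i, ‖b.repr x i‖ ^ 2) := by
  rw [coreNorm, hb, Complex.re_sum]
  congr 1
  refine Finset.sum_congr rfl fun i _ => ?_
  rw [Complex.conj_mul', ← Complex.ofReal_pow, Complex.ofReal_re]

/-- The quotient norm on `ℂ`, for a nonzero functional on a Hermitian space, is the inverse of the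
norm of the functional. -/
theorem sInf_coreNorm_eq {c : InnerProductSpace.Core ℂ V} {b : Module.Basis ι ℂ V}
    (hb : IsOrthonormalFor c b) {φ : V →ₗ[ℂ] ℂ} (hφ : φ ≠ 0) :
    sInf {t | ∃ x, φ x = 1 ∧ t = coreNorm c x} = (√(∑ i, ‖φ (b i)‖ ^ 2))⁻¹ := by
  set S := ∑ i, ‖φ (b i)‖ ^ 2 with hS
  have hφx : ∀ x, φ x = ∑ i, b.repr x i * φ (b i) := fun x => by
    conv_lhs => rw [← b.sum_repr x, map_sum]
    simp
  have hSpos : 0 < S := by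
    refine lt_of_le_of_ne (Finset.sum_nonneg fun _ _ => sq_nonneg _) fun h => hφ ?_
    rw [eq_comm, hS, Finset.sum_eq_zero_iff_of_nonneg fun _ _ => sq_nonneg _] at h
    refine b.ext fun i => ?_
    simpa using h i (Finset.mem_univ i)
  have hsq : 0 < √S := Real.sqrt_pos.mpr hSpos
  apply le_antisymm
  · -- the vector of least norm with `φ x = 1`
    set x : V := ∑ i, (conj (φ (b i)) / S : ℂ) • b i with hx
    have hr : ∀ i, b.repr x i = conj (φ (b i)) / S := fun i => by
      rw [hx, b.repr_sum_self]
    refine csInf_le ⟨0, ?_⟩ ⟨x, ?_, ?_⟩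
    · rintro t ⟨y, -, rfl⟩
      exact Real.sqrt_nonneg _
    · rw [hφx]
      simp_rw [hr, div_mul_eq_mul_div, Complex.conj_mul']
      rw [← Finset.sum_div]
      have : (S : ℂ) = ∑ i, (‖φ (b i)‖ : ℂ) ^ 2 := by rw [hS]; push_cast; rfl
      rw [← this, div_self]
      exact_mod_cast hSpos.ne'
    · rw [coreNorm_eq_sqrt hb]
      simp_rw [hr, norm_div, RCLike.norm_conj, Complex.norm_real, Real.norm_of_nonneg hSpos.le,
        div_pow]
      rw [← Finset.sum_div, ← hS, sq, div_mul_cancel_left₀ hSpos.ne', Real.sqrt_inv]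
  · obtain ⟨x₀, hx₀⟩ : ∃ x, φ x = 1 := by
      obtain ⟨y, hy⟩ : ∃ y, φ y ≠ 0 := by
        by_contra! h
        exact hφ (LinearMap.ext h)
      exact ⟨(φ y)⁻¹ • y, by rw [map_smul, smul_eq_mul, inv_mul_cancel₀ hy]⟩
    refine le_csInf ⟨_, x₀, hx₀, rfl⟩ ?_
    rintro t ⟨x, hx, rfl⟩
    rw [inv_le_iff_one_le_mul₀ hsq, coreNorm_eq_sqrt hb,
      ← Real.sqrt_mul (Finset.sum_nonneg fun _ _ => sq_nonneg _)]
    refine Real.le_sqrt_of_sq_le ?_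
    refine le_trans ?_ (Finset.sum_mul_sq_le_sq_mul_sq _ _ _)
    refine pow_le_pow_left₀ zero_le_one ?_ 2
    calc (1 : ℝ) = ‖φ x‖ := by rw [hx, norm_one]
      _ ≤ ∑ i, ‖b.repr x i‖ * ‖φ (b i)‖ := by
        rw [hφx]
        exact (norm_sum_le _ _).trans (Finset.sum_le_sum fun i _ => (norm_mul _ _).le)

theorem lift_eq_eval (b : Module.Basis ι ℂ V) (φ : V →ₗ[ℂ] ℂ) (f : SymmetricAlgebra ℂ V) :
    SymmetricAlgebra.lift φ f
      = MvPolynomial.eval (fun i => φ (b i)) (SymmetricAlgebra.equivMvPolynomial b f) := by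
  have : SymmetricAlgebra.lift φ = (MvPolynomial.aeval fun i => φ (b i)).comp
      (SymmetricAlgebra.equivMvPolynomial b).toAlgHom := by
    refine SymmetricAlgebra.algHom_ext (b.ext fun i => ?_)
    simp
  rw [this]
  simp [MvPolynomial.aeval_eq_eval]

theorem fubiniStudyNorm_le {c : InnerProductSpace.Core ℂ V} {b : Module.Basis ι ℂ V}
    (hb : IsOrthonormalFor c b) {D : ℕ} {f : SymmetricAlgebra ℂ V} (hf : f ∈ SymPow ℂ V D)
    {φ : V →ₗ[ℂ] ℂ} (hφ : φ ≠ 0) :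
    fubiniStudyNorm c D φ f ≤ bombieriNorm D (SymmetricAlgebra.equivMvPolynomial b f) := by
  rw [fubiniStudyNorm, sInf_coreNorm_eq hb hφ, lift_eq_eval b]
  have hpos : 0 < √(∑ i, ‖φ (b i)‖ ^ 2) := by
    refine Real.sqrt_pos.mpr (lt_of_le_of_ne (Finset.sum_nonneg fun _ _ => sq_nonneg _) fun h =>
      hφ ?_)
    rw [eq_comm, Finset.sum_eq_zero_iff_of_nonneg fun _ _ => sq_nonneg _] at h
    refine b.ext fun i => ?_
    simpa using h i (Finset.mem_univ i)
  rw [inv_pow, ← div_eq_mul_inv, div_le_iff₀ (pow_pos hpos D)]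
  exact norm_eval_le (isHomogeneous_equivMvPolynomial b hf) _

theorem supNorm_le_bombieriNorm {c : InnerProductSpace.Core ℂ V} {b : Module.Basis ι ℂ V}
    (hb : IsOrthonormalFor c b) {D : ℕ} {f : SymmetricAlgebra ℂ V} (hf : f ∈ SymPow ℂ V D) :
    supNorm c D f ≤ bombieriNorm D (SymmetricAlgebra.equivMvPolynomial b f) :=
  Real.iSup_le (fun φ => fubiniStudyNorm_le hb hf φ.2) (Real.sqrt_nonneg _)

/-- For a functional of norm `1` the Fubini–Study norm at the corresponding point is the absolute
value of the polynomial. -/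
theorem norm_eval_le_supNorm {c : InnerProductSpace.Core ℂ V} {b : Module.Basis ι ℂ V}
    (hb : IsOrthonormalFor c b) {D : ℕ} {f : SymmetricAlgebra ℂ V} (hf : f ∈ SymPow ℂ V D)
    {a : ι → ℂ} (ha : ∑ i, ‖a i‖ ^ 2 = 1) :
    ‖MvPolynomial.eval a (SymmetricAlgebra.equivMvPolynomial b f)‖ ≤ supNorm c D f := by
  set φ : V →ₗ[ℂ] ℂ := b.constr ℂ a with hφdef
  have hφb : ∀ i, φ (b i) = a i := fun i => b.constr_basis ℂ a i
  have hφ : φ ≠ 0 := by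
    intro h
    simp [h, ← hφb] at ha
  have h1 : fubiniStudyNorm c D φ f
      = ‖MvPolynomial.eval a (SymmetricAlgebra.equivMvPolynomial b f)‖ := by
    rw [fubiniStudyNorm, sInf_coreNorm_eq hb hφ, lift_eq_eval b]
    simp_rw [hφb]
    rw [ha]
    simp
  rw [← h1]
  refine le_ciSup (f := fun φ : {φ : V →ₗ[ℂ] ℂ // φ ≠ 0} => fubiniStudyNorm c D φ.1 f) ?_ ⟨φ, hφ⟩
  exact ⟨_, Set.forall_mem_range.mpr fun φ => fubiniStudyNorm_le hb hf φ.2⟩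

end SupNorm

/-! ### The norm of John of the supremum norm -/

section JohnSup

variable {ι : Type*} [Fintype ι] [DecidableEq ι] {V : Type*} [AddCommGroup V] [Module ℂ V]

/-- The coordinates of a homogeneous polynomial of degree `D` in the orthonormal basis of the
monomials `√(multinomial α) X^α`. -/
def bombieriCoord (D : ℕ) (p : MvPolynomial ι ℂ) (α : multiIndices ι D) : ℂ :=
  p.coeff α / (√((α : ι →₀ ℕ).multinomial : ℝ) : ℝ)

theorem sqrt_multinomial_ne_zero (α : ι →₀ ℕ) : ((√(α.multinomial : ℝ) : ℝ) : ℂ) ≠ 0 := by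
  have := multinomial_pos α
  exact_mod_cast (Real.sqrt_pos.mpr (Nat.cast_pos.mpr this)).ne'

theorem bombieriNorm_eq_sqrt_sum (D : ℕ) (p : MvPolynomial ι ℂ) :
    bombieriNorm D p = √(∑ α, ‖bombieriCoord D p α‖ ^ 2) := by
  rw [bombieriNorm, ← Finset.sum_coe_sort]
  congr 1
  refine Finset.sum_congr rfl fun α _ => ?_
  rw [bombieriCoord, norm_div, div_pow, Complex.norm_real, Real.norm_of_nonneg (Real.sqrt_nonneg _),
    Real.sq_sqrt (Nat.cast_nonneg _)]

/-- The linear isomorphism given by the coefficients of a homogeneous polynomial. -/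
def homogeneousCoeffEquiv (k : Type*) [CommRing k] (D : ℕ) :
    MvPolynomial.homogeneousSubmodule ι k D ≃ₗ[k] (multiIndices ι D → k) where
  toFun p α := (p : MvPolynomial ι k).coeff (α : ι →₀ ℕ)
  map_add' p q := by
    ext α
    simp
  map_smul' z p := by
    ext α
    simp
  invFun x := ⟨∑ α : multiIndices ι D, MvPolynomial.monomial (α : ι →₀ ℕ) (x α),
    Submodule.sum_mem _ fun α _ => MvPolynomial.isHomogeneous_monomial _ (mem_multiIndices.mp α.2)⟩
  left_inv p := by
    ext γ
    simp only [MvPolynomial.coeff_sum, MvPolynomial.coeff_monomial]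
    by_cases hγ : γ ∈ multiIndices ι D
    · rw [Finset.sum_eq_single ⟨γ, hγ⟩]
      · rw [if_pos rfl]
      · intro α _ hα
        exact if_neg fun h => hα (Subtype.ext h)
      · simp
    · rw [MvPolynomial.IsHomogeneous.coeff_eq_zero p.2 (by simpa using hγ)]
      refine Finset.sum_eq_zero fun α _ => if_neg ?_
      rintro rfl
      exact hγ α.2
  right_inv x := by
    ext γ
    simp only [MvPolynomial.coeff_sum, MvPolynomial.coeff_monomial]
    rw [Finset.sum_eq_single γ]
    · rw [if_pos rfl]
    · intro α _ hα
      exact if_neg fun h => hα (Subtype.ext h)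
    · simp

/-- The linear isomorphism given by `bombieriCoord`. -/
def bombieriCoordEquiv (D : ℕ) :
    MvPolynomial.homogeneousSubmodule ι ℂ D ≃ₗ[ℂ] (multiIndices ι D → ℂ) :=
  (homogeneousCoeffEquiv ℂ D).trans (LinearEquiv.piCongrRight fun α =>
    LinearEquiv.smulOfNeZero ℂ ℂ _ (inv_ne_zero (sqrt_multinomial_ne_zero (α : ι →₀ ℕ))))

theorem bombieriCoordEquiv_apply (D : ℕ) (p : MvPolynomial.homogeneousSubmodule ι ℂ D) :
    bombieriCoordEquiv D p = bombieriCoord D (p : MvPolynomial ι ℂ) :=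
  funext fun _ => (div_eq_inv_mul _ _).symm

/-- The linear isomorphism of `Sym^D(V)` with the homogeneous polynomials given by a basis. -/
def symPowEquiv {k V : Type*} [CommRing k] [AddCommGroup V] [Module k V] (b : Module.Basis ι k V)
    (D : ℕ) : SymPow k V D ≃ₗ[k] MvPolynomial.homogeneousSubmodule ι k D :=
  ((SymmetricAlgebra.equivMvPolynomial b).toLinearEquiv.submoduleMap (SymPow k V D)).trans
    (LinearEquiv.ofEq _ _ (equivMvPolynomial_symPow b D))

end JohnSup

section HermitianForm

variable {J : Type*} [Fintype J] [DecidableEq J] {W : Type*} [AddCommGroup W] [Module ℂ W]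
  [Module ℝ W] [IsScalarTower ℝ ℂ W] (β : Module.Basis J ℂ W)

theorem repr_real_smul (r : ℝ) (y : W) (α : J) : β.repr (r • y) α = r * β.repr y α := by
  rw [← algebraMap_smul ℂ r y, map_smul]
  rfl

/-- The real part of the Hermitian form for which the basis `β` is orthonormal. -/
def reHermitianForm : LinearMap.BilinForm ℝ W := LinearMap.mk₂ ℝ
  (fun y z => (∑ α, conj (β.repr y α) * β.repr z α).re)
  (fun y y' z => by
    simp only [map_add, Finsupp.add_apply, add_mul, Finset.sum_add_distrib, Complex.add_re])
  (fun r y z => by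
    simp only [repr_real_smul, map_mul, Complex.conj_ofReal, mul_assoc,
      ← Finset.mul_sum, Complex.re_ofReal_mul, smul_eq_mul])
  (fun y z z' => by
    simp only [map_add, Finsupp.add_apply, mul_add, Finset.sum_add_distrib, Complex.add_re])
  (fun r y z => by
    simp only [repr_real_smul, mul_left_comm _ (r : ℂ), ← Finset.mul_sum,
      Complex.re_ofReal_mul, smul_eq_mul])

theorem reHermitianForm_apply (y z : W) :
    reHermitianForm β y z = (∑ α, conj (β.repr y α) * β.repr z α).re := rfl

theorem reHermitianForm_self (y : W) : reHermitianForm β y y = ∑ α, ‖β.repr y α‖ ^ 2 := by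
  rw [reHermitianForm_apply, Complex.re_sum]
  refine Finset.sum_congr rfl fun α _ => ?_
  rw [Complex.conj_mul', ← Complex.ofReal_pow, Complex.ofReal_re]

theorem reHermitianForm_symm (y z : W) : reHermitianForm β y z = reHermitianForm β z y := by
  rw [reHermitianForm_apply, reHermitianForm_apply, ← Complex.conj_re, map_sum]
  congr 1
  refine Finset.sum_congr rfl fun α _ => ?_
  rw [map_mul, Complex.conj_conj, mul_comm]

theorem reHermitianForm_pos {y : W} (hy : y ≠ 0) : 0 < reHermitianForm β y y := by
  rw [reHermitianForm_self]
  refine lt_of_le_of_ne (Finset.sum_nonneg fun _ _ => sq_nonneg _) fun h => hy ?_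
  rw [eq_comm, Finset.sum_eq_zero_iff_of_nonneg fun _ _ => sq_nonneg _] at h
  refine β.repr.map_eq_zero_iff.mp (Finsupp.ext fun α => ?_)
  simpa using h α (Finset.mem_univ α)

theorem toMatrix_reHermitianForm :
    LinearMap.BilinForm.toMatrix (Complex.basisOneI.smulTower β) (reHermitianForm β) = 1 := by
  ext ⟨i, α⟩ ⟨j, γ⟩
  rw [LinearMap.BilinForm.toMatrix_apply, reHermitianForm_apply]
  have h : ∀ (z : ℂ) (α γ : J), β.repr (z • β α) γ = if α = γ then z else 0 := fun z α γ => by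
    rw [map_smul, β.repr_self, Finsupp.smul_apply, Finsupp.single_apply, smul_eq_mul, mul_ite,
      mul_one, mul_zero]
  simp only [Module.Basis.smulTower_apply, h, Matrix.one_apply, Prod.mk.injEq]
  rw [Finset.sum_eq_single α (fun a _ ha => by rw [if_neg ha.symm, map_zero, zero_mul])
    (fun h => absurd (Finset.mem_univ α) h), if_pos rfl]
  by_cases hγ : γ = α
  · subst hγ
    fin_cases i <;> fin_cases j <;> simp
  · rw [if_neg hγ, if_neg fun h => hγ h.2.symm, mul_zero, Complex.zero_re]

end HermitianForm

section PowerVector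

variable {ι : Type*} [Fintype ι] [DecidableEq ι] {W : Type*} [AddCommGroup W] [Module ℂ W]
  [Module ℝ W] [IsScalarTower ℝ ℂ W] {D : ℕ} (β : Module.Basis (multiIndices ι D) ℂ W)

/-- The vector corresponding to the power `(∑ i, a i • X i) ^ D` when `β` is the orthonormal basis
of the monomials `√(multinomial α) X^α`. -/
def powerVector (a : ι → ℂ) : W :=
  ∑ α : multiIndices ι D,
    ((√((α : ι →₀ ℕ).multinomial : ℝ) : ℝ) * ∏ i, a i ^ (α : ι →₀ ℕ) i : ℂ) • β α

theorem repr_powerVector (a : ι → ℂ) (α : multiIndices ι D) :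
    β.repr (powerVector β a) α
      = (√((α : ι →₀ ℕ).multinomial : ℝ) : ℝ) * ∏ i, a i ^ (α : ι →₀ ℕ) i := by
  rw [powerVector, β.repr_sum_self]

theorem powerVector_smul (z : ℂ) (a : ι → ℂ) :
    powerVector β (fun i => z * a i) = z ^ D • powerVector β a := by
  simp only [powerVector, Finset.smul_sum, smul_smul]
  refine Finset.sum_congr rfl fun α _ => ?_
  congr 1
  have : ∏ i, z ^ (α : ι →₀ ℕ) i = z ^ D := by
    rw [Finset.prod_pow_eq_pow_sum, ← Finsupp.degree_eq_sum, mem_multiIndices.mp α.2]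
  simp_rw [mul_pow, Finset.prod_mul_distrib, this]
  ring

variable {β} {C : LinearMap.BilinForm ℝ W}

/-- By homogeneity, a bound on the powers of the vectors of the unit sphere gives one on all
powers. -/
theorem apply_powerVector_le (hD : 0 < D)
    (hC : ∀ a : ι → ℂ, ∑ i, ‖a i‖ ^ 2 = 1 → C (powerVector β a) (powerVector β a) ≤ 1)
    (a : ι → ℂ) : C (powerVector β a) (powerVector β a) ≤ (∑ i, ‖a i‖ ^ 2) ^ D := by
  set S := ∑ i, ‖a i‖ ^ 2 with hS
  have hS0 : 0 ≤ S := Finset.sum_nonneg fun _ _ => sq_nonneg _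
  rcases hS0.eq_or_lt with h0 | hpos
  · have ha : a = fun i => 0 * (0 : ℂ) := by
      rw [hS, eq_comm, Finset.sum_eq_zero_iff_of_nonneg fun _ _ => sq_nonneg _] at h0
      ext i
      simpa using h0 i (Finset.mem_univ i)
    have h1 : powerVector β a = 0 := by rw [ha, powerVector_smul, zero_pow hD.ne', zero_smul]
    rw [h1, map_zero]
    exact pow_nonneg hS0 D
  · have hsq : √S ≠ 0 := (Real.sqrt_pos.mpr hpos).ne'
    have ha : a = fun i => (√S : ℂ) * ((√S : ℂ)⁻¹ * a i) := by
      ext i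
      rw [mul_inv_cancel_left₀]
      exact_mod_cast hsq
    have h1 : ∑ i, ‖(√S : ℂ)⁻¹ * a i‖ ^ 2 = 1 := by
      simp_rw [norm_mul, norm_inv, Complex.norm_real, Real.norm_of_nonneg (Real.sqrt_nonneg S),
        mul_pow, inv_pow, Real.sq_sqrt hS0]
      rw [← Finset.mul_sum, ← hS, inv_mul_cancel₀ hpos.ne']
    have h2 := hC _ h1
    have h3 : powerVector β a = (√S ^ D) • powerVector β (fun i => (√S : ℂ)⁻¹ * a i) := by
      conv_lhs => rw [ha, powerVector_smul]
      rw [← algebraMap_smul ℂ (√S ^ D)]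
      congr 1
      simp
    rw [h3, LinearMap.map_smul₂, map_smul, smul_eq_mul, smul_eq_mul, ← mul_assoc,
      ← mul_pow, Real.mul_self_sqrt hS0]
    exact mul_le_of_le_one_right (pow_nonneg hS0 D) h2

/-- Multiplication by `I` preserves the set of the powers: it comes from the multiplication of `a`
by a `D`-th root of `I`. -/
theorem apply_I_smul_powerVector_le (hD : 0 < D)
    (hC : ∀ a : ι → ℂ, ∑ i, ‖a i‖ ^ 2 = 1 → C (powerVector β a) (powerVector β a) ≤ 1)
    (a : ι → ℂ) :
    C (Complex.I • powerVector β a) (Complex.I • powerVector β a) ≤ (∑ i, ‖a i‖ ^ 2) ^ D := by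
  obtain ⟨ζ, hζ⟩ := IsAlgClosed.exists_pow_nat_eq Complex.I hD
  have hnorm : ‖ζ‖ = 1 := by
    rw [← pow_eq_one_iff_of_nonneg (norm_nonneg _) hD.ne', ← norm_pow, hζ, Complex.norm_I]
  have h := apply_powerVector_le hD hC fun i => ζ * a i
  rw [powerVector_smul, hζ] at h
  simpa [hnorm] using h

/-- The density of the standard Gaussian measure on `ℂ^ι`, up to a constant, is the square of this
function. -/
def gaussianFactor (a : ι → ℂ) : ℝ := ∏ i, Real.exp (-‖a i‖ ^ 2 / 2)

theorem sum_gaussianMonomial_smul (β : Module.Basis (multiIndices ι D) ℂ W) (a : ι → ℂ) :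
    ∑ α : multiIndices ι D, gaussianMonomial (α : ι →₀ ℕ) a • β α
      = gaussianFactor a • powerVector β a := by
  have hG : (algebraMap ℝ ℂ) (gaussianFactor a) = ∏ i, (Real.exp (-‖a i‖ ^ 2 / 2) : ℂ) :=
    map_prod (algebraMap ℝ ℂ) _ _
  rw [← algebraMap_smul ℂ (gaussianFactor a) (powerVector β a), powerVector, Finset.smul_sum, hG]
  refine Finset.sum_congr rfl fun α _ => ?_
  rw [smul_smul, gaussianMonomial, mul_comm]

theorem sum_norm_gaussianMonomial_sq (D : ℕ) (a : ι → ℂ) :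
    ∑ α : multiIndices ι D, ‖gaussianMonomial (α : ι →₀ ℕ) a‖ ^ 2
      = gaussianFactor a ^ 2 * (∑ i, ‖a i‖ ^ 2) ^ D := by
  have h0 := sum_pow_eq_sum_multinomial (fun i => ‖a i‖ ^ 2) D
  rw [← Finset.sum_coe_sort (multiIndices ι D)] at h0
  refine Eq.trans ?_ (congrArg (gaussianFactor a ^ 2 * ·) h0.symm)
  simp only [Finset.mul_sum]
  refine Finset.sum_congr rfl fun α _ => ?_
  rw [gaussianMonomial, norm_mul, norm_mul, Complex.norm_real,
    Real.norm_of_nonneg (Real.sqrt_nonneg _), norm_prod, norm_prod, mul_pow, mul_pow,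
    Real.sq_sqrt (Nat.cast_nonneg _)]
  have h1 : ∏ i, ‖((Real.exp (-‖a i‖ ^ 2 / 2) : ℝ) : ℂ)‖ = gaussianFactor a :=
    Finset.prod_congr rfl fun i _ => by
      rw [Complex.norm_real, Real.norm_of_nonneg (Real.exp_pos _).le]
  have h2 : (∏ i, ‖a i ^ (α : ι →₀ ℕ) i‖) ^ 2 = ∏ i, (‖a i‖ ^ 2) ^ (α : ι →₀ ℕ) i := by
    rw [← Finset.prod_pow]
    exact Finset.prod_congr rfl fun i _ => by rw [norm_pow, ← pow_mul, ← pow_mul, mul_comm]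
  rw [h1, h2]
  ring

/-- A real quadratic form which is at most `1` on the powers of the vectors of the unit sphere has
trace at most the dimension, since the powers average to a multiple of the identity. -/
theorem trace_le_of_powerVector_le (hD : 0 < D)
    (hC : ∀ a : ι → ℂ, ∑ i, ‖a i‖ ^ 2 = 1 → C (powerVector β a) (powerVector β a) ≤ 1) :
    ∑ α, (C (β α) (β α) + C (Complex.I • β α) (Complex.I • β α))
      ≤ 2 * Fintype.card (multiIndices ι D) := by
  refine sum_le_of_forall_le β C (μ := MeasureTheory.volume)
    (ψ := fun (α : multiIndices ι D) => gaussianMonomial (α : ι →₀ ℕ))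
    (fun α γ => integrable_conj_gaussianMonomial_mul _ _)
    (κ := Real.pi ^ Fintype.card ι * D.factorial) (by positivity) (fun α γ => ?_) (fun a => ?_)
    (fun a => ?_)
  · rw [integral_conj_gaussianMonomial_mul α.2]
    simp only [Subtype.ext_iff]
  · rw [sum_gaussianMonomial_smul, sum_norm_gaussianMonomial_sq, LinearMap.map_smul₂,
      map_smul, smul_eq_mul, smul_eq_mul, ← mul_assoc, ← sq]
    exact mul_le_mul_of_nonneg_left (apply_powerVector_le hD hC a) (sq_nonneg _)
  · have hc : Complex.I • (gaussianFactor a • powerVector β a)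
        = gaussianFactor a • (Complex.I • powerVector β a) := by
      rw [← algebraMap_smul ℂ (gaussianFactor a) (powerVector β a),
        ← algebraMap_smul ℂ (gaussianFactor a), smul_comm]
    rw [sum_gaussianMonomial_smul, sum_norm_gaussianMonomial_sq, hc,
      LinearMap.map_smul₂, map_smul, smul_eq_mul, smul_eq_mul, ← mul_assoc, ← sq]
    exact mul_le_mul_of_nonneg_left (apply_I_smul_powerVector_le hD hC a) (sq_nonneg _)

end PowerVector

section JohnSup

variable {ι : Type*} [Fintype ι] [DecidableEq ι] {V : Type*} [AddCommGroup V] [Module ℂ V]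

/-- The norm of John of the supremum norm is the symmetric norm. The points of contact of the unit
ball of the symmetric norm with that of the supremum norm are the powers `ℓ^D` of vectors of
norm `1`; the unit ball of the supremum norm lies in the corresponding half-spaces because
evaluation at a point is the inner product with such a power. -/
theorem johnNorm_supNorm_eq {c : InnerProductSpace.Core ℂ V} {b : Module.Basis ι ℂ V}
    (hb : IsOrthonormalFor c b) {D : ℕ} (hD : 0 < D) {W : Type*} [AddCommGroup W] [Module ℂ W]
    [Module ℝ W] [IsScalarTower ℝ ℂ W] (ψ : W ≃ₗ[ℂ] SymPow ℂ V D) (x : W) :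
    johnNorm (fun y => supNorm c D (ψ y)) x = symNorm c D (ψ x) := by
  let β : Module.Basis (multiIndices ι D) ℂ W :=
    Module.Basis.ofEquivFun ((ψ.trans (symPowEquiv b D)).trans (bombieriCoordEquiv D))
  have hβ : ∀ y α, β.repr y α = bombieriCoord D
      (SymmetricAlgebra.equivMvPolynomial b (ψ y : SymmetricAlgebra ℂ V)) α := fun y α =>
    congrFun (bombieriCoordEquiv_apply D (symPowEquiv b D (ψ y))) α
  have hsym : ∀ y, symNorm c D (ψ y) = √(reHermitianForm β y y) := fun y => by
    rw [symNorm_eq_bombieriNorm hb (ψ y).2, bombieriNorm_eq_sqrt_sum, reHermitianForm_self]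
    simp only [hβ]
  have hins : IsInscribed (fun y => supNorm c D (ψ y)) (reHermitianForm β) := by
    refine ⟨reHermitianForm_symm β, fun y hy => reHermitianForm_pos β hy, fun y hy => ?_⟩
    refine (supNorm_le_bombieriNorm hb (ψ y).2).trans ?_
    rw [← symNorm_eq_bombieriNorm hb (ψ y).2, hsym]
    exact Real.sqrt_le_one.mpr hy
  rw [hsym]
  refine johnNorm_eq_sqrt (Complex.basisOneI.smulTower β) hins (toMatrix_reHermitianForm β)
    {u | ∃ a : ι → ℂ, ∑ i, ‖a i‖ ^ 2 = 1 ∧ powerVector β a = u} ?_ ?_ x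
  · -- the inner product of `y` with the power of `a` is the value of `y` at `conj a`
    rintro u ⟨a, ha, rfl⟩ y hy
    have hconj : ∑ i, ‖conj (a i)‖ ^ 2 = 1 := by simpa using ha
    have h1 := norm_eval_le_supNorm hb (ψ y).2 hconj
    rw [eval_eq_sum_multiIndices (isHomogeneous_equivMvPolynomial b (ψ y).2),
      ← Finset.sum_coe_sort] at h1
    have h2 : reHermitianForm β y (powerVector β a) = (conj (∑ α : multiIndices ι D,
        (SymmetricAlgebra.equivMvPolynomial b (ψ y : SymmetricAlgebra ℂ V)).coeff (α : ι →₀ ℕ)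
          * ∏ i, conj (a i) ^ (α : ι →₀ ℕ) i)).re := by
      rw [reHermitianForm_apply, map_sum]
      congr 1
      refine Finset.sum_congr rfl fun α _ => ?_
      have := sqrt_multinomial_ne_zero (α : ι →₀ ℕ)
      rw [repr_powerVector, hβ]
      simp only [bombieriCoord, map_div₀, Complex.conj_ofReal, map_mul, map_prod, map_pow,
        Complex.conj_conj]
      field_simp
    rw [h2]
    refine (Complex.re_le_norm _).trans ?_
    rw [RCLike.norm_conj]
    exact h1.trans hy
  · intro C _ hC
    have key := trace_le_of_powerVector_le (β := β) (C := C) hD fun a ha => hC _ ⟨a, ha, rfl⟩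
    rw [Fintype.sum_prod_type, Fin.sum_univ_two, ← Finset.sum_add_distrib, Fintype.card_prod,
      Fintype.card_fin]
    simpa only [Module.Basis.smulTower_apply, Complex.coe_basisOneI, Matrix.cons_val_zero,
      Matrix.cons_val_one, one_smul, Nat.cast_mul, Nat.cast_ofNat] using key

/-- The constant vanishes since the norm of John of the supremum norm is the symmetric norm itself.
-/
theorem johnConst_eq_zero (n : ℕ) {D : ℕ} (hD : 0 < D) : johnConst n D = 0 := by
  let c : InnerProductSpace.Core ℂ (EuclideanSpace ℂ (Fin (n + 1))) := InnerProductSpace.toCore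
  obtain ⟨b, hb⟩ := exists_isOrthonormalFor c (finrank_euclideanSpace_fin (𝕜 := ℂ) (n := n + 1))
  rw [johnConst]
  simp only
  have h := johnNorm_supNorm_eq (c := c) hb hD (LinearEquiv.refl ℂ _)
    ⟨SymmetricAlgebra.ι ℂ _ (EuclideanSpace.single 0 1) ^ D,
      Submodule.pow_mem_pow _ (LinearMap.mem_range_self _ _) D⟩
  rw [sub_eq_zero]
  exact congrArg Real.log h

end JohnSup

/-! ### Base change of symmetric powers -/

section SymBaseChange

variable (R L E : Type*) [CommRing R] [CommRing L] [Algebra R L] [AddCommGroup E] [Module R E]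

/-- The canonical ring homomorphism `Sym_R(E) → Sym_L(L ⊗ E)`. -/
def symScalarExtension : SymmetricAlgebra R E →ₐ[R] SymmetricAlgebra L (L ⊗[R] E) :=
  SymmetricAlgebra.lift
    (((SymmetricAlgebra.ι L (L ⊗[R] E)).restrictScalars R).comp (TensorProduct.mk R L E 1))

@[simp]
theorem symScalarExtension_ι (e : E) : symScalarExtension R L E (SymmetricAlgebra.ι R E e)
    = SymmetricAlgebra.ι L (L ⊗[R] E) (1 ⊗ₜ e) :=
  SymmetricAlgebra.lift_ι_apply _ e

/-- The formation of the symmetric algebra commutes with base change. -/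
def symBaseChange : (L ⊗[R] SymmetricAlgebra R E) ≃ₐ[L] SymmetricAlgebra L (L ⊗[R] E) :=
  AlgEquiv.ofAlgHom
    (Algebra.TensorProduct.lift (Algebra.ofId L _) (symScalarExtension R L E)
      fun _ _ => Commute.all _ _)
    (SymmetricAlgebra.lift ((SymmetricAlgebra.ι R E).baseChange L))
    (SymmetricAlgebra.algHom_ext (TensorProduct.AlgebraTensorModule.curry_injective (by
      ext e
      simp)))
    (Algebra.TensorProduct.ext (by ext) (SymmetricAlgebra.algHom_ext (by
      ext e
      simp)))

theorem symBaseChange_tmul (z : L) (f : SymmetricAlgebra R E) :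
    symBaseChange R L E (z ⊗ₜ f) = z • symScalarExtension R L E f := by
  simp [symBaseChange, Algebra.ofId_apply, Algebra.smul_def]

variable {R E} in
theorem symScalarExtension_mem {D : ℕ} {f : SymmetricAlgebra R E} (hf : f ∈ SymPow R E D) :
    symScalarExtension R L E f ∈ SymPow L (L ⊗[R] E) D := by
  induction hf using Submodule.pow_induction_on_left' with
  | algebraMap r =>
    rw [AlgHom.commutes, SymPow, pow_zero, IsScalarTower.algebraMap_apply R L]
    exact Submodule.mem_one.mpr ⟨_, rfl⟩
  | add x y i hx hy hx' hy' => rw [map_add]; exact add_mem hx' hy'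
  | mem_mul m hm i x hx hx' =>
    obtain ⟨e, rfl⟩ := hm
    rw [map_mul, symScalarExtension_ι, Nat.succ_eq_add_one, SymPow, pow_succ']
    exact Submodule.mul_mem_mul (LinearMap.mem_range_self _ _) hx'

theorem one_mem_symPow_zero : (1 : SymmetricAlgebra R E) ∈ SymPow R E 0 := by
  rw [SymPow, pow_zero]
  exact Submodule.mem_one.mpr ⟨1, map_one _⟩

/-- The canonical map `L ⊗ Sym_R^D(E) → Sym_L^D(L ⊗ E)`. -/
def symPowBaseChange (D : ℕ) : (L ⊗[R] SymPow R E D) →ₗ[L] SymPow L (L ⊗[R] E) D :=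
  ((symBaseChange R L E).toLinearMap.comp ((SymPow R E D).subtype.baseChange L)).codRestrict
    (SymPow L (L ⊗[R] E) D) fun x => by
      induction x using TensorProduct.induction_on with
      | zero => rw [map_zero]; exact zero_mem _
      | add x y hx hy => rw [map_add]; exact add_mem hx hy
      | tmul z f =>
        simp only [LinearMap.comp_apply, LinearMap.baseChange_tmul, Submodule.subtype_apply,
          AlgEquiv.toLinearMap_apply, symBaseChange_tmul]
        exact Submodule.smul_mem _ z (symScalarExtension_mem L f.2)

theorem symPowBaseChange_tmul (D : ℕ) (z : L) (f : SymPow R E D) :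
    (symPowBaseChange R L E D (z ⊗ₜ f) : SymmetricAlgebra L (L ⊗[R] E))
      = z • symScalarExtension R L E f :=
  symBaseChange_tmul R L E z _

theorem symPowBaseChange_injective [Module.Flat R L] (D : ℕ) :
    Function.Injective (symPowBaseChange R L E D) := by
  intro x y hxy
  have h := (symBaseChange R L E).injective (congrArg Subtype.val hxy)
  exact Module.Flat.lTensor_preserves_injective_linearMap (M := L) _
    (SymPow R E D).injective_subtype h

theorem symPowBaseChange_surjective (D : ℕ) :
    Function.Surjective (symPowBaseChange R L E D) := by
  have key : SymPow L (L ⊗[R] E) D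
      ≤ (LinearMap.range (symPowBaseChange R L E D)).map (Submodule.subtype _) := by
    intro x hx
    induction hx using Submodule.pow_induction_on_left' with
    | algebraMap r =>
      refine ⟨_, ⟨r ⊗ₜ ⟨1, one_mem_symPow_zero R E⟩, rfl⟩, ?_⟩
      rw [Submodule.subtype_apply, symPowBaseChange_tmul, map_one, Algebra.algebraMap_eq_smul_one]
    | add x y i hx hy hx' hy' => exact add_mem hx' hy'
    | mem_mul m hm i x hx hx' =>
      obtain ⟨e, rfl⟩ := hm
      obtain ⟨-, ⟨f, rfl⟩, rfl⟩ := hx'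
      induction f using TensorProduct.induction_on with
      | zero => simp
      | add f g hf hg =>
        rw [map_add, map_add, mul_add]
        exact add_mem (hf (Subtype.prop _)) (hg (Subtype.prop _))
      | tmul z f =>
        induction e using TensorProduct.induction_on with
        | zero => simp
        | add e e' he he' =>
          rw [map_add, add_mul]
          exact add_mem he he'
        | tmul w e =>
          refine ⟨_, ⟨(w * z) ⊗ₜ ⟨SymmetricAlgebra.ι R E e * f, ?_⟩, rfl⟩, ?_⟩
          · rw [Nat.succ_eq_add_one, SymPow, pow_succ']
            exact Submodule.mul_mem_mul (LinearMap.mem_range_self _ _) f.2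
          · rw [Submodule.subtype_apply, symPowBaseChange_tmul, Submodule.subtype_apply,
              symPowBaseChange_tmul, map_mul, symScalarExtension_ι]
            have : (w ⊗ₜ[R] e : L ⊗[R] E) = w • (1 ⊗ₜ[R] e) := by
              rw [TensorProduct.smul_tmul', smul_eq_mul, mul_one]
            rw [this, map_smul, smul_mul_smul_comm]
  intro y
  obtain ⟨x, hx, hxy⟩ := key y.2
  obtain ⟨z, rfl⟩ := hx
  exact ⟨z, Subtype.ext hxy⟩

/-- The formation of the symmetric powers commutes with flat base change. -/
def symPowBaseChangeEquiv [Module.Flat R L] (D : ℕ) :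
    (L ⊗[R] SymPow R E D) ≃ₗ[L] SymPow L (L ⊗[R] E) D :=
  LinearEquiv.ofBijective (symPowBaseChange R L E D)
    ⟨symPowBaseChange_injective R L E D, symPowBaseChange_surjective R L E D⟩

variable {R E}

theorem symPowBaseChange_mulSection {δ D : ℕ} (h : δ ≤ D) (s : SymPow R E δ)
    (x : L ⊗[R] SymPow R E (D - δ)) :
    (symPowBaseChange R L E D ((mulSection h s).baseChange L x)
        : SymmetricAlgebra L (L ⊗[R] E))
      = symScalarExtension R L E s
        * (symPowBaseChange R L E (D - δ) x : SymmetricAlgebra L (L ⊗[R] E)) := by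
  induction x using TensorProduct.induction_on with
  | zero => simp
  | add x y hx hy => rw [map_add, map_add, map_add, Submodule.coe_add, hx, hy, Submodule.coe_add,
      mul_add]
  | tmul z f =>
    rw [LinearMap.baseChange_tmul, symPowBaseChange_tmul, symPowBaseChange_tmul, mul_smul_comm,
      ← map_mul]
    rfl

end SymBaseChange

/-! ### The multiplication by a nonzero section -/

section MulSection

variable {R E : Type*} [CommRing R] [IsDomain R] [AddCommGroup E] [Module R E]

/-- The symmetric algebra of a projective module is a retract of a polynomial ring. -/
theorem exists_injective_toMvPolynomial [Module.Projective R E] :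
    ∃ f : SymmetricAlgebra R E →ₐ[R] MvPolynomial E R, Function.Injective f := by
  obtain ⟨σ, hσ⟩ := Module.projective_def'.mp (inferInstance : Module.Projective R E)
  let b : Module.Basis E R (E →₀ R) := Finsupp.basisSingleOne
  let f : SymmetricAlgebra R E →ₐ[R] SymmetricAlgebra R (E →₀ R) :=
    SymmetricAlgebra.lift ((SymmetricAlgebra.ι R _).comp σ)
  let g : SymmetricAlgebra R (E →₀ R) →ₐ[R] SymmetricAlgebra R E :=
    SymmetricAlgebra.lift ((SymmetricAlgebra.ι R _).comp (Finsupp.linearCombination R id))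
  have hgf : g.comp f = AlgHom.id R _ := by
    refine SymmetricAlgebra.algHom_ext (LinearMap.ext fun e => ?_)
    have := LinearMap.congr_fun hσ e
    simp only [LinearMap.comp_apply, LinearMap.id_apply] at this
    simp [f, g, this]
  refine ⟨(SymmetricAlgebra.equivMvPolynomial b).toAlgHom.comp f, ?_⟩
  refine (SymmetricAlgebra.equivMvPolynomial b).injective.comp ?_
  exact Function.LeftInverse.injective (g := g) fun x => DFunLike.congr_fun hgf x

theorem noZeroDivisors_symmetricAlgebra [Module.Projective R E] :
    NoZeroDivisors (SymmetricAlgebra R E) := by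
  obtain ⟨f, hf⟩ := exists_injective_toMvPolynomial (R := R) (E := E)
  exact hf.noZeroDivisors f (map_zero f) (map_mul f)

theorem mulSection_injective [Module.Projective R E] {δ D : ℕ} (h : δ ≤ D) {s : SymPow R E δ}
    (hs : s ≠ 0) : Function.Injective (mulSection h s) := by
  have := noZeroDivisors_symmetricAlgebra (R := R) (E := E)
  refine (injective_iff_map_eq_zero _).mpr fun t ht => ?_
  have h0 : (s : SymmetricAlgebra R E) * t = 0 := congrArg Subtype.val ht
  rcases mul_eq_zero.mp h0 with h1 | h1
  · exact absurd (Subtype.ext h1) hs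
  · exact Subtype.ext h1

theorem isTorsionFree_symPow [Module.Projective R E] {D : ℕ} {a : R} (ha : a ≠ 0)
    {x : SymPow R E D} (h : a • x = 0) : x = 0 := by
  obtain ⟨f, hf⟩ := exists_injective_toMvPolynomial (R := R) (E := E)
  have h0 : f (a • (x : SymmetricAlgebra R E)) = 0 := by
    rw [← map_zero f]
    exact congrArg (fun y : SymPow R E D => f y) h
  rw [map_smul, smul_eq_zero_iff_right ha, ← map_zero f] at h0
  exact Subtype.ext (hf h0)

variable (L : Type*) [Field L] [Algebra R L]

theorem lTensor_exact_subtype_mkQ {M : Type*} [AddCommGroup M] [Module R M] (P : Submodule R M) :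
    Function.Exact (P.subtype.lTensor L) (P.mkQ.lTensor L) :=
  lTensor_exact L (LinearMap.exact_subtype_mkQ P) (Submodule.mkQ_surjective P)

/-- Over a field, the sections which vanish on the hypersurface are the multiples of `s`. -/
theorem exact_mulSection_mkQ (hL : Function.Injective (algebraMap R L)) {δ D : ℕ} (h : δ ≤ D)
    (s : SymPow R E δ) :
    Function.Exact ((mulSection h s).lTensor L) ((vanishing h s).mkQ.lTensor L) := by
  have hex := lTensor_exact_subtype_mkQ L (vanishing h s)
  intro y
  rw [hex y]
  constructor
  · rintro ⟨x, rfl⟩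
    induction x using TensorProduct.induction_on with
    | zero => exact ⟨0, by simp⟩
    | add x x' hx hx' =>
      obtain ⟨u, hu⟩ := hx
      obtain ⟨u', hu'⟩ := hx'
      exact ⟨u + u', by rw [map_add, map_add, hu, hu']⟩
    | tmul z x =>
      obtain ⟨a, ha, t, ht⟩ := x.2
      have ha' : algebraMap R L a ≠ 0 := by
        rwa [Ne, map_eq_zero_iff _ hL]
      refine ⟨(z * (algebraMap R L a)⁻¹) ⊗ₜ t, ?_⟩
      rw [LinearMap.lTensor_tmul, ← ht, ← TensorProduct.smul_tmul, Algebra.smul_def, mul_comm,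
        inv_mul_cancel_right₀ ha', LinearMap.lTensor_tmul, Submodule.subtype_apply]
  · rintro ⟨x, rfl⟩
    induction x using TensorProduct.induction_on with
    | zero => exact ⟨0, by simp⟩
    | add x x' hx hx' =>
      obtain ⟨u, hu⟩ := hx
      obtain ⟨u', hu'⟩ := hx'
      exact ⟨u + u', by rw [map_add, map_add, hu, hu']⟩
    | tmul z t =>
      exact ⟨z ⊗ₜ ⟨mulSection h s t, 1, one_ne_zero, t, one_smul _ _⟩, rfl⟩

end MulSection

/-! ### Complex fibres -/

section FiberSym

variable {K : Type*} [Field K] (v : InfinitePlace K)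

theorem algebraMap_complexAt_injective : Function.Injective (algebraMap (𝓞 K) (ComplexAt v)) :=
  (embAt v).injective.comp RingOfIntegers.coe_injective

/-- A torsion-free module over a Dedekind domain is flat. -/
instance [NumberField K] : Module.Flat (𝓞 K) (ComplexAt v) := by
  rw [IsDedekindDomain.flat_iff_torsion_eq_bot, eq_bot_iff]
  rintro z ⟨a, ha⟩
  have h : algebraMap (𝓞 K) (ComplexAt v) a * z = 0 := by
    rw [← Algebra.smul_def]
    exact ha
  rcases mul_eq_zero.mp h with h | h
  · rw [map_eq_zero_iff _ (algebraMap_complexAt_injective v)] at h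
    exact absurd h (nonZeroDivisors.coe_ne_zero a)
  · exact h

variable {E : Type*} [AddCommGroup E] [Module (𝓞 K) E]

theorem symToFiber_ι (e : E) : symToFiber v (SymmetricAlgebra.ι (𝓞 K) E e)
    = SymmetricAlgebra.ι ℂ (Fiber v E) (1 ⊗ₜ[𝓞 K] e) := by
  let _ : Algebra (𝓞 K) (SymmetricAlgebra ℂ (Fiber v E)) :=
    ((algebraMap ℂ (SymmetricAlgebra ℂ (Fiber v E))).comp
      (v.embedding.comp (algebraMap (𝓞 K) K))).toAlgebra
  exact SymmetricAlgebra.lift_ι_apply (R := 𝓞 K) (A := SymmetricAlgebra ℂ (Fiber v E)) _ e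

/-- The ring homomorphism to the symmetric algebra of the fibre is the base change map. -/
theorem symToFiber_eq (f : SymmetricAlgebra (𝓞 K) E) :
    symToFiber v f = symScalarExtension (𝓞 K) (ComplexAt v) E f := by
  induction f using SymmetricAlgebra.induction with
  | algebraMap a =>
    rw [Algebra.algebraMap_eq_smul_one, symToFiber_smul, map_one, map_smul, map_one]
    rw [← algebraMap_smul (ComplexAt v) a]
    rfl
  | ι e =>
    rw [symToFiber_ι, symScalarExtension_ι]
    rfl
  | mul f g hf hg =>
    rw [map_mul, map_mul, hf, hg]
    rfl
  | add f g hf hg =>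
    rw [map_add, map_add, hf, hg]
    rfl

theorem fiberToSym_tmul (D : ℕ) (z : ComplexAt v) (f : SymPow (𝓞 K) E D) :
    fiberToSym v D (z ⊗ₜ f) = (show ℂ from z) • symToFiber v (f : SymmetricAlgebra (𝓞 K) E) := rfl

theorem fiberToSym_eq (D : ℕ) (x : Fiber v (SymPow (𝓞 K) E D)) :
    fiberToSym v D x = (symPowBaseChange (𝓞 K) (ComplexAt v) E D x
      : SymmetricAlgebra (ComplexAt v) (Fiber v E)) := by
  induction x using TensorProduct.induction_on with
  | zero => rw [map_zero, map_zero]; rfl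
  | add x y hx hy => rw [map_add, map_add, hx, hy]; rfl
  | tmul z f => rw [fiberToSym_tmul, symPowBaseChange_tmul, symToFiber_eq]; rfl

theorem fiberToSym_smul (D : ℕ) (z : ℂ) (x : Fiber v (SymPow (𝓞 K) E D)) :
    fiberToSym v D (z • x) = z • fiberToSym v D x := by
  induction x using TensorProduct.induction_on with
  | zero => rw [smul_zero, map_zero, smul_zero]
  | add x y hx hy => rw [smul_add, map_add, hx, hy, map_add, smul_add]
  | tmul w f =>
    rw [TensorProduct.smul_tmul', fiberToSym_tmul, fiberToSym_tmul, smul_smul]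
    rfl

/-- The identification of the fibre of `Sym^D(E)` with the symmetric power of the fibre. -/
def fiberSymEquiv [NumberField K] (D : ℕ) :
    Fiber v (SymPow (𝓞 K) E D) ≃ₗ[ℂ] SymPow ℂ (Fiber v E) D :=
  LinearEquiv.ofBijective
    (LinearMap.codRestrict (SymPow ℂ (Fiber v E) D)
      { toFun := fiberToSym v D
        map_add' := map_add _
        map_smul' := fiberToSym_smul v D }
      fun x => by
        have := (symPowBaseChange (𝓞 K) (ComplexAt v) E D x).2
        rw [← fiberToSym_eq] at this
        exact this)
    ⟨fun x y hxy => by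
      have h : fiberToSym v D x = fiberToSym v D y := congrArg Subtype.val hxy
      rw [fiberToSym_eq, fiberToSym_eq] at h
      exact symPowBaseChange_injective (𝓞 K) (ComplexAt v) E D (Subtype.ext h),
    fun y => by
      obtain ⟨x, hx⟩ := symPowBaseChange_surjective (𝓞 K) (ComplexAt v) E D y
      refine ⟨x, Subtype.ext ?_⟩
      change fiberToSym v D x = y
      rw [fiberToSym_eq, hx]⟩

@[simp]
theorem coe_fiberSymEquiv [NumberField K] (D : ℕ) (x : Fiber v (SymPow (𝓞 K) E D)) :
    (fiberSymEquiv v D x : SymmetricAlgebra ℂ (Fiber v E)) = fiberToSym v D x := rfl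

theorem fiberToSym_fiberMap_mulSection {δ D : ℕ} (h : δ ≤ D) (s : SymPow (𝓞 K) E δ)
    (t : Fiber v (SymPow (𝓞 K) E (D - δ))) :
    fiberToSym v D (fiberMap v (mulSection h s) t)
      = fiberToSym v δ (1 ⊗ₜ[𝓞 K] s) * fiberToSym v (D - δ) t := by
  induction t using TensorProduct.induction_on with
  | zero => rw [map_zero, map_zero, map_zero, mul_zero]
  | add x y hx hy => rw [map_add, map_add, map_add, hx, hy, mul_add]
  | tmul z t =>
    rw [fiberMap, LinearMap.lTensor_tmul, fiberToSym_tmul, fiberToSym_tmul, fiberToSym_tmul]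
    have : ((mulSection h s t : SymPow (𝓞 K) E D) : SymmetricAlgebra (𝓞 K) E) = s * t := rfl
    rw [this, map_mul, mul_smul_comm]
    congr 2
    exact (one_smul ℂ _).symm

end FiberSym

section FiberBasis

variable {K : Type*} [Field K] (v : InfinitePlace K) {M : Type*} [AddCommGroup M]
  [Module (𝓞 K) M]

theorem toFiber_tmul (a : K) (x : M) : toFiber v (a ⊗ₜ[𝓞 K] x) = embAt v a ⊗ₜ x := rfl

theorem toFiber_smul (a : K) (x : K ⊗[𝓞 K] M) :
    toFiber v (a • x) = v.embedding a • toFiber v x := by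
  induction x using TensorProduct.induction_on with
  | zero => rw [smul_zero, map_zero, smul_zero]
  | add x y hx hy => rw [smul_add, map_add, hx, hy, map_add, smul_add]
  | tmul b x =>
    rw [TensorProduct.smul_tmul', toFiber_tmul, toFiber_tmul, TensorProduct.smul_tmul',
      smul_eq_mul, map_mul]
    rfl

/-- The fibre of `M` at `v` is the base change of `M ⊗ K` along the embedding `v`. -/
theorem exists_fiberBasis {ι : Type*} (σ : Module.Basis ι K (K ⊗[𝓞 K] M)) :
    ∃ b : Module.Basis ι ℂ (Fiber v M), ∀ i, b i = toFiber v (σ i) := by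
  let _ : Algebra K (ComplexAt v) := (embAt v).toAlgebra
  have : IsScalarTower (𝓞 K) K (ComplexAt v) := IsScalarTower.of_algebraMap_eq fun a => rfl
  let e : ComplexAt v ⊗[K] (K ⊗[𝓞 K] M) ≃ₗ[ComplexAt v] Fiber v M :=
    TensorProduct.AlgebraTensorModule.cancelBaseChange (𝓞 K) K (ComplexAt v) (ComplexAt v) M
  let b : Module.Basis ι (ComplexAt v) (Fiber v M) := (σ.baseChange (ComplexAt v)).map e
  refine ⟨b, fun i => ?_⟩
  have key : ∀ x : K ⊗[𝓞 K] M, e (1 ⊗ₜ x) = toFiber v x := fun x => by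
    induction x using TensorProduct.induction_on with
    | zero => rw [TensorProduct.tmul_zero, map_zero, map_zero]
    | add x y hx hy => rw [TensorProduct.tmul_add, map_add, hx, hy, map_add]
    | tmul a x =>
      rw [toFiber_tmul]
      simp only [e, TensorProduct.AlgebraTensorModule.cancelBaseChange_tmul, Algebra.smul_def,
        mul_one]
      rfl
  change b i = _
  rw [← key]
  simp [b]

/-- The basis of a complex fibre given by a `K`-basis of `M ⊗ K`. -/
def fiberBasis {ι : Type*} (σ : Module.Basis ι K (K ⊗[𝓞 K] M)) : Module.Basis ι ℂ (Fiber v M) :=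
  (exists_fiberBasis v σ).choose

@[simp]
theorem fiberBasis_apply {ι : Type*} (σ : Module.Basis ι K (K ⊗[𝓞 K] M)) (i : ι) :
    fiberBasis v σ i = toFiber v (σ i) :=
  (exists_fiberBasis v σ).choose_spec i

variable {ι : Type*} [Fintype ι] [DecidableEq ι]

theorem fiberBasis_repr_toFiber (σ : Module.Basis ι K (K ⊗[𝓞 K] M)) (x : K ⊗[𝓞 K] M) (i : ι) :
    (fiberBasis v σ).repr (toFiber v x) i = v.embedding (σ.repr x i) := by
  have h : toFiber v x = ∑ i, v.embedding (σ.repr x i) • fiberBasis v σ i := by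
    conv_lhs => rw [← σ.sum_repr x, map_sum]
    exact Finset.sum_congr rfl fun i _ => by rw [toFiber_smul, fiberBasis_apply]
  rw [h, Module.Basis.repr_sum_self]

theorem fiberBasis_det_toFiber (σ : Module.Basis ι K (K ⊗[𝓞 K] M)) (s : ι → K ⊗[𝓞 K] M) :
    (fiberBasis v σ).det (fun i => toFiber v (s i)) = v.embedding (σ.det s) := by
  rw [Module.Basis.det_apply, Module.Basis.det_apply, RingHom.map_det]
  congr 1
  ext i j
  exact fiberBasis_repr_toFiber v σ (s j) i

theorem finrank_fiber [Module.Finite (𝓞 K) M] :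
    Module.finrank ℂ (Fiber v M) = Module.finrank K (K ⊗[𝓞 K] M) := by
  rw [Module.finrank_eq_card_basis (fiberBasis v (Module.finBasis K (K ⊗[𝓞 K] M))),
    Fintype.card_fin]

instance [Module.Finite (𝓞 K) M] : Module.Finite ℂ (Fiber v M) :=
  Module.Finite.of_basis (fiberBasis v (Module.finBasis K (K ⊗[𝓞 K] M)))

/-- The norms of John of the supremum norms are the symmetric norms. -/
theorem bundleJohnNorm_eq [NumberField K] [Module.Finite (𝓞 K) M]
    (h : HermitianMetric (K := K) M) {D : ℕ} (hD : 0 < D)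
    (x : Fiber v (SymPow (𝓞 K) M D)) : bundleJohnNorm h D v x = bundleSymNorm h D v x := by
  obtain ⟨b, hb⟩ := exists_isOrthonormalFor (h.core v) rfl
  exact johnNorm_supNorm_eq hb hD (fiberSymEquiv v D) x

end FiberBasis

/-! ### Bases adapted to a lattice at a finite place -/

section FinitePlaceValues

variable {K : Type*} [Field K] [NumberField K]

theorem finitePlace_integer_le_one (w : FinitePlace K) (a : 𝓞 K) : w (a : K) ≤ 1 := by
  rw [← FinitePlace.norm_embedding_eq w]
  exact FinitePlace.norm_le_one K _ a

/-- The elements of absolute value at most `1` at `w` are in the localization of the ring of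
integers at `w`. -/
theorem exists_mul_eq_integer (w : FinitePlace K) {a : K} (ha : w a ≤ 1) :
    ∃ b : 𝓞 K, w (b : K) = 1 ∧ ∃ c : 𝓞 K, (b : K) * a = c := by
  have hv : w.maximalIdeal.valuation K a ≤ 1 := by
    rw [← FinitePlace.norm_embedding_eq w, FinitePlace.norm_embedding'] at ha
    have h1 : WithZeroMulInt.toNNReal (HeightOneSpectrum.absNorm_ne_zero w.maximalIdeal)
        (w.maximalIdeal.valuation K a) ≤ 1 := ha
    rwa [WithZeroMulInt.toNNReal_le_one_iff (HeightOneSpectrum.one_lt_absNorm_nnreal _)] at h1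
  obtain ⟨n, d, hnd⟩ := w.maximalIdeal.exists_primeCompl_mul_eq_of_integer a hv
  refine ⟨d, ?_, n, ?_⟩
  · rw [← FinitePlace.norm_embedding_eq w]
    exact (FinitePlace.norm_eq_one_iff_notMem K _ _).mpr d.2
  · rw [mul_comm]
    exact hnd

theorem exists_forall_mul_eq_integer (w : FinitePlace K) {ι : Type*} [Fintype ι] {a : ι → K}
    (ha : ∀ i, w (a i) ≤ 1) : ∃ b : 𝓞 K, w (b : K) = 1 ∧ ∀ i, ∃ c : 𝓞 K, (b : K) * a i = c := by
  classical
  choose b hb c hc using fun i => exists_mul_eq_integer w (ha i)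
  refine ⟨∏ i, b i, by simp [hb], fun i => ⟨(∏ k ∈ Finset.univ.erase i, b k) * c i, ?_⟩⟩
  rw [← Finset.mul_prod_erase _ _ (Finset.mem_univ i)]
  push_cast
  linear_combination (∏ k ∈ Finset.univ.erase i, (b k : K)) * hc i

theorem finitePlace_sum_le (w : FinitePlace K) {ι : Type*} {s : Finset ι} {f : ι → K} {B : ℝ}
    (hB : 0 ≤ B) (h : ∀ i ∈ s, w (f i) ≤ B) : w (∑ i ∈ s, f i) ≤ B := by
  classical
  induction s using Finset.induction_on with
  | empty => simpa using hB
  | insert i s hi ih =>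
    rw [Finset.sum_insert hi]
    exact (FinitePlace.add_le w _ _).trans (max_le (h i (Finset.mem_insert_self _ _))
      (ih fun k hk => h k (Finset.mem_insert_of_mem hk)))

theorem finitePlace_det_le (w : FinitePlace K) {ι : Type*} [Fintype ι] [DecidableEq ι]
    {A : Matrix ι ι K} {B : ℝ} (hB : 0 ≤ B) (h : ∀ i j, w (A i j) ≤ B) :
    w A.det ≤ B ^ Fintype.card ι := by
  rw [Matrix.det_apply]
  refine finitePlace_sum_le w (pow_nonneg hB _) fun σ _ => ?_
  have h1 : w (∏ i, A (σ i) i) ≤ B ^ Fintype.card ι := by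
    rw [map_prod, ← Finset.card_univ, ← Finset.prod_const]
    exact Finset.prod_le_prod (fun i _ => apply_nonneg w _) fun i _ => h _ _
  rcases Int.units_eq_one_or (Equiv.Perm.sign σ) with hσ | hσ <;> rw [hσ]
  · rwa [one_smul]
  · rwa [Units.neg_smul, one_smul, map_neg_eq_map]

theorem eventually_finitePlace_eq_one {a : K} (ha : a ≠ 0) :
    ∀ᶠ w : FinitePlace K in Filter.cofinite, w a = 1 :=
  FinitePlace.hasFiniteMulSupport ha

theorem eventually_finitePlace_le_one (a : K) :
    ∀ᶠ w : FinitePlace K in Filter.cofinite, w a ≤ 1 := by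
  rcases eq_or_ne a 0 with rfl | ha
  · exact Filter.Eventually.of_forall fun w => by simp
  · exact (eventually_finitePlace_eq_one ha).mono fun w h => h.le

end FinitePlaceValues

section LocalBasis

variable {K : Type*} [Field K] [NumberField K] {W : Type*} [AddCommGroup W] [Module K W]
  [Module (𝓞 K) W] [IsScalarTower (𝓞 K) K W] {ι : Type*} {L : Submodule (𝓞 K) W}
  {w : FinitePlace K}

/-- `e` is a basis of the localization of the lattice `L` at the finite place `w`. -/
structure IsLocalBasis (w : FinitePlace K) (L : Submodule (𝓞 K) W) (e : Module.Basis ι K W) :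
    Prop where
  mem : ∀ i, ∃ b : 𝓞 K, w (b : K) = 1 ∧ b • e i ∈ L
  repr_le : ∀ x ∈ L, ∀ i, w (e.repr x i) ≤ 1

theorem integer_smul_eq (b : 𝓞 K) (x : W) : b • x = (b : K) • x :=
  (algebraMap_smul K b x).symm

theorem IsLocalBasis.reindex {ι' : Type*} {e : Module.Basis ι K W} (h : IsLocalBasis w L e)
    (σ : ι ≃ ι') : IsLocalBasis w L (e.reindex σ) where
  mem i := by simpa using h.mem (σ.symm i)
  repr_le x hx i := by simpa using h.repr_le x hx (σ.symm i)

/-- A vector with coordinates integral at `w` belongs to the localization of the lattice. -/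
theorem IsLocalBasis.exists_smul_mem [Fintype ι] {e : Module.Basis ι K W}
    (h : IsLocalBasis w L e) {x : W} (hx : ∀ i, w (e.repr x i) ≤ 1) :
    ∃ b : 𝓞 K, w (b : K) = 1 ∧ b • x ∈ L := by
  classical
  obtain ⟨b, hb, hbc⟩ := exists_forall_mul_eq_integer w hx
  choose c hc using hbc
  choose d hd hdL using h.mem
  refine ⟨b * ∏ i, d i, by simp [hb, hd], ?_⟩
  rw [← e.sum_repr x, Finset.smul_sum]
  refine L.sum_mem fun i _ => ?_
  have : (b * ∏ i, d i) • e.repr x i • e i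
      = (c i * ∏ k ∈ Finset.univ.erase i, d k) • d i • e i := by
    rw [integer_smul_eq, integer_smul_eq, integer_smul_eq, smul_smul, smul_smul]
    congr 1
    rw [← Finset.mul_prod_erase _ _ (Finset.mem_univ i)]
    push_cast
    linear_combination (d i * ∏ k ∈ Finset.univ.erase i, (d k : K)) * hc i
  rw [this]
  exact L.smul_mem _ (hdL i)

/-- A lattice has a basis at every finite place: a family of generators for which the determinant
is maximal, by Cramer's rule. -/
theorem exists_isLocalBasis [Fintype ι] (w : FinitePlace K) (e₀ : Module.Basis ι K W)
    (hfg : L.FG) (hL : Submodule.span K (L : Set W) = ⊤) :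
    ∃ e : Module.Basis ι K W, IsLocalBasis w L e := by
  classical
  obtain ⟨S, hS⟩ := hfg
  have hSK : ⊤ ≤ Submodule.span K (S : Set W) := by
    rw [← hL, Submodule.span_le, ← hS]
    exact Submodule.span_le_restrictScalars (𝓞 K) K (S : Set W)
  let b₁ := (Module.Basis.ofSpan hSK).reindex ((Module.Basis.ofSpan hSK).indexEquiv e₀)
  have hb₁ : ∀ i, b₁ i ∈ S := fun i => by
    refine Module.Basis.ofSpan_subset hSK ?_
    rw [Module.Basis.reindex_apply]
    exact Set.mem_range_self _
  let I₁ : ι → S := fun i => ⟨b₁ i, hb₁ i⟩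
  have : Nonempty (ι → S) := ⟨I₁⟩
  obtain ⟨I, hI⟩ := Finite.exists_max fun I : ι → S => w (e₀.det fun i => (I i : W))
  have hdet : e₀.det (fun i => (I i : W)) ≠ 0 := by
    have h1 : 0 < w (e₀.det b₁) := FinitePlace.pos_iff.mpr (e₀.isUnit_det b₁).ne_zero
    exact FinitePlace.pos_iff.mp (h1.trans_le (hI I₁))
  obtain ⟨hli, hsp⟩ := e₀.is_basis_iff_det.mpr (isUnit_iff_ne_zero.mpr hdet)
  let e := Module.Basis.mk hli hsp.ge
  have he : ∀ i, e i = I i := fun i => Module.Basis.mk_apply hli hsp.ge i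
  refine ⟨e, fun i => ⟨1, by simp, ?_⟩, ?_⟩
  · rw [one_smul, he, ← hS]
    exact Submodule.subset_span (I i).2
  · intro x hx i
    rw [← hS] at hx
    induction hx using Submodule.span_induction with
    | mem x hx =>
      have hcr := congrArg (fun f => f x) (e₀.det_smul_mk_coord_eq_det_update hli hsp.ge i)
      have h2 : e₀.det (fun i => (I i : W)) * e.repr x i
          = e₀.det (fun k => (Function.update I i ⟨x, hx⟩ k : W)) := by
        refine Eq.trans hcr ?_
        change e₀.det (Function.update _ i x) = _
        congr 1
        ext k
        by_cases hk : k = i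
        · subst hk; simp
        · simp [hk]
      have h3 := hI (Function.update I i ⟨x, hx⟩)
      rw [← h2, map_mul] at h3
      exact le_of_mul_le_mul_left (by simpa using h3) (FinitePlace.pos_iff.mpr hdet)
    | zero => simp
    | add x y _ _ hx hy =>
      rw [map_add, Finsupp.add_apply]
      exact (FinitePlace.add_le w _ _).trans (max_le hx hy)
    | smul a x _ hx =>
      rw [integer_smul_eq, map_smul, Finsupp.smul_apply, smul_eq_mul, map_mul]
      exact mul_le_one₀ (finitePlace_integer_le_one w a) (apply_nonneg w _) hx

theorem exists_integer_smul_mem (hL : Submodule.span K (L : Set W) = ⊤) (x : W) :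
    ∃ b : 𝓞 K, b ≠ 0 ∧ b • x ∈ L := by
  have hx : x ∈ Submodule.span K (L : Set W) := hL ▸ Submodule.mem_top
  induction hx using Submodule.span_induction with
  | mem x hx => exact ⟨1, one_ne_zero, by rwa [one_smul]⟩
  | zero => exact ⟨1, one_ne_zero, by simp⟩
  | add x y _ _ hx hy =>
    obtain ⟨b, hb, hbx⟩ := hx
    obtain ⟨c, hc, hcy⟩ := hy
    refine ⟨b * c, mul_ne_zero hb hc, ?_⟩
    rw [smul_add, mul_smul, smul_comm, mul_smul]
    exact L.add_mem (L.smul_mem c hbx) (L.smul_mem b hcy)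
  | smul a x _ hx =>
    obtain ⟨b, hb, hbx⟩ := hx
    obtain ⟨c, d, hd, rfl⟩ := IsFractionRing.div_surjective (A := 𝓞 K) a
    refine ⟨d * b, mul_ne_zero (nonZeroDivisors.ne_zero hd) hb, ?_⟩
    have hd' : (d : K) ≠ 0 := by
      simpa using nonZeroDivisors.ne_zero hd
    have : (d * b) • ((algebraMap (𝓞 K) K c / algebraMap (𝓞 K) K d) • x) = c • b • x := by
      rw [integer_smul_eq, integer_smul_eq, integer_smul_eq, smul_smul, smul_smul]
      congr 1
      push_cast
      field_simp
    rw [this]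
    exact L.smul_mem c hbx

/-- A basis of `W` is a basis of the localization of a lattice at all but finitely many places. -/
theorem eventually_isLocalBasis [Finite ι] (e : Module.Basis ι K W) (hfg : L.FG)
    (hL : Submodule.span K (L : Set W) = ⊤) :
    ∀ᶠ w : FinitePlace K in Filter.cofinite, IsLocalBasis w L e := by
  obtain ⟨S, hS⟩ := hfg
  choose b hb hbL using fun i => exists_integer_smul_mem hL (e i)
  have h1 : ∀ᶠ w : FinitePlace K in Filter.cofinite, ∀ i, w (b i : K) = 1 :=
    Filter.eventually_all.mpr fun i => eventually_finitePlace_eq_one (by simpa using hb i)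
  have h2 : ∀ᶠ w : FinitePlace K in Filter.cofinite, ∀ x ∈ S, ∀ i, w (e.repr x i) ≤ 1 :=
    (Filter.eventually_all_finset S).mpr fun x _ => Filter.eventually_all.mpr fun i =>
      eventually_finitePlace_le_one _
  filter_upwards [h1, h2] with w hw1 hw2
  refine ⟨fun i => ⟨b i, hw1 i, hbL i⟩, fun x hx i => ?_⟩
  rw [← hS] at hx
  induction hx using Submodule.span_induction with
  | mem x hx => exact hw2 x hx i
  | zero => simp
  | add x y _ _ hx hy =>
    rw [map_add, Finsupp.add_apply]
    exact (FinitePlace.add_le w _ _).trans (max_le hx hy)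
  | smul a x _ hx =>
    rw [integer_smul_eq, map_smul, Finsupp.smul_apply, smul_eq_mul, map_mul]
    exact mul_le_one₀ (finitePlace_integer_le_one w a) (apply_nonneg w _) hx

end LocalBasis

section ModelNorm

variable {K : Type*} [Field K] [NumberField K] {W : Type*} [AddCommGroup W] [Module K W]
  [Module (𝓞 K) W] [IsScalarTower (𝓞 K) K W] {ι : Type*} {L : Submodule (𝓞 K) W}
  {w : FinitePlace K}

theorem modelNorm_nonneg (x : W) : 0 ≤ modelNorm L w x :=
  Real.sInf_nonneg (by
    rintro t ⟨a, -, -, rfl⟩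
    exact apply_nonneg w a)

theorem modelNorm_le {x : W} {a : K} (ha : a ≠ 0) (hx : a⁻¹ • x ∈ L) : modelNorm L w x ≤ w a :=
  csInf_le ⟨0, by
    rintro t ⟨a, -, -, rfl⟩
    exact apply_nonneg w a⟩ ⟨a, ha, hx, rfl⟩

/-- The infimum in the norm given by a lattice is the value `w c` if it is reached by `c` up to an
integer which is a unit at `w`. -/
theorem modelNorm_eq {x : W} {c : K} (hc : c ≠ 0)
    (h1 : ∃ b : 𝓞 K, w (b : K) = 1 ∧ b • c⁻¹ • x ∈ L)
    (h2 : ∀ a : K, a ≠ 0 → a⁻¹ • x ∈ L → w c ≤ w a) : modelNorm L w x = w c := by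
  obtain ⟨b, hb, hbx⟩ := h1
  have hb0 : (b : K) ≠ 0 := FinitePlace.pos_iff.mp (hb ▸ one_pos : 0 < w (b : K))
  have h3 : (c / b)⁻¹ • x ∈ L := by
    rwa [inv_div, div_eq_mul_inv, mul_smul, ← integer_smul_eq]
  have h4 : w (c / b) = w c := by rw [map_div₀, hb, div_one]
  apply le_antisymm
  · rw [← h4]
    exact modelNorm_le (div_ne_zero hc hb0) h3
  · refine le_csInf ⟨_, c / b, div_ne_zero hc hb0, h3, rfl⟩ ?_
    rintro t ⟨a, ha, hax, rfl⟩
    exact h2 a ha hax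

/-- The norm given by a lattice is the maximum of the absolute values of the coordinates in a local
basis. -/
theorem modelNorm_eq_of_isLocalBasis [Fintype ι] {e : Module.Basis ι K W}
    (he : IsLocalBasis w L e) {x : W} {i : ι} (hi : e.repr x i ≠ 0)
    (hmax : ∀ k, w (e.repr x k) ≤ w (e.repr x i)) : modelNorm L w x = w (e.repr x i) := by
  have hpos : 0 < w (e.repr x i) := FinitePlace.pos_iff.mpr hi
  refine modelNorm_eq hi (he.exists_smul_mem fun k => ?_) fun a ha hax => ?_
  · rw [map_smul, Finsupp.smul_apply, smul_eq_mul, map_mul, map_inv₀, inv_mul_le_iff₀ hpos, mul_one]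
    exact hmax k
  · have := he.repr_le _ hax i
    rwa [map_smul, Finsupp.smul_apply, smul_eq_mul, map_mul, map_inv₀,
      inv_mul_le_iff₀ (FinitePlace.pos_iff.mpr ha), mul_one] at this

variable {M : Type*} [AddCommGroup M] [Module (𝓞 K) M]

theorem tmul_mem_lattice (x : M) : (1 : K) ⊗ₜ[𝓞 K] x ∈ lattice (K := K) M :=
  LinearMap.mem_range_self (TensorProduct.mk (𝓞 K) K M 1) x

theorem span_lattice : Submodule.span K (lattice (K := K) M : Set (K ⊗[𝓞 K] M)) = ⊤ := by
  refine eq_top_iff.mpr fun x _ => ?_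
  induction x using TensorProduct.induction_on with
  | zero => exact zero_mem _
  | add x y hx hy => exact add_mem (hx trivial) (hy trivial)
  | tmul a x =>
    have : a ⊗ₜ[𝓞 K] x = a • ((1 : K) ⊗ₜ[𝓞 K] x) := by
      rw [TensorProduct.smul_tmul', smul_eq_mul, mul_one]
    rw [this]
    exact Submodule.smul_mem _ a (Submodule.subset_span (tmul_mem_lattice x))

theorem lattice_fg [Module.Finite (𝓞 K) M] : (lattice (K := K) M).FG := by
  rw [lattice, LinearMap.range_eq_map]
  exact (Module.Finite.fg_top).map _

theorem modelNorm_tmul_le_one (x : M) : modelNorm (lattice M) w ((1 : K) ⊗ₜ[𝓞 K] x) ≤ 1 := by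
  have := modelNorm_le (L := lattice M) (w := w) (x := (1 : K) ⊗ₜ[𝓞 K] x) (a := 1) one_ne_zero
    (by rw [inv_one, one_smul]; exact tmul_mem_lattice x)
  rwa [map_one] at this

/-- The norm of a determinant given by the exterior power of a lattice is the absolute value of the
determinant in a local basis. -/
theorem modelNorm_wedgeLattice {r : ℕ} {e : Module.Basis (Fin r) K (K ⊗[𝓞 K] M)}
    (he : IsLocalBasis w (lattice M) e) {s : Fin r → K ⊗[𝓞 K] M} (hs : e.det s ≠ 0) :
    modelNorm (wedgeLattice M r) w (exteriorPower.ιMulti K r s) = w (e.det s) := by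
  refine modelNorm_eq hs ?_ fun a ha hax => ?_
  · choose b hb hbL using he.mem
    refine ⟨∏ i, b i, by simp [hb], ?_⟩
    rw [ιMulti_eq_det_smul e s, inv_smul_smul₀ hs, integer_smul_eq]
    choose m hm using hbL
    have : ((∏ i, b i : 𝓞 K) : K) • exteriorPower.ιMulti K r e
        = exteriorPower.ιMulti K r fun i => (1 : K) ⊗ₜ[𝓞 K] m i := by
      have h1 : (fun i => (1 : K) ⊗ₜ[𝓞 K] m i) = fun i => (b i : K) • e i :=
        funext fun i => (hm i).trans (integer_smul_eq _ _)
      rw [h1, AlternatingMap.map_smul_univ]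
      push_cast
      rfl
    rw [this]
    exact Submodule.subset_span ⟨m, rfl⟩
  · let φ : (⋀[K]^r (K ⊗[𝓞 K] M)) →ₗ[K] K := exteriorPower.alternatingMapLinearEquiv e.det
    have hφ : ∀ t, φ (exteriorPower.ιMulti K r t) = e.det t := fun t =>
      exteriorPower.alternatingMapLinearEquiv_apply_ιMulti e.det t
    have key : ∀ x ∈ wedgeLattice M r, w (φ x) ≤ 1 := by
      intro x hx
      induction hx using Submodule.span_induction with
      | mem x hx =>
        obtain ⟨m, rfl⟩ := hx
        rw [hφ, Module.Basis.det_apply]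
        refine (finitePlace_det_le w zero_le_one fun i j => ?_).trans_eq (one_pow _)
        exact he.repr_le _ (tmul_mem_lattice _) i
      | zero => simp
      | add x y _ _ hx hy =>
        rw [map_add]
        exact (FinitePlace.add_le w _ _).trans (max_le hx hy)
      | smul a x _ hx =>
        rw [integer_smul_eq, map_smul, smul_eq_mul, map_mul]
        exact mul_le_one₀ (finitePlace_integer_le_one w a) (apply_nonneg w _) hx
    have := key _ hax
    rwa [map_smul, hφ, smul_eq_mul, map_mul, map_inv₀,
      inv_mul_le_iff₀ (FinitePlace.pos_iff.mpr ha), mul_one] at this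

end ModelNorm

/-! ### Bases and exact sequences -/

section ExactBasis

/-- A basis of the middle term of a short exact sequence, given by bases of the other terms. -/
theorem exists_basis_sum {k V V' V'' : Type*} [Field k] [AddCommGroup V] [Module k V]
    [AddCommGroup V'] [Module k V'] [AddCommGroup V''] [Module k V''] {ι' ι'' : Type*}
    [Fintype ι''] {j : V' →ₗ[k] V} {q : V →ₗ[k] V''} (hj : Function.Injective j)
    (hjq : Function.Exact j q) (b' : Module.Basis ι' k V') (b'' : Module.Basis ι'' k V'')
    (c : ι'' → V) (hc : ∀ i, q (c i) = b'' i) :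
    ∃ B : Module.Basis (ι' ⊕ ι'') k V, (∀ i, B (Sum.inl i) = j (b' i)) ∧
      ∀ i, B (Sum.inr i) = c i := by
  let f : V' × V'' →ₗ[k] V := j.coprod (b''.constr k c)
  have hqf : ∀ x, q (f x) = x.2 := fun x => by
    have h : q.comp (b''.constr k c) = LinearMap.id := b''.ext fun i => by
      rw [LinearMap.comp_apply, Module.Basis.constr_basis, hc, LinearMap.id_apply]
    have h2 := LinearMap.congr_fun h x.2
    have h3 : q (j x.1) = 0 := (hjq _).mpr ⟨_, rfl⟩
    rw [LinearMap.coprod_apply, map_add, h3, zero_add]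
    exact h2
  have hf : Function.Bijective f := by
    constructor
    · refine (injective_iff_map_eq_zero f).mpr fun x hx => ?_
      have h2 : x.2 = 0 := by rw [← hqf, hx, map_zero]
      have h1 : j x.1 = 0 := by
        rw [← hx, LinearMap.coprod_apply, h2, map_zero, add_zero]
      exact Prod.ext (hj (h1.trans (map_zero j).symm)) h2
    · intro y
      obtain ⟨x, hx⟩ := (hjq (y - f (0, q y))).mp (by rw [map_sub, hqf, sub_self])
      refine ⟨(x, q y), ?_⟩
      have h1 : f (x, q y) = j x + f (0, q y) := by
        simp [f, LinearMap.coprod_apply]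
      rw [h1, hx, sub_add_cancel]
  refine ⟨(b'.prod b'').map (LinearEquiv.ofBijective f hf), fun i => ?_, fun i => ?_⟩
  · simp [f, LinearMap.coprod_apply]
  · rw [Module.Basis.map_apply, LinearEquiv.ofBijective_apply, LinearMap.coprod_apply,
      Module.Basis.prod_apply_inr_fst, Module.Basis.prod_apply_inr_snd, map_zero, zero_add,
      Module.Basis.constr_basis]

variable {K : Type*} [Field K] [NumberField K] {W W' W'' : Type*}
  [AddCommGroup W] [Module K W] [Module (𝓞 K) W] [IsScalarTower (𝓞 K) K W]
  [AddCommGroup W'] [Module K W'] [Module (𝓞 K) W'] [IsScalarTower (𝓞 K) K W']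
  [AddCommGroup W''] [Module K W''] [Module (𝓞 K) W''] [IsScalarTower (𝓞 K) K W'']

/-- Local bases of the lattices induced by `L` on the outer terms of a short exact sequence give a
local basis of `L`. -/
theorem exists_isLocalBasis_sum {w : FinitePlace K} {L : Submodule (𝓞 K) W} {j : W' →ₗ[K] W}
    {q : W →ₗ[K] W''} (hj : Function.Injective j) (hjq : Function.Exact j q) {ι' ι'' : Type*}
    [Fintype ι'] [Fintype ι''] {u : Module.Basis ι' K W'} {e'' : Module.Basis ι'' K W''}
    (hu : IsLocalBasis w (L.comap (j.restrictScalars (𝓞 K))) u)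
    (he'' : IsLocalBasis w (L.map (q.restrictScalars (𝓞 K))) e'') :
    ∃ B : Module.Basis (ι' ⊕ ι'') K W, IsLocalBasis w L B ∧ (∀ i, B (Sum.inl i) = j (u i)) ∧
      ∀ i, q (B (Sum.inr i)) = e'' i := by
  choose b hb hbL using he''.mem
  choose y hyL hy using hbL
  have hb0 : ∀ i, (b i : K) ≠ 0 := fun i => FinitePlace.pos_iff.mp (hb i ▸ one_pos)
  have hyq : ∀ i, q (y i) = (b i : K) • e'' i := fun i => (hy i).trans (integer_smul_eq _ _)
  obtain ⟨B, hBl, hBr⟩ := exists_basis_sum hj hjq u e'' (fun i => (b i : K)⁻¹ • y i) fun i => by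
    rw [map_smul, hyq, inv_smul_smul₀ (hb0 i)]
  have hyB : ∀ i, y i = b i • B (Sum.inr i) := fun i => by
    rw [hBr, integer_smul_eq, smul_inv_smul₀ (hb0 i)]
  have hqB : ∀ i, q (B (Sum.inr i)) = e'' i := fun i => by
    rw [hBr, map_smul, hyq, inv_smul_smul₀ (hb0 i)]
  refine ⟨B, ⟨?_, ?_⟩, hBl, hqB⟩
  · rintro (i | i)
    · obtain ⟨a, ha, haL⟩ := hu.mem i
      refine ⟨a, ha, ?_⟩
      rw [hBl]
      simpa using haL
    · exact ⟨b i, hb i, hyB i ▸ hyL i⟩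
  · intro x hx
    have hqx : ∀ i, B.repr x (Sum.inr i) = e''.repr (q x) i := fun i => by
      conv_rhs => rw [← B.sum_repr x, map_sum]
      have h1 : ∀ i, q (j (u i)) = 0 := fun i => (hjq _).mpr ⟨_, rfl⟩
      simp only [Fintype.sum_sum_type, map_smul, hBl, h1, smul_zero, Finset.sum_const_zero,
        zero_add, hqB]
      rw [e''.repr_sum_self]
    have hr : ∀ i, w (B.repr x (Sum.inr i)) ≤ 1 := fun i => by
      rw [hqx]
      exact he''.repr_le _ ⟨x, hx, rfl⟩ i
    -- after multiplication by a unit at `w`, the part of `x` along the lifts is in `L`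
    obtain ⟨a, ha, hac⟩ := exists_forall_mul_eq_integer w (a := fun i =>
      B.repr x (Sum.inr i) * (b i : K)⁻¹) fun i => by
        rw [map_mul, map_inv₀, hb, inv_one, mul_one]
        exact hr i
    choose c hc using hac
    let z : W' := ∑ i, B.repr x (Sum.inl i) • u i
    have hz : a • x = j (a • z) + ∑ i, c i • y i := by
      have h1 : ∀ i, (c i : 𝓞 K) • y i = a • (B.repr x (Sum.inr i) • B (Sum.inr i)) := fun i => by
        rw [hyB, integer_smul_eq, integer_smul_eq, integer_smul_eq, smul_smul, smul_smul, ← hc]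
        congr 1
        have := hb0 i
        field_simp
      conv_lhs => rw [← B.sum_repr x, Fintype.sum_sum_type]
      rw [smul_add, Finset.smul_sum (s := Finset.univ) (f := fun i => B.repr x (Sum.inr i) • _)]
      simp only [h1]
      congr 1
      rw [integer_smul_eq, integer_smul_eq, map_smul]
      simp only [z, map_sum, map_smul, hBl]
    have hzL : a • z ∈ L.comap (j.restrictScalars (𝓞 K)) := by
      have : j (a • z) = a • x - ∑ i, c i • y i := by rw [hz, add_sub_cancel_right]
      change j (a • z) ∈ L
      rw [this]
      exact L.sub_mem (L.smul_mem a hx) (L.sum_mem fun i _ => L.smul_mem _ (hyL i))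
    rintro (i | i)
    · have h1 := hu.repr_le _ hzL i
      rwa [integer_smul_eq, map_smul, Finsupp.smul_apply, smul_eq_mul, map_mul, ha, one_mul,
        u.repr_sum_self] at h1
    · exact hr i

end ExactBasis

/-! ### The lemma of Gauss -/

section Gauss

variable {K : Type*} [Field K] [NumberField K] (w : FinitePlace K)

theorem finitePlace_sum_lt {ι : Type*} {s : Finset ι} {f : ι → K} {B : ℝ} (hB : 0 < B)
    (h : ∀ i ∈ s, w (f i) < B) : w (∑ i ∈ s, f i) < B := by
  classical
  induction s using Finset.induction_on with
  | empty => simpa using hB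
  | insert i s hi ih =>
    rw [Finset.sum_insert hi]
    exact (FinitePlace.add_le w _ _).trans_lt (max_lt (h i (Finset.mem_insert_self _ _))
      (ih fun k hk => h k (Finset.mem_insert_of_mem hk)))

variable {ι : Type*} [LinearOrder ι]

/-- The lexicographically largest index of a coefficient of maximal absolute value. -/
theorem exists_lex_max_coeff {p : MvPolynomial ι K} (hp : p ≠ 0) :
    ∃ α, p.coeff α ≠ 0 ∧ (∀ α', w (p.coeff α') ≤ w (p.coeff α)) ∧
      ∀ α', toLex α < toLex α' → w (p.coeff α') < w (p.coeff α) := by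
  have hne : p.support.Nonempty := by
    rwa [Finset.nonempty_iff_ne_empty, Ne, MvPolynomial.support_eq_empty]
  obtain ⟨α₀, hα₀, hmax₀⟩ := p.support.exists_max_image (fun α => w (p.coeff α)) hne
  obtain ⟨α, hα, hmax⟩ := (p.support.filter fun α =>
    w (p.coeff α) = w (p.coeff α₀)).exists_max_image toLex ⟨α₀, Finset.mem_filter.mpr ⟨hα₀, rfl⟩⟩
  rw [Finset.mem_filter] at hα
  have h0 : p.coeff α ≠ 0 := MvPolynomial.mem_support_iff.mp hα.1
  have hle : ∀ α', w (p.coeff α') ≤ w (p.coeff α) := fun α' => by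
    by_cases h : α' ∈ p.support
    · exact (hmax₀ α' h).trans hα.2.ge
    · rw [MvPolynomial.notMem_support_iff.mp h, map_zero]
      exact apply_nonneg w _
  refine ⟨α, h0, hle, fun α' hα' => lt_of_le_of_ne (hle α') fun h => ?_⟩
  have h1 : α' ∈ p.support := by
    rw [MvPolynomial.mem_support_iff]
    intro h2
    rw [h2, map_zero] at h
    exact h0 (eq_zero_of_map_eq_zero w h.symm)
  exact hα'.not_ge (hmax α' (Finset.mem_filter.mpr ⟨h1, h.trans hα.2⟩))

/-- The lemma of Gauss: the maximum of the absolute values of the coefficients is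
supermultiplicative. In the coefficient at the sum of the lexicographically largest indices of
maximal coefficients of `p` and `q`, the product of these coefficients dominates all other terms. -/
theorem exists_mul_le_coeff_mul {p q : MvPolynomial ι K} (hp : p ≠ 0) (hq : q ≠ 0) :
    ∃ α β, p.coeff α ≠ 0 ∧ (∀ α', w (p.coeff α') ≤ w (p.coeff α)) ∧
      (∀ β', w (q.coeff β') ≤ w (q.coeff β)) ∧
      w (p.coeff α) * w (q.coeff β) ≤ w ((p * q).coeff (α + β)) := by
  classical
  obtain ⟨α, hα0, hα, hα'⟩ := exists_lex_max_coeff w hp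
  obtain ⟨β, hβ0, hβ, hβ'⟩ := exists_lex_max_coeff w hq
  refine ⟨α, β, hα0, hα, hβ, ?_⟩
  have hpα : 0 < w (p.coeff α) := FinitePlace.pos_iff.mpr hα0
  have hqβ : 0 < w (q.coeff β) := FinitePlace.pos_iff.mpr hβ0
  have hmem : (α, β) ∈ antidiagonal (α + β) := mem_antidiagonal.mpr rfl
  have hlt : w (∑ x ∈ (antidiagonal (α + β)).erase (α, β), p.coeff x.1 * q.coeff x.2)
      < w (p.coeff α) * w (q.coeff β) := by
    refine finitePlace_sum_lt w (mul_pos hpα hqβ) fun x hx => ?_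
    obtain ⟨hne, hx⟩ := Finset.mem_erase.mp hx
    rw [mem_antidiagonal] at hx
    rw [map_mul]
    rcases lt_trichotomy (toLex α) (toLex x.1) with h | h | h
    · exact (mul_le_mul_of_nonneg_left (hβ _) (apply_nonneg w _)).trans_lt
        (mul_lt_mul_of_pos_right (hα' _ h) hqβ)
    · have h1 : α = x.1 := toLex.injective h
      refine absurd (Prod.ext h1.symm ?_) hne
      rw [← h1] at hx
      exact add_left_cancel hx
    · have h2 : toLex β < toLex x.2 := by
        by_contra hcon
        have h3 := add_lt_add_of_lt_of_le h (not_lt.mp hcon)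
        have h4 : toLex x.1 + toLex x.2 = toLex α + toLex β := congrArg toLex hx
        exact absurd h4 h3.ne
      exact mul_lt_mul' (hα _) (hβ' _ h2) (apply_nonneg w _) hpα
  rw [MvPolynomial.coeff_mul, ← Finset.add_sum_erase _ _ hmem]
  by_contra hcon
  rw [not_le] at hcon
  have h1 := FinitePlace.add_le w
    (p.coeff α * q.coeff β + ∑ x ∈ (antidiagonal (α + β)).erase (α, β), p.coeff x.1 * q.coeff x.2)
    (-∑ x ∈ (antidiagonal (α + β)).erase (α, β), p.coeff x.1 * q.coeff x.2)
  rw [add_neg_cancel_right, map_neg_eq_map, map_mul] at h1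
  exact absurd h1 (not_le.mpr (max_lt hcon hlt))

end Gauss

/-! ### Local bases of the symmetric powers -/

section MonomialBasis

variable {K : Type*} [Field K] [NumberField K] {E : Type*} [AddCommGroup E] [Module (𝓞 K) E]
  {ι : Type*} [Fintype ι] [DecidableEq ι] (σ : Module.Basis ι K (K ⊗[𝓞 K] E))

/-- The homogeneous polynomial corresponding to an element of `Sym^D(E) ⊗ K`. -/
def sectionPoly (D : ℕ) (x : K ⊗[𝓞 K] SymPow (𝓞 K) E D) : MvPolynomial ι K :=
  SymmetricAlgebra.equivMvPolynomial σ
    (symPowBaseChange (𝓞 K) K E D x : SymmetricAlgebra K (K ⊗[𝓞 K] E))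

theorem sectionPoly_mulSection {δ D : ℕ} (h : δ ≤ D) (s : SymPow (𝓞 K) E δ)
    (x : K ⊗[𝓞 K] SymPow (𝓞 K) E (D - δ)) :
    sectionPoly σ D ((mulSection h s).baseChange K x)
      = sectionPoly σ δ (1 ⊗ₜ s) * sectionPoly σ (D - δ) x := by
  rw [sectionPoly, symPowBaseChange_mulSection, map_mul, sectionPoly, sectionPoly,
    symPowBaseChange_tmul, one_smul]

/-- The basis of `Sym^D(E) ⊗ K` given by the monomials in a basis of `E ⊗ K`. -/
def monomialBasis (D : ℕ) :
    Module.Basis (multiIndices ι D) K (K ⊗[𝓞 K] SymPow (𝓞 K) E D) :=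
  Module.Basis.ofEquivFun (((symPowBaseChangeEquiv (𝓞 K) K E D).trans (symPowEquiv σ D)).trans
    (homogeneousCoeffEquiv K D))

theorem monomialBasis_repr (D : ℕ) (x : K ⊗[𝓞 K] SymPow (𝓞 K) E D) (α : multiIndices ι D) :
    (monomialBasis σ D).repr x α = (sectionPoly σ D x).coeff (α : ι →₀ ℕ) := rfl

theorem isHomogeneous_sectionPoly (D : ℕ) (x : K ⊗[𝓞 K] SymPow (𝓞 K) E D) :
    (sectionPoly σ D x).IsHomogeneous D :=
  isHomogeneous_equivMvPolynomial σ (symPowBaseChange (𝓞 K) K E D x).2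

theorem sectionPoly_ne_zero {D : ℕ} {x : K ⊗[𝓞 K] SymPow (𝓞 K) E D} (hx : x ≠ 0) :
    sectionPoly σ D x ≠ 0 := by
  intro h
  refine hx ((monomialBasis σ D).repr.map_eq_zero_iff.mp (Finsupp.ext fun α => ?_))
  rw [monomialBasis_repr, h]
  simp

variable {σ} {w : FinitePlace K}

/-- The elements of `Sym(E)` have coefficients integral at `w` in a local basis of `E`. -/
theorem coeff_symScalarExtension_le_one (hσ : IsLocalBasis w (lattice E) σ)
    (f : SymmetricAlgebra (𝓞 K) E) (α : ι →₀ ℕ) :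
    w ((SymmetricAlgebra.equivMvPolynomial σ (symScalarExtension (𝓞 K) K E f)).coeff α) ≤ 1 := by
  induction f using SymmetricAlgebra.induction generalizing α with
  | algebraMap a =>
    rw [AlgHom.commutes, IsScalarTower.algebraMap_apply (𝓞 K) K, AlgEquiv.commutes,
      MvPolynomial.algebraMap_eq, MvPolynomial.coeff_C]
    split_ifs
    · exact finitePlace_integer_le_one w a
    · simp
  | ι e =>
    rw [symScalarExtension_ι, equivMvPolynomial_ι, MvPolynomial.coeff_sum]
    refine finitePlace_sum_le w zero_le_one fun i _ => ?_
    rw [MvPolynomial.coeff_smul, MvPolynomial.coeff_X, smul_eq_mul, map_mul]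
    refine mul_le_one₀ (hσ.repr_le _ (tmul_mem_lattice e) i) (apply_nonneg w _) ?_
    split_ifs <;> simp
  | mul f g hf hg =>
    rw [map_mul, map_mul, MvPolynomial.coeff_mul]
    refine finitePlace_sum_le w zero_le_one fun x _ => ?_
    rw [map_mul]
    exact mul_le_one₀ (hf _) (apply_nonneg w _) (hg _)
  | add f g hf hg =>
    rw [map_add, map_add, MvPolynomial.coeff_add]
    exact (FinitePlace.add_le w _ _).trans (max_le (hf _) (hg _))

theorem prod_ι_pow_mem (D : ℕ) (m : ι → E) (α : multiIndices ι D) :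
    ∏ i, SymmetricAlgebra.ι (𝓞 K) E (m i) ^ (α : ι →₀ ℕ) i ∈ SymPow (𝓞 K) E D := by
  have h : ∀ s : Finset ι, ∏ i ∈ s, SymmetricAlgebra.ι (𝓞 K) E (m i) ^ (α : ι →₀ ℕ) i
      ∈ SymPow (𝓞 K) E (∑ i ∈ s, (α : ι →₀ ℕ) i) := fun s => by
    induction s using Finset.induction_on with
    | empty => exact one_mem_symPow_zero _ _
    | insert i s hi ih =>
      rw [Finset.prod_insert hi, Finset.sum_insert hi, SymPow, pow_add]
      exact Submodule.mul_mem_mul (Submodule.pow_mem_pow _ (LinearMap.mem_range_self _ _) _) ih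
  have := h Finset.univ
  rwa [← Finsupp.degree_eq_sum, mem_multiIndices.mp α.2] at this

/-- The monomials in a local basis of `E` are a local basis of `Sym^D(E)`. -/
theorem isLocalBasis_monomialBasis (hσ : IsLocalBasis w (lattice E) σ) (D : ℕ) :
    IsLocalBasis w (lattice (SymPow (𝓞 K) E D)) (monomialBasis σ D) where
  mem α := by
    choose b hb hbL using hσ.mem
    choose m hm using hbL
    refine ⟨∏ i, b i ^ (α : ι →₀ ℕ) i, by simp [hb], ⟨⟨_, prod_ι_pow_mem D m α⟩, ?_⟩⟩
    refine (monomialBasis σ D).repr.injective (Finsupp.ext fun γ => ?_)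
    have h1 : ∀ i, SymmetricAlgebra.equivMvPolynomial σ (symScalarExtension (𝓞 K) K E
        (SymmetricAlgebra.ι (𝓞 K) E (m i))) = MvPolynomial.C (b i : K) * MvPolynomial.X i :=
      fun i => by
        rw [symScalarExtension_ι]
        have : (1 : K) ⊗ₜ[𝓞 K] m i = (b i : K) • σ i := (hm i).trans (integer_smul_eq _ _)
        rw [this, map_smul, map_smul, SymmetricAlgebra.equivMvPolynomial_ι_apply,
          MvPolynomial.smul_eq_C_mul]
    have h2 : sectionPoly σ D (TensorProduct.mk (𝓞 K) K _ 1 ⟨_, prod_ι_pow_mem D m α⟩)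
        = MvPolynomial.monomial (α : ι →₀ ℕ) (((∏ i, b i ^ (α : ι →₀ ℕ) i : 𝓞 K) : K)) := by
      rw [sectionPoly, TensorProduct.mk_apply, symPowBaseChange_tmul, one_smul, map_prod, map_prod]
      simp only [map_pow, h1, mul_pow]
      rw [Finset.prod_mul_distrib, MvPolynomial.monomial_eq, Finsupp.prod_fintype _ _ (by simp)]
      congr 1
      push_cast
      rw [map_prod]
      simp only [map_pow]
    rw [monomialBasis_repr, h2, integer_smul_eq, map_smul, Module.Basis.repr_self,
      MvPolynomial.coeff_monomial, Finsupp.smul_apply, Finsupp.single_apply]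
    simp only [Subtype.ext_iff, smul_eq_mul, mul_ite, mul_one, mul_zero]
  repr_le := by
    rintro - ⟨f, rfl⟩ α
    rw [monomialBasis_repr, sectionPoly, TensorProduct.mk_apply, symPowBaseChange_tmul, one_smul]
    exact coeff_symScalarExtension_le_one hσ _ _

end MonomialBasis

/-! ### The local inequality at a finite place -/

section FiniteInequality

variable {K : Type*} [Field K] [NumberField K] {E : Type*} [AddCommGroup E] [Module (𝓞 K) E]

theorem one_tmul_ne_zero [Module.Projective (𝓞 K) E] {D : ℕ} {s : SymPow (𝓞 K) E D}
    (hs : s ≠ 0) : (1 : K) ⊗ₜ[𝓞 K] s ≠ 0 := by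
  intro h
  obtain ⟨a, ha⟩ := (IsLocalizedModule.eq_zero_iff (nonZeroDivisors (𝓞 K))
    (TensorProduct.mk (𝓞 K) K (SymPow (𝓞 K) E D) 1)).mp h
  exact hs (isTorsionFree_symPow (nonZeroDivisors.coe_ne_zero a) ha)

theorem lattice_eq_map {M M'' : Type*} [AddCommGroup M] [Module (𝓞 K) M] [AddCommGroup M'']
    [Module (𝓞 K) M''] {g : M →ₗ[𝓞 K] M''} (hg : Function.Surjective g) :
    lattice (K := K) M'' = (lattice M).map ((g.baseChange K).restrictScalars (𝓞 K)) := by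
  ext y
  constructor
  · rintro ⟨x, rfl⟩
    obtain ⟨x, rfl⟩ := hg x
    exact ⟨_, tmul_mem_lattice x, rfl⟩
  · rintro ⟨-, ⟨x, rfl⟩, rfl⟩
    exact tmul_mem_lattice (g x)

theorem baseChange_mulSection_injective [Module.Projective (𝓞 K) E] {δ D : ℕ} (h : δ ≤ D)
    {s : SymPow (𝓞 K) E δ} (hs : s ≠ 0) : Function.Injective ((mulSection h s).baseChange K) := by
  rw [LinearMap.baseChange_eq_ltensor]
  exact Module.Flat.lTensor_preserves_injective_linearMap _ (mulSection_injective h hs)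

theorem exact_baseChange_mulSection {δ D : ℕ} (h : δ ≤ D) (s : SymPow (𝓞 K) E δ) :
    Function.Exact ((mulSection h s).baseChange K) ((vanishing h s).mkQ.baseChange K) := by
  rw [LinearMap.baseChange_eq_ltensor, LinearMap.baseChange_eq_ltensor]
  exact exact_mulSection_mkQ K RingOfIntegers.coe_injective h s

section

variable {ι : Type*} [Fintype ι] [DecidableEq ι] {w : FinitePlace K}
  {σ : Module.Basis ι K (K ⊗[𝓞 K] E)}

/-- If `s * x` is integral at `w`, then the coordinates of `x` are bounded by the inverse of the
norm of `s`. -/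
theorem modelNorm_mul_repr_le [LinearOrder ι] [Module.Projective (𝓞 K) E]
    (hσ : IsLocalBasis w (lattice E) σ) {δ D : ℕ} (h : δ ≤ D) {s : SymPow (𝓞 K) E δ} (hs : s ≠ 0)
    {x : K ⊗[𝓞 K] SymPow (𝓞 K) E (D - δ)}
    (hx : (mulSection h s).baseChange K x ∈ lattice (SymPow (𝓞 K) E D))
    (γ : multiIndices ι (D - δ)) :
    modelNorm (lattice (SymPow (𝓞 K) E δ)) w (1 ⊗ₜ s)
      * w ((monomialBasis σ (D - δ)).repr x γ) ≤ 1 := by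
  rcases eq_or_ne x 0 with rfl | hx0
  · simp
  obtain ⟨α, β, hα0, hα, hβ, hαβ⟩ := exists_mul_le_coeff_mul w
    (sectionPoly_ne_zero σ (one_tmul_ne_zero hs)) (sectionPoly_ne_zero σ hx0)
  have hαD : α ∈ multiIndices ι δ := by
    rw [mem_multiIndices]
    by_contra hcon
    exact hα0 ((isHomogeneous_sectionPoly σ δ _).coeff_eq_zero hcon)
  have h1 : modelNorm (lattice (SymPow (𝓞 K) E δ)) w (1 ⊗ₜ s)
      = w ((sectionPoly σ δ (1 ⊗ₜ s)).coeff α) :=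
    modelNorm_eq_of_isLocalBasis (isLocalBasis_monomialBasis hσ δ) (i := ⟨α, hαD⟩) hα0
      fun k => hα k
  rw [h1, monomialBasis_repr]
  refine (mul_le_mul_of_nonneg_left (hβ _) (apply_nonneg w _)).trans (hαβ.trans ?_)
  obtain ⟨f, hf⟩ := hx
  rw [← sectionPoly_mulSection σ h, ← hf, sectionPoly, TensorProduct.mk_apply,
    symPowBaseChange_tmul, one_smul]
  exact coeff_symScalarExtension_le_one hσ _ _

end

/-- A bound for the index of two lattices. -/
theorem pow_le_finitePlace_det (w : FinitePlace K) {W : Type*} [AddCommGroup W] [Module K W]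
    {S : ℝ} (hS0 : 0 ≤ S) {r : ℕ} (e u : Module.Basis (Fin r) K W)
    (hentry : ∀ i k, S * w (e.repr (u k) i) ≤ 1) : S ^ r ≤ w (u.det e) := by
  have heu : 1 = e.det u * u.det e :=
    e.det_self.symm.trans (congrArg (fun f => f e) (AlternatingMap.eq_smul_basis_det u e.det))
  have hw : 1 = w (e.det u) * w (u.det e) := by rw [← map_mul, ← heu, map_one]
  have hbound : S ^ r * w (e.det u) ≤ 1 := by
    rcases hS0.eq_or_lt with h0 | hpos
    · rw [← h0]
      rcases Nat.eq_zero_or_pos r with rfl | hr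
      · simp
      · rw [zero_pow hr.ne', zero_mul]
        exact zero_le_one
    · have h3 : w (e.det u) ≤ (S⁻¹) ^ r := by
        rw [Module.Basis.det_apply]
        refine (finitePlace_det_le w (inv_nonneg.mpr hS0) fun i k => ?_).trans_eq
          (by rw [Fintype.card_fin])
        rw [Module.Basis.toMatrix_apply, ← one_div, le_div_iff₀ hpos, mul_comm]
        exact hentry i k
      calc S ^ r * w (e.det u) ≤ S ^ r * (S⁻¹) ^ r :=
            mul_le_mul_of_nonneg_left h3 (pow_nonneg hS0 _)
        _ = 1 := by rw [← mul_pow, mul_inv_cancel₀ hpos.ne', one_pow]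
  calc S ^ r = S ^ r * w (e.det u) * w (u.det e) := by rw [mul_assoc, ← hw, mul_one]
    _ ≤ 1 * w (u.det e) := mul_le_mul_of_nonneg_right hbound (apply_nonneg w _)
    _ = w (u.det e) := one_mul _

/-- The norms at a finite place of the determinants of a short exact sequence, when the norm of the
preimages under `f` of the lattice `M` is at most `S⁻¹`. -/
theorem modelNorm_mul_pow_le_of_exact (w : FinitePlace K) {M' M M'' : Type*} [AddCommGroup M']
    [Module (𝓞 K) M'] [AddCommGroup M] [Module (𝓞 K) M] [AddCommGroup M''] [Module (𝓞 K) M'']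
    [Module.Finite (𝓞 K) M] [Module.Finite (𝓞 K) M''] {f : M' →ₗ[𝓞 K] M} {g : M →ₗ[𝓞 K] M''}
    (hg : Function.Surjective g) (hf : Function.Injective (f.baseChange K))
    (hfg : Function.Exact (f.baseChange K) (g.baseChange K)) {r' r'' : ℕ}
    {e' : Module.Basis (Fin r') K (K ⊗[𝓞 K] M')} (he' : IsLocalBasis w (lattice M') e')
    {S : ℝ} (hS0 : 0 ≤ S)
    (hS : ∀ x, f.baseChange K x ∈ lattice M → ∀ i, S * w (e'.repr x i) ≤ 1)
    (t : Module.Basis (Fin r') K (K ⊗[𝓞 K] M')) (b'' : Module.Basis (Fin r'') K (K ⊗[𝓞 K] M''))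
    (B : Module.Basis (Fin r' ⊕ Fin r'') K (K ⊗[𝓞 K] M))
    (hBl : ∀ i, B (Sum.inl i) = f.baseChange K (t i))
    (hBr : ∀ i, g.baseChange K (B (Sum.inr i)) = b'' i) :
    modelNorm (wedgeLattice M'' r'') w (exteriorPower.ιMulti K r'' b'')
      * modelNorm (wedgeLattice M' r') w (exteriorPower.ιMulti K r' t) * S ^ r'
      ≤ modelNorm (wedgeLattice M (r' + r'')) w
        (exteriorPower.ιMulti K (r' + r'') (B.reindex finSumFinEquiv)) := by
  -- a local basis of the saturation of the image of `M'`
  let L' := (lattice (K := K) M).comap ((f.baseChange K).restrictScalars (𝓞 K))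
  have hL'fg : L'.FG := Submodule.fg_of_fg_map_injective ((f.baseChange K).restrictScalars (𝓞 K)) hf
    (Submodule.FG.of_le lattice_fg (Submodule.map_comap_le _ _))
  have hL' : lattice M' ≤ L' := by
    rintro - ⟨x, rfl⟩
    exact tmul_mem_lattice (f x)
  obtain ⟨u, hu⟩ := exists_isLocalBasis w t hL'fg
    (eq_top_iff.mpr (span_lattice.ge.trans (Submodule.span_mono hL')))
  obtain ⟨e'', he''⟩ := exists_isLocalBasis w b'' (lattice_fg (K := K) (M := M'')) span_lattice
  have he2 := he''
  rw [lattice_eq_map hg] at he2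
  obtain ⟨B₀, hB₀, hB₀l, hB₀r⟩ := exists_isLocalBasis_sum hf hfg hu he2
  have hdet : (B₀.reindex finSumFinEquiv).det (B.reindex finSumFinEquiv)
      = u.det t * e''.det b'' := by
    rw [Module.Basis.det_reindex]
    have h1 : (B.reindex finSumFinEquiv) ∘ finSumFinEquiv
        = Sum.elim (fun i => f.baseChange K (t i)) (fun i => B (Sum.inr i)) := by
      ext i
      rw [Function.comp_apply, Module.Basis.reindex_apply, Equiv.symm_apply_apply]
      rcases i with i | i
      · exact hBl i
      · rfl
    rw [h1, det_sum_eq_mul (f.baseChange K) (g.baseChange K) (fun x => (hfg _).mpr ⟨x, rfl⟩) B₀ u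
      e'' hB₀l hB₀r]
    congr 2
    exact funext hBr
  have hut : u.det t = u.det e' * e'.det t :=
    congrArg (fun f => f t) (AlternatingMap.eq_smul_basis_det e' u.det)
  have hne1 : u.det t ≠ 0 := (u.isUnit_det t).ne_zero
  have hne2 : e''.det b'' ≠ 0 := (e''.isUnit_det b'').ne_zero
  have hne3 : e'.det t ≠ 0 := (e'.isUnit_det t).ne_zero
  rw [modelNorm_wedgeLattice he'' hne2, modelNorm_wedgeLattice he' hne3,
    modelNorm_wedgeLattice (hB₀.reindex finSumFinEquiv) (by rw [hdet]; exact mul_ne_zero hne1 hne2),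
    hdet, hut, map_mul, map_mul]
  have hfin : S ^ r' ≤ w (u.det e') := by
    refine pow_le_finitePlace_det w hS0 e' u fun i k => ?_
    obtain ⟨b, hb, hbL⟩ := hu.mem k
    have h3 := hS _ hbL i
    rwa [integer_smul_eq, map_smul, Finsupp.smul_apply, smul_eq_mul, map_mul, hb, one_mul] at h3
  calc w (e''.det b'') * w (e'.det t) * S ^ r'
      ≤ w (e''.det b'') * w (e'.det t) * w (u.det e') := mul_le_mul_of_nonneg_left hfin
        (mul_nonneg (apply_nonneg w _) (apply_nonneg w _))
    _ = w (u.det e') * w (e'.det t) * w (e''.det b'') := by ring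

variable [Module.Finite (𝓞 K) E] [Module.Projective (𝓞 K) E]

/-- Multiplication by `s` embeds the lattice `Sym^{D-δ}(E)` with an index in its saturation which is
controlled by the norm of `s`, through the lemma of Gauss. -/
theorem modelNorm_mul_pow_le (w : FinitePlace K) {δ D : ℕ} (h : δ ≤ D) {s : SymPow (𝓞 K) E δ}
    (hs : s ≠ 0) {r' r'' : ℕ} (t : Module.Basis (Fin r') K (K ⊗[𝓞 K] SymPow (𝓞 K) E (D - δ)))
    (b'' : Module.Basis (Fin r'') K (K ⊗[𝓞 K] (SymPow (𝓞 K) E D ⧸ vanishing h s)))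
    (B : Module.Basis (Fin r' ⊕ Fin r'') K (K ⊗[𝓞 K] SymPow (𝓞 K) E D))
    (hBl : ∀ i, B (Sum.inl i) = (mulSection h s).baseChange K (t i))
    (hBr : ∀ i, (vanishing h s).mkQ.baseChange K (B (Sum.inr i)) = b'' i) :
    modelNorm (wedgeLattice (SymPow (𝓞 K) E D ⧸ vanishing h s) r'') w
        (exteriorPower.ιMulti K r'' b'')
      * modelNorm (wedgeLattice (SymPow (𝓞 K) E (D - δ)) r') w (exteriorPower.ιMulti K r' t)
      * modelNorm (lattice (SymPow (𝓞 K) E δ)) w (1 ⊗ₜ s) ^ r'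
      ≤ modelNorm (wedgeLattice (SymPow (𝓞 K) E D) (r' + r'')) w
        (exteriorPower.ιMulti K (r' + r'') (B.reindex finSumFinEquiv)) := by
  obtain ⟨σ, hσ⟩ := exists_isLocalBasis w (Module.finBasis K (K ⊗[𝓞 K] E)) lattice_fg span_lattice
  let ε := (monomialBasis σ (D - δ)).indexEquiv t
  refine modelNorm_mul_pow_le_of_exact w (vanishing h s).mkQ_surjective
    (baseChange_mulSection_injective h hs) (exact_baseChange_mulSection h s)
    ((isLocalBasis_monomialBasis hσ (D - δ)).reindex ε) (modelNorm_nonneg _) (fun x hx i => ?_)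
    t b'' B hBl hBr
  rw [Module.Basis.repr_reindex_apply]
  exact modelNorm_mul_repr_le hσ h hs hx _

end FiniteInequality

section AlmostAll

variable {K : Type*} [Field K] [NumberField K] {M : Type*} [AddCommGroup M] [Module (𝓞 K) M]
  [Module.Finite (𝓞 K) M]

theorem modelNorm_wedgeLattice_pos (w : FinitePlace K) {r : ℕ}
    (σ : Module.Basis (Fin r) K (K ⊗[𝓞 K] M)) :
    0 < modelNorm (wedgeLattice M r) w (exteriorPower.ιMulti K r σ) := by
  obtain ⟨e, he⟩ := exists_isLocalBasis w σ (lattice_fg (K := K) (M := M)) span_lattice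
  have h := (e.isUnit_det σ).ne_zero
  rw [modelNorm_wedgeLattice he h]
  exact FinitePlace.pos_iff.mpr h

theorem modelNorm_wedgeLattice_basis (w : FinitePlace K) {r : ℕ}
    (σ τ : Module.Basis (Fin r) K (K ⊗[𝓞 K] M)) :
    modelNorm (wedgeLattice M r) w (exteriorPower.ιMulti K r τ)
      = modelNorm (wedgeLattice M r) w (exteriorPower.ιMulti K r σ) * w (σ.det τ) := by
  obtain ⟨e, he⟩ := exists_isLocalBasis w σ (lattice_fg (K := K) (M := M)) span_lattice
  rw [modelNorm_wedgeLattice he (e.isUnit_det σ).ne_zero,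
    modelNorm_wedgeLattice he (e.isUnit_det τ).ne_zero, ← map_mul]
  congr 1
  exact congrArg (fun f => f τ) (AlternatingMap.eq_smul_basis_det σ e.det)

/-- A basis of `M ⊗ K` is a local basis of `M` at almost all places. -/
theorem hasFiniteSupport_log_modelNorm_wedgeLattice {r : ℕ}
    (σ : Module.Basis (Fin r) K (K ⊗[𝓞 K] M)) :
    Function.HasFiniteSupport fun w : FinitePlace K =>
      Real.log (modelNorm (wedgeLattice M r) w (exteriorPower.ιMulti K r σ)) := by
  have h : ∀ᶠ w : FinitePlace K in Filter.cofinite,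
      Real.log (modelNorm (wedgeLattice M r) w (exteriorPower.ιMulti K r σ)) = 0 := by
    filter_upwards [eventually_isLocalBasis σ (lattice_fg (K := K) (M := M)) span_lattice] with w hw
    rw [modelNorm_wedgeLattice hw (by rw [σ.det_self]; exact one_ne_zero), σ.det_self, map_one,
      Real.log_one]
  exact h

theorem modelNorm_lattice_pos (w : FinitePlace K) {x : K ⊗[𝓞 K] M} (hx : x ≠ 0) :
    0 < modelNorm (lattice M) w x := by
  obtain ⟨e, he⟩ := exists_isLocalBasis w (Module.finBasis K (K ⊗[𝓞 K] M))
    (lattice_fg (K := K) (M := M)) span_lattice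
  obtain ⟨i₀, hi₀⟩ : ∃ i, e.repr x i ≠ 0 := by
    by_contra! hcon
    exact hx (e.repr.map_eq_zero_iff.mp (Finsupp.ext hcon))
  have : Nonempty (Fin (Module.finrank K (K ⊗[𝓞 K] M))) := ⟨i₀⟩
  obtain ⟨i, hi⟩ := Finite.exists_max fun i => w (e.repr x i)
  have hpos : 0 < w (e.repr x i) := (FinitePlace.pos_iff.mpr hi₀).trans_le (hi i₀)
  rwa [modelNorm_eq_of_isLocalBasis he (FinitePlace.pos_iff.mp hpos) hi]

theorem hasFiniteSupport_log_modelNorm_lattice {x : K ⊗[𝓞 K] M} (hx : x ≠ 0) :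
    Function.HasFiniteSupport fun w : FinitePlace K =>
      Real.log (modelNorm (lattice M) w x) := by
  let e := Module.finBasis K (K ⊗[𝓞 K] M)
  obtain ⟨i, hi⟩ : ∃ i, e.repr x i ≠ 0 := by
    by_contra! hcon
    exact hx (e.repr.map_eq_zero_iff.mp (Finsupp.ext hcon))
  have h1 : ∀ᶠ w : FinitePlace K in Filter.cofinite, ∀ k, w (e.repr x k) ≤ 1 :=
    Filter.eventually_all.mpr fun k => eventually_finitePlace_le_one _
  have h : ∀ᶠ w : FinitePlace K in Filter.cofinite, Real.log (modelNorm (lattice M) w x) = 0 := by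
    filter_upwards [eventually_isLocalBasis e (lattice_fg (K := K) (M := M)) span_lattice, h1,
      eventually_finitePlace_eq_one hi] with w hw hw1 hw2
    rw [modelNorm_eq_of_isLocalBasis hw hi fun k => (hw1 k).trans hw2.ge, hw2, Real.log_one]
  exact h

end AlmostAll

/-! ### The degree in terms of an arbitrary basis -/

section DegreeFormula

variable {K : Type*} [Field K] [NumberField K] {M : Type*} [AddCommGroup M] [Module (𝓞 K) M]
  [Module.Finite (𝓞 K) M]

/-- The product formula. -/
theorem finsum_log_finitePlace {a : K} (ha : a ≠ 0) :
    ∑ᶠ w : FinitePlace K, Real.log (w a)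
      = -∑ v : InfinitePlace K, (v.mult : ℝ) * Real.log (v a) := by
  have hpos : ∀ w : FinitePlace K, 0 < w a := fun w => FinitePlace.pos_iff.mpr ha
  have hpos' : ∀ v : InfinitePlace K, 0 < v a := fun v => InfinitePlace.pos_iff.mpr ha
  have h := congrArg Real.log (prod_abs_eq_one ha)
  have hfin : ∏ᶠ w : FinitePlace K, w a ≠ 0 := by
    intro h0
    have := prod_abs_eq_one ha
    rw [h0, mul_zero] at this
    exact zero_ne_one this
  rw [Real.log_mul (Finset.prod_pos fun v _ => pow_pos (hpos' v) _).ne' hfin, Real.log_one,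
    Real.log_finprod hpos, Real.log_prod fun v _ => (pow_pos (hpos' v) _).ne'] at h
  simp only [Real.log_pow] at h
  linarith

theorem norm_det_toFiber (v : InfinitePlace K) {r : ℕ} (b : Module.Basis (Fin r) ℂ (Fiber v M))
    (σ τ : Module.Basis (Fin r) K (K ⊗[𝓞 K] M)) :
    ‖b.det fun i => toFiber v (τ i)‖ = ‖b.det fun i => toFiber v (σ i)‖ * v (σ.det τ) := by
  have h := congrArg (fun f => f fun i => toFiber v (τ i))
    (AlternatingMap.eq_smul_basis_det (fiberBasis v σ) b.det)
  simp only [AlternatingMap.smul_apply, fiberBasis_det_toFiber, smul_eq_mul] at h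
  rw [h, norm_mul, InfinitePlace.norm_embedding_eq]
  congr 3
  ext i
  exact fiberBasis_apply v σ i

theorem det_toFiber_ne_zero (v : InfinitePlace K) {r : ℕ} (b : Module.Basis (Fin r) ℂ (Fiber v M))
    (σ : Module.Basis (Fin r) K (K ⊗[𝓞 K] M)) : b.det (fun i => toFiber v (σ i)) ≠ 0 := by
  have h := (b.isUnit_det (fiberBasis v σ)).ne_zero
  have h2 : ⇑(fiberBasis v σ) = fun i => toFiber v (σ i) := funext fun i => fiberBasis_apply v σ i
  rwa [h2] at h

/-- The degree can be computed with any basis: by the product formula, a change of basis multiplies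
the norms by the absolute values of a nonzero element of `K`. -/
theorem normalizedDegree_eq {N : ∀ v : InfinitePlace K, Fiber v M → ℝ} {r : ℕ}
    (hN : ∀ v, ∃ b : Module.Basis (Fin r) ℂ (Fiber v M), IsAdaptedBasis (N v) b)
    (τ : Module.Basis (Fin r) K (K ⊗[𝓞 K] M)) :
    normalizedDegree N = (-(∑ᶠ w : FinitePlace K,
        Real.log (modelNorm (wedgeLattice M r) w (exteriorPower.ιMulti K r τ)))
      - ∑ v : InfinitePlace K, (v.mult : ℝ) * Real.log (wedgeNorm (N v) fun i => toFiber v (τ i)))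
      / Module.finrank ℚ K := by
  obtain rfl : Module.finrank K (K ⊗[𝓞 K] M) = r := by
    rw [Module.finrank_eq_card_basis τ, Fintype.card_fin]
  let σ := Module.finBasis K (K ⊗[𝓞 K] M)
  have hd : σ.det τ ≠ 0 := (σ.isUnit_det τ).ne_zero
  have h1 : ∑ᶠ w : FinitePlace K, Real.log (modelNorm (wedgeLattice M _) w
        (exteriorPower.ιMulti K _ τ))
      = ∑ᶠ w : FinitePlace K, Real.log (modelNorm (wedgeLattice M _) w
        (exteriorPower.ιMulti K _ σ)) + ∑ᶠ w : FinitePlace K, Real.log (w (σ.det τ)) := by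
    rw [← finsum_add_distrib (hasFiniteSupport_log_modelNorm_wedgeLattice σ)]
    · refine finsum_congr fun w => ?_
      rw [modelNorm_wedgeLattice_basis w σ τ, Real.log_mul (modelNorm_wedgeLattice_pos w σ).ne'
        (FinitePlace.pos_iff.mpr hd).ne']
    · have : ∀ᶠ w : FinitePlace K in Filter.cofinite, Real.log (w (σ.det τ)) = 0 := by
        filter_upwards [eventually_finitePlace_eq_one hd] with w hw
        rw [hw, Real.log_one]
      exact this
  have h2 : ∀ v : InfinitePlace K, Real.log (wedgeNorm (N v) fun i => toFiber v (τ i))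
      = Real.log (wedgeNorm (N v) fun i => toFiber v (σ i)) + Real.log (v (σ.det τ)) := fun v => by
    obtain ⟨b, hb⟩ := hN v
    rw [wedgeNorm_eq_norm_det hb, wedgeNorm_eq_norm_det hb, norm_det_toFiber v b σ τ,
      Real.log_mul (norm_ne_zero_iff.mpr (det_toFiber_ne_zero v b σ))
        (InfinitePlace.pos_iff.mpr hd).ne']
  rw [h1, finsum_log_finitePlace hd]
  simp only [h2, mul_add, Finset.sum_add_distrib]
  rw [normalizedDegree]
  ring

end DegreeFormula

/-! ### Short exact sequences of Hermitian spaces -/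

section HermitianExact

theorem isAdaptedBasis_of_eq {V : Type*} [AddCommGroup V] [Module ℂ V] {ι : Type*} [Fintype ι]
    {N : V → ℝ} {b : Module.Basis ι ℂ V} (h : ∀ x, N x = √(∑ i, ‖b.repr x i‖ ^ 2)) :
    IsAdaptedBasis N b where
  le x := (h x).ge
  smul_le z i := by
    classical
    rw [h]
    simp only [map_smul, Module.Basis.repr_self, Finsupp.smul_apply, Finsupp.single_apply,
      smul_eq_mul, mul_ite, mul_one, mul_zero]
    rw [Finset.sum_eq_single i (fun k _ hk => by rw [if_neg hk.symm, norm_zero]; norm_num)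
      (fun h => absurd (Finset.mem_univ i) h), if_pos rfl, Real.sqrt_sq (norm_nonneg z)]

variable {H : Type*} [NormedAddCommGroup H] [InnerProductSpace ℂ H]

theorem isAdaptedBasis_of_orthonormal {V : Type*} [AddCommGroup V] [Module ℂ V] {ι : Type*}
    [Fintype ι] {N : V → ℝ} {b : Module.Basis ι ℂ V} {φ : V →ₗ[ℂ] H} (hN : ∀ x, N x = ‖φ x‖)
    (hb : Orthonormal ℂ fun i => φ (b i)) : IsAdaptedBasis N b :=
  isAdaptedBasis_of_eq fun x => by
    have h1 : φ x = ∑ i, b.repr x i • φ (b i) := by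
      conv_lhs => rw [← b.sum_repr x, map_sum]
      simp only [map_smul]
    rw [hN, norm_eq_sqrt_re_inner (𝕜 := ℂ), h1, hb.inner_sum, map_sum]
    congr 1
    refine Finset.sum_congr rfl fun i _ => ?_
    rw [Complex.conj_mul', ← Complex.ofReal_pow]
    exact Complex.ofReal_re _

/-- For a short exact sequence of Hermitian spaces, where the outer terms carry the norms induced
from the middle term, there are compatible orthonormal bases. -/
theorem exists_adapted_bases {V' V V'' : Type*} [AddCommGroup V'] [Module ℂ V'] [AddCommGroup V]
    [Module ℂ V] [AddCommGroup V''] [Module ℂ V''] {ι : Type*} [Fintype ι] {N : V → ℝ}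
    {β : Module.Basis ι ℂ V} (hβ : ∀ x, N x = √(∑ i, ‖β.repr x i‖ ^ 2)) {j : V' →ₗ[ℂ] V}
    {q : V →ₗ[ℂ] V''} (hj : Function.Injective j) (hjq : Function.Exact j q)
    (hq : Function.Surjective q) {r' r'' : ℕ} (hr' : Module.finrank ℂ V' = r')
    (hr'' : Module.finrank ℂ V'' = r'') :
    ∃ (b' : Module.Basis (Fin r') ℂ V') (b'' : Module.Basis (Fin r'') ℂ V'')
      (B : Module.Basis (Fin r' ⊕ Fin r'') ℂ V),
      IsAdaptedBasis (fun x => N (j x)) b' ∧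
      IsAdaptedBasis (fun y => sInf {t | ∃ x, q x = y ∧ t = N x}) b'' ∧ IsAdaptedBasis N B ∧
      (∀ i, B (Sum.inl i) = j (b' i)) ∧ ∀ i, q (B (Sum.inr i)) = b'' i := by
  let φ : V ≃ₗ[ℂ] EuclideanSpace ℂ ι := β.equivFun.trans (WithLp.linearEquiv 2 ℂ (ι → ℂ)).symm
  have hN : ∀ x, N x = ‖φ x‖ := fun x => by
    rw [hβ, EuclideanSpace.norm_eq]
    rfl
  let U : Submodule ℂ (EuclideanSpace ℂ ι) := LinearMap.range (φ.toLinearMap.comp j)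
  let eU : V' ≃ₗ[ℂ] U := LinearEquiv.ofInjective (φ.toLinearMap.comp j) (φ.injective.comp hj)
  have heU : ∀ x, (eU x : EuclideanSpace ℂ ι) = φ (j x) := fun x => rfl
  let p : Uᗮ →ₗ[ℂ] V'' := (q.comp φ.symm.toLinearMap).comp Uᗮ.subtype
  have hqU : ∀ u ∈ U, q (φ.symm u) = 0 := by
    rintro - ⟨x, rfl⟩
    change q (φ.symm (φ (j x))) = 0
    rw [LinearEquiv.symm_apply_apply]
    exact (hjq _).mpr ⟨x, rfl⟩
  -- every class has a unique representative orthogonal to `U`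
  have hproj : ∀ x, ∃ c : Uᗮ, p c = q x ∧ ‖c‖ ≤ N x := fun x => by
    refine ⟨Uᗮ.orthogonalProjectionOnto (φ x), ?_, ?_⟩
    · have h1 : φ x - Uᗮ.orthogonalProjectionOnto (φ x) ∈ U := by
        have := Submodule.sub_starProjection_mem_orthogonal (K := Uᗮ) (φ x)
        rwa [Submodule.orthogonal_orthogonal] at this
      have h2 := hqU _ h1
      rw [map_sub, map_sub, LinearEquiv.symm_apply_apply, sub_eq_zero] at h2
      exact h2.symm
    · rw [hN]
      exact Submodule.norm_orthogonalProjectionOnto_apply_le _ _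
  have hp : Function.Bijective p := by
    refine ⟨(injective_iff_map_eq_zero p).mpr fun c hc => ?_, fun y => ?_⟩
    · obtain ⟨x, hx⟩ := (hjq _).mp hc
      have h1 : (c : EuclideanSpace ℂ ι) ∈ U := ⟨x, by
        change φ (j x) = c
        rw [hx]
        exact φ.apply_symm_apply _⟩
      have h2 := Submodule.inner_right_of_mem_orthogonal h1 c.2
      exact Subtype.ext (inner_self_eq_zero.mp h2)
    · obtain ⟨x, rfl⟩ := hq y
      obtain ⟨c, hc, -⟩ := hproj x
      exact ⟨c, hc⟩
  let eP : Uᗮ ≃ₗ[ℂ] V'' := LinearEquiv.ofBijective p hp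
  have hquot : ∀ y, sInf {t | ∃ x, q x = y ∧ t = N x} = ‖eP.symm y‖ := fun y => by
    have hc : q (φ.symm (eP.symm y : EuclideanSpace ℂ ι)) = y := eP.apply_symm_apply y
    apply le_antisymm
    · refine csInf_le ⟨0, ?_⟩ ⟨_, hc, ?_⟩
      · rintro t ⟨x, -, rfl⟩
        rw [hN]
        exact norm_nonneg _
      · rw [hN, LinearEquiv.apply_symm_apply]
        rfl
    · refine le_csInf ⟨_, _, hc, rfl⟩ ?_
      rintro t ⟨x, rfl, rfl⟩
      obtain ⟨c, hc, hle⟩ := hproj x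
      have : eP.symm (q x) = c := by
        rw [LinearEquiv.symm_apply_eq]
        exact hc.symm
      rwa [this]
  let oU := (stdOrthonormalBasis ℂ U).reindex (finCongr (eU.finrank_eq.symm.trans hr'))
  let oP := (stdOrthonormalBasis ℂ Uᗮ).reindex (finCongr (eP.finrank_eq.trans hr''))
  let b' := oU.toBasis.map eU.symm
  let b'' := oP.toBasis.map eP
  have hb' : ∀ i, φ (j (b' i)) = oU i := fun i => by
    rw [← heU]
    simp [b']
  have hb'' : ∀ i, eP.symm (b'' i) = oP i := fun i => by simp [b'']
  obtain ⟨B, hBl, hBr⟩ := exists_basis_sum hj hjq b' b''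
    (fun i => φ.symm (oP i : EuclideanSpace ℂ ι)) fun i => by
      have : b'' i = eP (oP i) := by simp [b'']
      rw [this]
      rfl
  have horthU : Orthonormal ℂ fun i => (oU i : EuclideanSpace ℂ ι) :=
    oU.orthonormal.comp_linearIsometry U.subtypeₗᵢ
  have horthP : Orthonormal ℂ fun i => (oP i : EuclideanSpace ℂ ι) :=
    oP.orthonormal.comp_linearIsometry Uᗮ.subtypeₗᵢ
  refine ⟨b', b'', B, ?_, ?_, ?_, hBl, fun i => ?_⟩
  · refine isAdaptedBasis_of_orthonormal (φ := φ.toLinearMap.comp j) (fun x => hN _) ?_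
    have : (fun i => (φ.toLinearMap.comp j) (b' i)) = fun i => (oU i : EuclideanSpace ℂ ι) :=
      funext hb'
    rwa [this]
  · refine isAdaptedBasis_of_orthonormal (φ := eP.symm.toLinearMap) hquot ?_
    have : (fun i => eP.symm.toLinearMap (b'' i)) = oP := funext hb''
    rw [this]
    exact oP.orthonormal
  · refine isAdaptedBasis_of_orthonormal (φ := φ.toLinearMap) hN ?_
    have h1 : (fun i => φ.toLinearMap (B i)) = Sum.elim
        (fun i => (oU i : EuclideanSpace ℂ ι)) (fun i => (oP i : EuclideanSpace ℂ ι)) := by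
      funext i
      rcases i with i | i
      · exact (congrArg φ (hBl i)).trans (hb' i)
      · exact (congrArg φ (hBr i)).trans (φ.apply_symm_apply _)
    rw [h1]
    refine ⟨?_, ?_⟩
    · rintro (i | i)
      · exact horthU.1 i
      · exact horthP.1 i
    · rintro (i | i) (k | k) hik
      · exact horthU.2 fun h => hik (congrArg Sum.inl h)
      · exact Submodule.inner_right_of_mem_orthogonal (oU i).2 (oP k).2
      · exact Submodule.inner_left_of_mem_orthogonal (oU k).2 (oP i).2
      · exact horthP.2 fun h => hik (congrArg Sum.inr h)
  · have : b'' i = eP (oP i) := by simp [b'']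
    rw [hBr, this]
    rfl

end HermitianExact

/-! ### The local comparison at an infinite place -/

section InfinitePlaces

variable {K : Type*} [Field K] [NumberField K] (v : InfinitePlace K)

theorem fiberMap_smul {M M' : Type*} [AddCommGroup M] [Module (𝓞 K) M] [AddCommGroup M']
    [Module (𝓞 K) M'] (f : M →ₗ[𝓞 K] M') (z : ℂ) (x : Fiber v M) :
    fiberMap v f (z • x) = z • fiberMap v f x := by
  induction x using TensorProduct.induction_on with
  | zero => rw [smul_zero, map_zero, smul_zero]
  | add x y hx hy => rw [smul_add, map_add, hx, hy, map_add, smul_add]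
  | tmul w x => rfl

/-- The map `fiberMap v f` as a complex linear map. -/
def fiberLin {M M' : Type*} [AddCommGroup M] [Module (𝓞 K) M] [AddCommGroup M']
    [Module (𝓞 K) M'] (f : M →ₗ[𝓞 K] M') : Fiber v M →ₗ[ℂ] Fiber v M' where
  toFun := fiberMap v f
  map_add' := map_add _
  map_smul' := fiberMap_smul v f

theorem toFiber_baseChange {M M' : Type*} [AddCommGroup M] [Module (𝓞 K) M] [AddCommGroup M']
    [Module (𝓞 K) M'] (f : M →ₗ[𝓞 K] M') (x : K ⊗[𝓞 K] M) :
    toFiber v (f.baseChange K x) = fiberMap v f (toFiber v x) := by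
  induction x using TensorProduct.induction_on with
  | zero => simp only [map_zero]
  | add x y hx hy => rw [map_add, map_add, hx, hy, map_add, map_add]
  | tmul a x => rfl

variable {E : Type*} [AddCommGroup E] [Module (𝓞 K) E] [Module.Finite (𝓞 K) E]
  (h : HermitianMetric (K := K) E)

theorem exists_bundleSymNorm_eq (D : ℕ) :
    ∃ (m : ℕ) (β : Module.Basis (multiIndices (Fin m) D) ℂ (Fiber v (SymPow (𝓞 K) E D))),
      ∀ x, bundleSymNorm h D v x = √(∑ i, ‖β.repr x i‖ ^ 2) := by
  obtain ⟨b, hb⟩ := exists_isOrthonormalFor (h.core v) rfl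
  refine ⟨_, Module.Basis.ofEquivFun (((fiberSymEquiv v D).trans (symPowEquiv b D)).trans
    (bombieriCoordEquiv D)), fun x => ?_⟩
  have hx := (fiberSymEquiv v D x).2
  rw [coe_fiberSymEquiv] at hx
  rw [bundleSymNorm, symNorm_eq_bombieriNorm hb hx, bombieriNorm_eq_sqrt_sum]
  congr 1
  refine Finset.sum_congr rfl fun α _ => ?_
  rw [← Module.Basis.equivFun_apply, Module.Basis.equivFun_ofEquivFun, LinearEquiv.trans_apply,
    bombieriCoordEquiv_apply]
  rfl

theorem bundleSymNorm_nonneg (D : ℕ) (x : Fiber v (SymPow (𝓞 K) E D)) :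
    0 ≤ bundleSymNorm h D v x := by
  obtain ⟨m, β, hβ⟩ := exists_bundleSymNorm_eq v h D
  rw [hβ]
  exact Real.sqrt_nonneg _

theorem bundleSymNorm_pos {D : ℕ} {x : Fiber v (SymPow (𝓞 K) E D)} (hx : x ≠ 0) :
    0 < bundleSymNorm h D v x := by
  obtain ⟨m, β, hβ⟩ := exists_bundleSymNorm_eq v h D
  rw [hβ]
  refine Real.sqrt_pos.mpr (lt_of_le_of_ne (Finset.sum_nonneg fun _ _ => sq_nonneg _) fun h =>
    hx ?_)
  rw [eq_comm, Finset.sum_eq_zero_iff_of_nonneg fun _ _ => sq_nonneg _] at h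
  refine β.repr.map_eq_zero_iff.mp (Finsupp.ext fun α => ?_)
  simpa using h α (Finset.mem_univ α)

/-- The inequality of Bombieri, for the norms induced by the multiplication by `s`. -/
theorem mul_bundleSymNorm_le {δ D : ℕ} (hD : δ ≤ D) (s : SymPow (𝓞 K) E δ)
    (x : Fiber v (SymPow (𝓞 K) E (D - δ))) :
    bundleSymNorm h δ v (1 ⊗ₜ s) / √(D.choose δ) * bundleSymNorm h (D - δ) v x
      ≤ bundleSubspaceNorm h hD s v x := by
  obtain ⟨b, hb⟩ := exists_isOrthonormalFor (h.core v) rfl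
  have h1 := (fiberSymEquiv v δ (1 ⊗ₜ s)).2
  have h2 := (fiberSymEquiv v (D - δ) x).2
  have h3 := (fiberSymEquiv v D (fiberMap v (mulSection hD s) x)).2
  rw [coe_fiberSymEquiv] at h1 h2 h3
  have h4 := bombieriNorm_mul_le (isHomogeneous_equivMvPolynomial b h1)
    (isHomogeneous_equivMvPolynomial b h2)
  rw [Nat.add_sub_cancel' hD, ← map_mul, ← fiberToSym_fiberMap_mulSection v hD] at h4
  rw [bundleSubspaceNorm, bundleSymNorm, bundleSymNorm, bundleSymNorm,
    symNorm_eq_bombieriNorm hb h1, symNorm_eq_bombieriNorm hb h2, symNorm_eq_bombieriNorm hb h3]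
  have hpos : 0 < √(D.choose δ : ℝ) :=
    Real.sqrt_pos.mpr (Nat.cast_pos.mpr (Nat.choose_pos hD))
  rwa [div_mul_eq_mul_div, div_le_iff₀ hpos, mul_comm _ √(D.choose δ : ℝ)]

theorem exists_isAdaptedBasis_bundleSymNorm (D : ℕ) {r : ℕ}
    (hr : Module.finrank K (K ⊗[𝓞 K] SymPow (𝓞 K) E D) = r) :
    ∃ b : Module.Basis (Fin r) ℂ (Fiber v (SymPow (𝓞 K) E D)),
      IsAdaptedBasis (bundleSymNorm h D v) b := by
  obtain ⟨m, β, hβ⟩ := exists_bundleSymNorm_eq v h D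
  have hcard : Fintype.card (multiIndices (Fin m) D) = r := by
    rw [← Module.finrank_eq_card_basis β, finrank_fiber, hr]
  let e := Fintype.equivFinOfCardEq hcard
  exact ⟨β.reindex e, (isAdaptedBasis_of_eq hβ).reindex e⟩

variable [Module.Projective (𝓞 K) E]

theorem hypersurfaceJohnNorm_eq {δ D : ℕ} (hD : δ ≤ D) (hD0 : 0 < D) (s : SymPow (𝓞 K) E δ)
    (y : Fiber v (HypersurfaceSections hD s)) :
    hypersurfaceJohnNorm h hD s v y
      = sInf {t | ∃ x, fiberLin v (vanishing hD s).mkQ x = y ∧ t = bundleSymNorm h D v x} := by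
  rw [hypersurfaceJohnNorm, quotientNorm]
  simp only [bundleJohnNorm_eq v h hD0]
  rfl

/-- Compatible orthonormal bases at an infinite place. The quotient norm on the sections on the
hypersurface is induced by an inner product because the norm of John is the symmetric norm. -/
theorem exists_adapted_bases_fiber {δ D : ℕ} (hD : δ ≤ D) (hD0 : 0 < D) {s : SymPow (𝓞 K) E δ}
    (hs : s ≠ 0) {r' r'' : ℕ}
    (hr' : Module.finrank K (K ⊗[𝓞 K] SymPow (𝓞 K) E (D - δ)) = r')
    (hr'' : Module.finrank K (K ⊗[𝓞 K] HypersurfaceSections hD s) = r'') :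
    ∃ (b' : Module.Basis (Fin r') ℂ (Fiber v (SymPow (𝓞 K) E (D - δ))))
      (b'' : Module.Basis (Fin r'') ℂ (Fiber v (HypersurfaceSections hD s)))
      (B : Module.Basis (Fin r' ⊕ Fin r'') ℂ (Fiber v (SymPow (𝓞 K) E D))),
      IsAdaptedBasis (bundleSubspaceNorm h hD s v) b' ∧
      IsAdaptedBasis (hypersurfaceJohnNorm h hD s v) b'' ∧
      IsAdaptedBasis (bundleSymNorm h D v) B ∧
      (∀ i, B (Sum.inl i) = fiberLin v (mulSection hD s) (b' i)) ∧
      ∀ i, fiberLin v (vanishing hD s).mkQ (B (Sum.inr i)) = b'' i := by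
  obtain ⟨m, β, hβ⟩ := exists_bundleSymNorm_eq v h D
  have hj : Function.Injective (fiberLin v (mulSection hD s)) :=
    Module.Flat.lTensor_preserves_injective_linearMap (M := ComplexAt v) _
      (mulSection_injective hD hs)
  have hjq : Function.Exact (fiberLin v (mulSection hD s)) (fiberLin v (vanishing hD s).mkQ) :=
    exact_mulSection_mkQ (ComplexAt v) (algebraMap_complexAt_injective v) hD s
  have hq : Function.Surjective (fiberLin v (vanishing hD s).mkQ) :=
    LinearMap.lTensor_surjective (ComplexAt v) (vanishing hD s).mkQ_surjective
  obtain ⟨b', b'', B, h1, h2, h3, h4, h5⟩ := exists_adapted_bases hβ hj hjq hq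
    ((finrank_fiber v).trans hr') ((finrank_fiber v).trans hr'')
  refine ⟨b', b'', B, h1, ?_, h3, h4, h5⟩
  have : hypersurfaceJohnNorm h hD s v = fun y => sInf {t | ∃ x,
      fiberLin v (vanishing hD s).mkQ x = y ∧ t = bundleSymNorm h D v x} :=
    funext (hypersurfaceJohnNorm_eq v h hD hD0 s)
  rwa [this]

/-- The multiplicativity of the norms of determinants in a short exact sequence. -/
theorem wedgeNorm_mul_wedgeNorm {δ D : ℕ} (hD : δ ≤ D) (hD0 : 0 < D) {s : SymPow (𝓞 K) E δ}
    (hs : s ≠ 0) {r' r'' : ℕ}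
    (t : Module.Basis (Fin r') K (K ⊗[𝓞 K] SymPow (𝓞 K) E (D - δ)))
    (c : Module.Basis (Fin r'') K (K ⊗[𝓞 K] HypersurfaceSections hD s))
    (C : Module.Basis (Fin r' ⊕ Fin r'') K (K ⊗[𝓞 K] SymPow (𝓞 K) E D))
    (hCl : ∀ i, C (Sum.inl i) = (mulSection hD s).baseChange K (t i))
    (hCr : ∀ i, (vanishing hD s).mkQ.baseChange K (C (Sum.inr i)) = c i) :
    wedgeNorm (bundleSymNorm h D v) (fun i => toFiber v (C.reindex finSumFinEquiv i))
      = wedgeNorm (bundleSubspaceNorm h hD s v) (fun i => toFiber v (t i))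
        * wedgeNorm (hypersurfaceJohnNorm h hD s v) (fun i => toFiber v (c i)) := by
  obtain ⟨b', b'', B, h1, h2, h3, h4, h5⟩ := exists_adapted_bases_fiber v h hD hD0 hs
    (by rw [Module.finrank_eq_card_basis t, Fintype.card_fin])
    (by rw [Module.finrank_eq_card_basis c, Fintype.card_fin])
  rw [wedgeNorm_eq_norm_det h1, wedgeNorm_eq_norm_det h2,
    wedgeNorm_eq_norm_det (h3.reindex finSumFinEquiv), Module.Basis.det_reindex, ← norm_mul]
  congr 1
  have h6 : (fun i => toFiber v (C.reindex finSumFinEquiv i)) ∘ finSumFinEquiv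
      = Sum.elim (fun i => fiberLin v (mulSection hD s) (toFiber v (t i)))
        (fun i => toFiber v (C (Sum.inr i))) := by
    ext i
    rw [Function.comp_apply, Module.Basis.reindex_apply, Equiv.symm_apply_apply]
    rcases i with i | i
    · rw [hCl, toFiber_baseChange]
      rfl
    · rfl
  have h7 : ∀ x, fiberLin v (vanishing hD s).mkQ (fiberLin v (mulSection hD s) x) = 0 := fun x =>
    (exact_mulSection_mkQ (ComplexAt v) (algebraMap_complexAt_injective v) hD s _).mpr ⟨x, rfl⟩
  rw [h6, det_sum_eq_mul _ _ h7 B b' b'' h4 h5]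
  congr 2
  funext i
  rw [← hCr, toFiber_baseChange]
  rfl

end InfinitePlaces

/-! ### Comparison of the degrees -/

section Degrees

variable {K : Type*} [Field K] [NumberField K] {E : Type*} [AddCommGroup E] [Module (𝓞 K) E]
  [Module.Finite (𝓞 K) E]

theorem finrank_tensor (M : Type*) [AddCommGroup M] [Module (𝓞 K) M] :
    Module.finrank K (K ⊗[𝓞 K] M) = Module.finrank (𝓞 K) M :=
  (TensorProduct.isBaseChange (𝓞 K) M K).finrank_eq

theorem finrank_tensor_symPow {n : ℕ} (hn : Module.finrank (𝓞 K) E = n + 1) (D : ℕ) :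
    Module.finrank K (K ⊗[𝓞 K] SymPow (𝓞 K) E D) = (n + D).choose n := by
  let σ : Module.Basis (Fin (n + 1)) K (K ⊗[𝓞 K] E) :=
    Module.finBasisOfFinrankEq K _ ((finrank_tensor E).trans hn)
  rw [Module.finrank_eq_card_basis (monomialBasis σ D), Fintype.card_coe,
    card_multiIndices n D (Fintype.card_fin _)]

theorem wedgeNorm_pos {M : Type*} [AddCommGroup M] [Module (𝓞 K) M] [Module.Finite (𝓞 K) M]
    (v : InfinitePlace K) {r : ℕ} {N : Fiber v M → ℝ} {b : Module.Basis (Fin r) ℂ (Fiber v M)}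
    (hb : IsAdaptedBasis N b) (σ : Module.Basis (Fin r) K (K ⊗[𝓞 K] M)) :
    0 < wedgeNorm N fun i => toFiber v (σ i) := by
  rw [wedgeNorm_eq_norm_det hb]
  exact norm_pos_iff.mpr (det_toFiber_ne_zero v b σ)

theorem sum_mult_eq_finrank :
    ∑ v : InfinitePlace K, (v.mult : ℝ) = Module.finrank ℚ K := by
  exact_mod_cast InfinitePlace.sum_mult_eq (K := K)

variable [Module.Projective (𝓞 K) E] (h : HermitianMetric (K := K) E) {δ D : ℕ}

theorem tmul_fiber_ne_zero (v : InfinitePlace K) {s : SymPow (𝓞 K) E D} (hs : s ≠ 0) :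
    ((1 : ComplexAt v) ⊗ₜ[𝓞 K] s) ≠ 0 := by
  have h1 : ((1 : ComplexAt v) ⊗ₜ[𝓞 K] s) = toFiber v ((1 : K) ⊗ₜ[𝓞 K] s) := by
    rw [toFiber_tmul, map_one]
  intro h0
  refine one_tmul_ne_zero (K := K) hs ?_
  let σ := Module.finBasis K (K ⊗[𝓞 K] SymPow (𝓞 K) E D)
  refine σ.repr.map_eq_zero_iff.mp (Finsupp.ext fun i => ?_)
  have h2 := fiberBasis_repr_toFiber v σ ((1 : K) ⊗ₜ[𝓞 K] s) i
  rw [← h1, h0, map_zero, Finsupp.zero_apply, eq_comm, map_eq_zero] at h2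
  exact h2

/-- The archimedean part of the comparison of the induced norms with the symmetric norms, which
follows from the inequality of Bombieri. -/
theorem log_wedgeNorm_sub_ge (v : InfinitePlace K) (hD : δ ≤ D) {s : SymPow (𝓞 K) E δ}
    (hs : s ≠ 0) {r : ℕ} (t : Module.Basis (Fin r) K (K ⊗[𝓞 K] SymPow (𝓞 K) E (D - δ))) :
    Real.log (wedgeNorm (bundleSymNorm h (D - δ) v) fun i => toFiber v (t i))
      + r * (Real.log (bundleSymNorm h δ v (1 ⊗ₜ s)) - 1 / 2 * Real.log (D.choose δ))
      ≤ Real.log (wedgeNorm (bundleSubspaceNorm h hD s v) fun i => toFiber v (t i)) := by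
  obtain ⟨b, hb⟩ := exists_isAdaptedBasis_bundleSymNorm v h (D - δ) (r := r)
    (by rw [Module.finrank_eq_card_basis t, Fintype.card_fin])
  have hs0 : 0 < bundleSymNorm h δ v (1 ⊗ₜ s) := bundleSymNorm_pos v h (tmul_fiber_ne_zero v hs)
  have hch : (0 : ℝ) < D.choose δ := Nat.cast_pos.mpr (Nat.choose_pos hD)
  have hc : 0 < bundleSymNorm h δ v (1 ⊗ₜ s) / √(D.choose δ) :=
    div_pos hs0 (Real.sqrt_pos.mpr hch)
  have hpos := wedgeNorm_pos v hb t
  have h1 := pow_mul_wedgeNorm_le (bundleSymNorm_nonneg v h (D - δ)) hc.le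
    (mul_bundleSymNorm_le v h hD s) fun i => toFiber v (t i)
  have h2 := Real.log_le_log (mul_pos (pow_pos hc r) hpos) h1
  rw [Real.log_mul (pow_pos hc r).ne' hpos.ne', Real.log_pow,
    Real.log_div hs0.ne' (Real.sqrt_pos.mpr hch).ne', Real.log_sqrt hch.le] at h2
  linarith

theorem sum_log_wedgeNorm_sub_ge (hD : δ ≤ D) {s : SymPow (𝓞 K) E δ} (hs : s ≠ 0) {r : ℕ}
    (t : Module.Basis (Fin r) K (K ⊗[𝓞 K] SymPow (𝓞 K) E (D - δ))) :
    ∑ v : InfinitePlace K, (v.mult : ℝ)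
        * Real.log (wedgeNorm (bundleSymNorm h (D - δ) v) fun i => toFiber v (t i))
      + r * (∑ v : InfinitePlace K, (v.mult : ℝ) * Real.log (bundleSymNorm h δ v (1 ⊗ₜ s))
        - Module.finrank ℚ K * (1 / 2 * Real.log (D.choose δ)))
      ≤ ∑ v : InfinitePlace K, (v.mult : ℝ)
        * Real.log (wedgeNorm (bundleSubspaceNorm h hD s v) fun i => toFiber v (t i)) := by
  rw [← sum_mult_eq_finrank, Finset.sum_mul, ← Finset.sum_sub_distrib, Finset.mul_sum,
    ← Finset.sum_add_distrib]
  refine Finset.sum_le_sum fun v _ => ?_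
  refine le_trans (le_of_eq ?_)
    (mul_le_mul_of_nonneg_left (log_wedgeNorm_sub_ge h v hD hs t) (Nat.cast_nonneg v.mult))
  ring

/-- The degree of the bundle of sections with the induced norms is bounded in terms of the one with
the symmetric norms. Only the infinite places contribute to the difference of these degrees; the
finite places contribute to the degree of `s` with the right sign, since `s` is integral. -/
theorem normalizedDegree_sub_le {n : ℕ} (hn : Module.finrank (𝓞 K) E = n + 1) (hD : δ ≤ D)
    (hD0 : 0 < D) {s : SymPow (𝓞 K) E δ} (hs : s ≠ 0) :
    normalizedDegree (bundleSubspaceNorm h hD s)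
      ≤ normalizedDegree (bundleSymNorm h (D - δ))
        + ((n + (D - δ)).choose n : ℝ)
          * (normalizedDegreeOf (bundleSymNorm h δ) s + 1 / 2 * Real.log (D.choose δ)) := by
  have hr := finrank_tensor_symPow hn (D - δ)
  let t := Module.finBasisOfFinrankEq K (K ⊗[𝓞 K] SymPow (𝓞 K) E (D - δ)) hr
  rw [normalizedDegree_eq (fun v => by
      obtain ⟨b', -, -, h1, -⟩ := exists_adapted_bases_fiber v h hD hD0 hs hr rfl
      exact ⟨b', h1⟩) t,
    normalizedDegree_eq (fun v => exists_isAdaptedBasis_bundleSymNorm v h (D - δ) hr) t,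
    normalizedDegreeOf]
  have hfin : ∑ᶠ w : FinitePlace K,
      Real.log (modelNorm (lattice (SymPow (𝓞 K) E δ)) w (1 ⊗ₜ s)) ≤ 0 := by
    rw [← neg_nonneg, ← finsum_neg_distrib]
    exact finsum_nonneg fun w => neg_nonneg.mpr
      (Real.log_nonpos (modelNorm_nonneg _) (modelNorm_tmul_le_one s))
  have hinf := sum_log_wedgeNorm_sub_ge h hD hs t
  have hd : (0 : ℝ) < Module.finrank ℚ K := Nat.cast_pos.mpr Module.finrank_pos
  set r := (n + (D - δ)).choose n
  have hr0 : (0 : ℝ) ≤ r := Nat.cast_nonneg r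
  have hmul := mul_nonpos_of_nonneg_of_nonpos hr0 hfin
  rw [div_le_iff₀ hd]
  field_simp
  linarith

/-- The logarithm of a product inequality for positive functions, summed over the index set; finite
supports are needed, as `∑ᶠ` is zero otherwise. -/
theorem finsum_log_add_le {α : Type*} {a b c d : α → ℝ} (r : ℕ) (ha : ∀ i, 0 < a i)
    (hb : ∀ i, 0 < b i) (hc : ∀ i, 0 < c i) (h : ∀ i, a i * b i * c i ^ r ≤ d i)
    (fa : Function.HasFiniteSupport fun i => Real.log (a i))
    (fb : Function.HasFiniteSupport fun i => Real.log (b i))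
    (fc : Function.HasFiniteSupport fun i => Real.log (c i))
    (fd : Function.HasFiniteSupport fun i => Real.log (d i)) :
    ∑ᶠ i, Real.log (a i) + ∑ᶠ i, Real.log (b i) + r * ∑ᶠ i, Real.log (c i)
      ≤ ∑ᶠ i, Real.log (d i) := by
  have fab := (fa.union fb).subset (Function.support_add _ _)
  have frc : Function.HasFiniteSupport fun i => (r : ℝ) * Real.log (c i) :=
    fc.subset fun i hi h0 => hi (by simp only [h0, mul_zero])
  rw [mul_finsum, ← finsum_add_distrib fa fb, ← finsum_add_distrib fab frc, ← sub_nonneg,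
    ← finsum_sub_distrib fd ((fab.union frc).subset (Function.support_add _ _))]
  refine finsum_nonneg fun i => sub_nonneg.mpr ?_
  have h1 := Real.log_le_log (mul_pos (mul_pos (ha i) (hb i)) (pow_pos (hc i) r)) (h i)
  rwa [Real.log_mul (mul_pos (ha i) (hb i)).ne' (pow_pos (hc i) r).ne',
    Real.log_mul (ha i).ne' (hb i).ne', Real.log_pow] at h1

/-- The contributions of the finite places: the norms of the determinants are subject to
`modelNorm_mul_pow_le` at each of them. -/
theorem finsum_log_modelNorm_le (hD : δ ≤ D) {s : SymPow (𝓞 K) E δ} (hs : s ≠ 0) {r r₁ : ℕ}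
    (t : Module.Basis (Fin r) K (K ⊗[𝓞 K] SymPow (𝓞 K) E (D - δ)))
    (c : Module.Basis (Fin r₁) K (K ⊗[𝓞 K] HypersurfaceSections hD s))
    (C : Module.Basis (Fin r ⊕ Fin r₁) K (K ⊗[𝓞 K] SymPow (𝓞 K) E D))
    (hCl : ∀ j, C (Sum.inl j) = (mulSection hD s).baseChange K (t j))
    (hCr : ∀ i, (vanishing hD s).mkQ.baseChange K (C (Sum.inr i)) = c i) :
    ∑ᶠ w : FinitePlace K, Real.log (modelNorm
        (wedgeLattice (HypersurfaceSections hD s) r₁) w (exteriorPower.ιMulti K r₁ c))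
      + ∑ᶠ w : FinitePlace K, Real.log (modelNorm (wedgeLattice (SymPow (𝓞 K) E (D - δ)) r) w
        (exteriorPower.ιMulti K r t))
      + r * ∑ᶠ w : FinitePlace K,
        Real.log (modelNorm (lattice (SymPow (𝓞 K) E δ)) w (1 ⊗ₜ s))
      ≤ ∑ᶠ w : FinitePlace K, Real.log (modelNorm (wedgeLattice (SymPow (𝓞 K) E D) (r + r₁)) w
        (exteriorPower.ιMulti K (r + r₁) (C.reindex finSumFinEquiv))) :=
  finsum_log_add_le r (fun w => modelNorm_wedgeLattice_pos w c)
    (fun w => modelNorm_wedgeLattice_pos w t)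
    (fun w => modelNorm_lattice_pos w (one_tmul_ne_zero (K := K) hs))
    (fun w => modelNorm_mul_pow_le w hD hs t c C hCl hCr)
    (hasFiniteSupport_log_modelNorm_wedgeLattice c)
    (hasFiniteSupport_log_modelNorm_wedgeLattice t)
    (hasFiniteSupport_log_modelNorm_lattice (one_tmul_ne_zero (K := K) hs))
    (hasFiniteSupport_log_modelNorm_wedgeLattice (C.reindex finSumFinEquiv))

/-- The contributions of the infinite places: the norms are induced by inner products, so that the
determinant is multiplicative. -/
theorem sum_log_wedgeNorm_eq_add (hD : δ ≤ D) (hD0 : 0 < D) {s : SymPow (𝓞 K) E δ} (hs : s ≠ 0)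
    {r r₁ : ℕ} (t : Module.Basis (Fin r) K (K ⊗[𝓞 K] SymPow (𝓞 K) E (D - δ)))
    (c : Module.Basis (Fin r₁) K (K ⊗[𝓞 K] HypersurfaceSections hD s))
    (C : Module.Basis (Fin r ⊕ Fin r₁) K (K ⊗[𝓞 K] SymPow (𝓞 K) E D))
    (hCl : ∀ j, C (Sum.inl j) = (mulSection hD s).baseChange K (t j))
    (hCr : ∀ i, (vanishing hD s).mkQ.baseChange K (C (Sum.inr i)) = c i) :
    ∑ v : InfinitePlace K, (v.mult : ℝ) * Real.log
        (wedgeNorm (bundleSymNorm h D v) fun i => toFiber v (C.reindex finSumFinEquiv i))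
      = ∑ v : InfinitePlace K, (v.mult : ℝ) * Real.log
        (wedgeNorm (bundleSubspaceNorm h hD s v) fun i => toFiber v (t i))
      + ∑ v : InfinitePlace K, (v.mult : ℝ) * Real.log
        (wedgeNorm (hypersurfaceJohnNorm h hD s v) fun i => toFiber v (c i)) := by
  rw [← Finset.sum_add_distrib]
  refine Finset.sum_congr rfl fun v _ => ?_
  obtain ⟨b', b'', -, h1, h2, -⟩ := exists_adapted_bases_fiber v h hD hD0 hs
    (by rw [Module.finrank_eq_card_basis t, Fintype.card_fin])
    (by rw [Module.finrank_eq_card_basis c, Fintype.card_fin])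
  rw [wedgeNorm_mul_wedgeNorm v h hD hD0 hs t c C hCl hCr,
    Real.log_mul (wedgeNorm_pos v h1 t).ne' (wedgeNorm_pos v h2 c).ne', mul_add]

set_option maxHeartbeats 600000 in
/-- The degree of the bundle of sections on the hypersurface is bounded below in terms of the
degrees of the bundles of sections on the projective space. -/
theorem le_normalizedDegree_hypersurface {n : ℕ} (hn : Module.finrank (𝓞 K) E = n + 1)
    (hD : δ ≤ D) (hD0 : 0 < D) {s : SymPow (𝓞 K) E δ} (hs : s ≠ 0) :
    normalizedDegree (bundleSymNorm h D) - normalizedDegree (bundleSymNorm h (D - δ))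
        - ((n + (D - δ)).choose n : ℝ)
          * (normalizedDegreeOf (bundleSymNorm h δ) s + 1 / 2 * Real.log (D.choose δ))
      ≤ normalizedDegree (hypersurfaceJohnNorm h hD s) := by
  obtain ⟨r, hrn⟩ : ∃ r, r = (n + (D - δ)).choose n := ⟨_, rfl⟩
  obtain ⟨r₁, hr₁⟩ : ∃ r₁, Module.finrank K (K ⊗[𝓞 K] HypersurfaceSections hD s) = r₁ := ⟨_, rfl⟩
  have hr := (finrank_tensor_symPow hn (D - δ)).trans hrn.symm
  rw [← hrn]
  obtain ⟨t⟩ : Nonempty (Module.Basis (Fin r) K (K ⊗[𝓞 K] SymPow (𝓞 K) E (D - δ))) :=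
    ⟨Module.finBasisOfFinrankEq K _ hr⟩
  obtain ⟨c⟩ : Nonempty (Module.Basis (Fin r₁) K (K ⊗[𝓞 K] HypersurfaceSections hD s)) :=
    ⟨Module.finBasisOfFinrankEq K _ hr₁⟩
  have hsurj : Function.Surjective ((vanishing hD s).mkQ.baseChange K) := by
    rw [LinearMap.baseChange_eq_ltensor]
    exact LinearMap.lTensor_surjective K (vanishing hD s).mkQ_surjective
  choose y hy using fun i => hsurj (c i)
  obtain ⟨C, hCl, hCr⟩ := exists_basis_sum (baseChange_mulSection_injective hD hs)
    (exact_baseChange_mulSection hD s) t c y hy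
  have hCr' : ∀ i, (vanishing hD s).mkQ.baseChange K (C (Sum.inr i)) = c i := fun i => by
    rw [hCr, hy]
  have hrD : Module.finrank K (K ⊗[𝓞 K] SymPow (𝓞 K) E D) = r + r₁ := by
    rw [Module.finrank_eq_card_basis (C.reindex finSumFinEquiv), Fintype.card_fin]
  have hadF : ∀ v, ∃ b : Module.Basis (Fin r₁) ℂ (Fiber v (HypersurfaceSections hD s)),
      IsAdaptedBasis (hypersurfaceJohnNorm h hD s v) b := fun v => by
    obtain ⟨-, b'', -, -, h2, -⟩ := exists_adapted_bases_fiber v h hD hD0 hs hr hr₁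
    exact ⟨b'', h2⟩
  have eF := normalizedDegree_eq hadF c
  have eT := normalizedDegree_eq
    (fun v => exists_isAdaptedBasis_bundleSymNorm v h (D - δ) hr) t
  have eD := normalizedDegree_eq (fun v => exists_isAdaptedBasis_bundleSymNorm v h D hrD)
    (C.reindex finSumFinEquiv)
  have hfin := finsum_log_modelNorm_le hD hs t c C hCl hCr'
  have hinf1 := sum_log_wedgeNorm_eq_add h hD hD0 hs t c C hCl hCr'
  have hinf := sum_log_wedgeNorm_sub_ge h hD hs t
  have hd : (0 : ℝ) < Module.finrank ℚ K := Nat.cast_pos.mpr Module.finrank_pos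
  rw [eF, eT, eD, hinf1, normalizedDegreeOf, le_div_iff₀ hd]
  field_simp
  linarith

end Degrees

end ArakelovHS

end

theorem mainTheorem5 {K : Type*} [Field K] [NumberField K] {E : Type*} [AddCommGroup E]
    [Module (𝓞 K) E] [Module.Finite (𝓞 K) E] [Module.Projective (𝓞 K) E] (n : ℕ)
    (hn : Module.finrank (𝓞 K) E = n + 1) (h : HermitianMetric (K := K) E) (δ D : ℕ)
    (hD : δ + 1 ≤ D) (s : SymPow (𝓞 K) E δ) (hs : s ≠ 0) :
    -- the upper bound for the bundle `E_{D-δ}` with the subspace norms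
    normalizedDegree (bundleSubspaceNorm h (Nat.le_of_succ_le hD) s)
      ≤ normalizedDegree (bundleSymNorm h (D - δ))
        + ((n + (D - δ)).choose n : ℝ)
          * (normalizedDegreeOf (bundleSymNorm h δ) s + 1 / 2 * Real.log (D.choose δ))
    -- `johnConst n D` is the constant which relates the norms of John and the symmetric norms
    ∧ (∀ (v : InfinitePlace K) (x : Fiber v (SymPow (𝓞 K) E D)), x ≠ 0 →
        Real.log (bundleJohnNorm h D v x) = Real.log (bundleSymNorm h D v x) + johnConst n D)
    -- the lower bound for the bundle `F_{D,J}`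
    ∧ normalizedDegree (bundleSymNorm h D) - normalizedDegree (bundleSymNorm h (D - δ))
        - ((n + (D - δ)).choose n : ℝ)
          * (normalizedDegreeOf (bundleSymNorm h δ) s + 1 / 2 * Real.log (D.choose δ))
        - (Module.finrank (𝓞 K) (HypersurfaceSections (Nat.le_of_succ_le hD) s) : ℝ)
          * johnConst n D
      ≤ normalizedDegree (hypersurfaceJohnNorm h (Nat.le_of_succ_le hD) s) := by
  have hD0 : 0 < D := Nat.lt_of_lt_of_le (Nat.succ_pos δ) hD
  refine ⟨normalizedDegree_sub_le h hn _ hD0 hs, fun v x _ => ?_, ?_⟩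
  · rw [bundleJohnNorm_eq v h hD0, johnConst_eq_zero n hD0, add_zero]
  · rw [johnConst_eq_zero n hD0, mul_zero, sub_zero]
    exact le_normalizedDegree_hypersurface h hn _ hD0 hs
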